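/- Let $\mathrm{sim}$ be an LSHable similarity measure on a set $X$: there is a random hash function $h$ on $X$ with $\Pr[h(x)=h(y)]=\mathrm{sim}(x,y)$ for all $x,y\in X$. Fix constants $\lambda,\varphi\in(0,1)$ and an integer constant $\mathtt{limit}\ge 1$; the constants in $O(\cdot)$ and $\tilde O(\cdot)$ below depend only on these, and $\tilde O(f)$ means $O(f\cdot(1+\log n)^{c})$ for a constant $c$ (read $\log n$ as $1+\log n$ when $n=1$). **Algorithm.** The input is a set $S\subseteq X$ of $n\ge 1$ points. Draw $h_1,\dots,h_t$ independently with the law of $h$ and replace every point $x$ by the token set $f(x)=\{(i,h_i(x)) : 1\le i\le t\}$. Put $\varepsilon=\log(1/\lambda)/\log n$. Then run $R$ independent repetitions of the recursive procedure $\mathrm{CPSJoin}$, started on $S$. A call $\mathrm{CPSJoin}(S')$ does the following. 1. Brute force: while $|S'|>\mathtt{limit}$ and some $x\in S'$ satisfies $\frac{1}{|S'|-1}\sum_{y\in S'\setminus\{x\}}|f(x)\cap f(y)|/t>(1-\varepsilon)\lambda$, compute $\mathrm{sim}(x,y)$ for all other $y\in S'$, report the pairs with similarity at least $\lambda$ (and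 $(x,x)$), and remove $x$ from $S'$. As soon as $|S'|\le\mathtt{limit}$, compare all pairs in $S'$, report those with similarity at least $\lambda$, and return. 2. Splitting: draw a fresh random function $r$ from tokens to $[0,1]$ with independent uniform values, and for every token $j$ with $r(j)<\frac{1}{\lambda t}$ that lies in $f(x)$ for some remaining $x\in S'$, call $\mathrm{CPSJoin}(\{x\in S' : j\in f(x)\})$. Time is the number of elementary steps; evaluating a hash function, computing one similarity, one arithmetic or dictionary operation, and reporting a pair are one step each. Working space is the peak number of memory words in use, not counting the input and the output. **Theorem.** There are choices $t=t(n)\ge 1$ with $t=\tilde O(1)$ and $R=R(n)=O(\log^2 n)$, depending only on $n,\lambda,\varphi,\mathtt{limit}$, such that for every LSHable $\mathrm{sim}$ and every set $S$ of $n\ge1$ points the algorithm solves the $(\lambda,\varphi)$-similarity self-join problem on $S$: its output $L$ always satisfies $L\subseteq S\bowtie_\lambda S=\{(x,y)\in S\times S : \mathrm{sim}(x,y)\ge\lambda\}$, and $\Pr[(x,y)\in L]\ge\varphi$ for every $(x,y)\in S\bowtie_\lambda S$. Moreover, with $$W=\sum_{x\in S}\min_{k_x\in\{0,1,2,\dots\}}\Bigl(\sum_{y\in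 S\setminus\{x\}}(\mathrm{sim}(x,y)/\lambda)^{k_x}+(1/\lambda)^{k_x}\Bigr),$$ the cost of the best strategy with an individual stopping depth $k_x$ for every point $x$: * the expected running time is $\tilde O(W)$; * the expected number of similarity computations is $O(W)$ per repetition, that is, at most $O(R\cdot W)$ in total; * the working space is $\tilde O(n)$ with high probability: for every $a>0$ there is a constant $D_a$, depending only on $a,\lambda,\varphi,\mathtt{limit}$, such that the working space exceeds $D_a\,n\,(1+\log n)^c$ with probability at most $n^{-a}$, where $c$ does not depend on $a$. -/

import Mathlib

open MeasureTheory
open scoped ENNReal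

noncomputable section

namespace CPSJoin

/-! ### Computations with a cost account -/

/-- A computation over records named by references of type `ι`, together with what it costs:
`time` is the number of elementary steps, `cmps` the number of similarity computations (each of
them is also an elementary step), `space` the peak number of words of working memory in use, and
`out` the set of pairs written to the output. -/
structure Exec (ι : Type*) (α : Type*) where
  val : α
  time : ℕ
  cmps : ℕ
  space : ℕ
  out : Set (ι × ι)

namespace Exec

variable {ι α σ : Type*}

/-- Return a value at no cost. -/
def ret (a : α) : Exec ι α := ⟨a, 0, 0, 0, ∅⟩

/-- Sequential composition: times add up, and the peak memory is the larger of the two peaks.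
Memory that stays occupied while the second computation runs is accounted for by `hold`. -/
def bind (e : Exec ι α) (f : α → Exec ι σ) : Exec ι σ :=
  ⟨(f e.val).val, e.time + (f e.val).time, e.cmps + (f e.val).cmps,
    max e.space (f e.val).space, e.out ∪ (f e.val).out⟩

/-- `m` elementary steps (arithmetic on words and reals, dictionary look-up or update, evaluation
of a hash function, copying of a word). -/
def ticks (m : ℕ) : Exec ι Unit := ⟨(), m, 0, 0, ∅⟩

/-- Compute one similarity, whose value is `s`. -/
def similarity (s : ℝ) : Exec ι ℝ := ⟨s, 1, 1, 0, ∅⟩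

/-- Write one pair to the output. -/
def report (q : ι × ι) : Exec ι Unit := ⟨(), 1, 0, 0, {q}⟩

/-- Run `e` while `w` further words of working memory are occupied. -/
def hold (w : ℕ) (e : Exec ι α) : Exec ι α := { e with space := w + e.space }

/-- A loop over a list that carries a state. -/
def foldE (f : σ → α → Exec ι σ) : List α → σ → Exec ι σ
  | [], s => ret s
  | a :: l, s => (f s a).bind fun s' => foldE f l s'

/-- A loop over a list. -/
def forEach (l : List α) (f : α → Exec ι Unit) : Exec ι Unit :=
  foldE (fun _ a => f a) l ()

end Exec

open Exec

/-! ### The algorithm -/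

/-- The data and the global parameters: `tok x` lists the tokens of the record with reference `x`,
all records have `t` tokens, `sim` is the similarity that decides which pairs are reported, `lam`
is the threshold, and `limit`, `eps` are the parameters of the brute force step. -/
structure Input (ι τ : Type*) where
  tok : ι → List τ
  t : ℕ
  sim : ι → ι → ℝ
  lam : ℝ
  limit : ℕ
  eps : ℝ

variable {ι τ : Type*} (I : Input ι τ)

open scoped Classical in
/-- `BruteForcePoint(S, x, λ)`: compare `x` with every other point of `S` and report the pairs of
similarity at least `λ`, in both orders; the pair `(x, x)` is reported without a comparison. -/
def bruteForcePoint (S : List ι) (x : ι) : Exec ι Unit :=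
  forEach S fun y =>
    if y = x then report (x, x)
    else (similarity (I.sim x y)).bind fun s =>
      if I.lam ≤ s then (report (x, y)).bind fun _ => report (y, x) else ret ()

/-- `BruteForcePairs(S, λ)`. -/
def bruteForcePairs (S : List ι) : Exec ι Unit :=
  forEach S fun x => bruteForcePoint I S x

open scoped Classical in
/-- The dictionary `count`: for every token the number of its occurrences in `S`. -/
def countTokens (S : List ι) : Exec ι (τ → ℕ) :=
  foldE (fun c x =>
    foldE (fun c j => (ticks 1).bind fun _ => ret (Function.update c j (c j + 1))) (I.tok x) c)
    S (fun _ => 0)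

open scoped Classical in
/-- Look for the first `x` in a list with
`(1 / (m - 1)) * ∑ j ∈ x, (count j - 1) / t > (1 - ε) λ`. -/
def findHeavy (count : τ → ℕ) (m : ℕ) : List ι → Exec ι (Option ι)
  | [] => ret none
  | x :: l =>
    (foldE (fun (s : ℝ) j => (ticks 1).bind fun _ => ret (s + ((count j : ℝ) - 1) / I.t))
      (I.tok x) 0).bind fun s =>
    (ticks 1).bind fun _ =>
    if (1 - I.eps) * I.lam < 1 / ((m : ℝ) - 1) * s then ret (some x)
    else findHeavy count m l

open scoped Classical in
/-- The recursion of `BruteForce`; the first argument bounds `|S|` (the recursive call is on a set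
with one point less). The dictionary `count` occupies at most two words per token occurrence and
is released before the recursive call. -/
def bruteForceAux : ℕ → List ι → Exec ι (List ι)
  | 0, S => (ticks 1).bind fun _ => (bruteForcePairs I S).bind fun _ => ret []
  | m + 1, S => (ticks 1).bind fun _ =>
    if S.length ≤ I.limit then (bruteForcePairs I S).bind fun _ => ret []
    else
      (hold (2 * (S.map fun x => (I.tok x).length).sum)
        ((countTokens I S).bind fun count => findHeavy I count S.length S)).bind fun found =>
      match found with
      | none => ret S
      | some x =>
        (bruteForcePoint I S x).bind fun _ =>
        (ticks S.length).bind fun _ =>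
        bruteForceAux m (S.erase x)

/-- `BruteForce(S, λ)`: the value is the set of points that have not been removed. -/
def bruteForce (S : List ι) : Exec ι (List ι) := bruteForceAux I S.length S

open scoped Classical in
/-- `S_j ← S_j ∪ {x}` in a dictionary that stores the nonempty sets `S_j` only. -/
def addToBucket (j : τ) (x : ι) : List (τ × List ι) → List (τ × List ι)
  | [] => [(j, [x])]
  | b :: B => if b.1 = j then (j, x :: b.2) :: B else b :: addToBucket j x B

open scoped Classical in
/-- The splitting step with hash function `r`. -/
def split (r : τ → ℝ) (S : List ι) : Exec ι (List (τ × List ι)) :=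
  foldE (fun B x =>
    foldE (fun B j => (ticks 1).bind fun _ =>
      if r j < 1 / (I.lam * (I.tok x).length) then
        (ticks 1).bind fun _ => ret (addToBucket j x B)
      else ret B) (I.tok x) B) S []

/-- `CPSJoin(S, λ)` at the node with path `p` of the recursion tree, where `r p` is the hash
function drawn at that node. The first argument bounds the recursion depth: calls below that depth
are cut off. The algorithm without cut-off is recovered by letting the bound tend to infinity, see
`totalTime` and the definitions after it. A call occupies memory for its own copy of `S`, the seed
of its hash function, and the sets `S_j`, until it returns. -/
def cpsJoin (r : List τ → τ → ℝ) : ℕ → List τ → List ι → Exec ι Unit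
  | 0, _, _ => ret ()
  | k + 1, p, S =>
    hold (S.length + 1) <|
      (ticks (S.length + 1)).bind fun _ =>
      (bruteForce I S).bind fun S' =>
      (split I (r p) S').bind fun B =>
      hold (B.map fun b => b.2.length + 1).sum
        (forEach B fun b => (ticks 1).bind fun _ => cpsJoin r k (p ++ [b.1]) b.2)

/-! ### LSHable similarity measures and the join algorithm -/

/-- A random hash function `h`, drawn from `ν`, with `Pr[h(x) = h(y)] = sim(x, y)` for all points
`x`, `y`. A similarity is LSHable if such a family exists. -/
def IsLSHFamily {X H β : Type*} [MeasurableSpace H] (ν : Measure H) (hash : H → X → β)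
    (sim : X → X → ℝ) : Prop :=
  ∀ x y, MeasurableSet {h | hash h x = hash h y} ∧ ν.real {h | hash h x = hash h y} = sim x y

section Join

variable {X H β : Type*}

/-- The input for `CPSJoin` on the points `pts 0, …, pts (n - 1)` after the embedding
`f(x) = {(i, h_i(x)) | i = 1, …, t}`, with `ε = log(1/λ) / log n`. -/
def embeddedInput (hash : H → X → β) (sim : X → X → ℝ) (lam : ℝ) (limit : ℕ) {n t : ℕ}
    (pts : Fin n → X) (g : Fin t → H) : Input (Fin n) (Fin t × β) where
  tok x := (List.finRange t).map fun i => (i, hash (g i) (pts x))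
  t := t
  sim x y := sim (pts x) (pts y)
  lam := lam
  limit := limit
  eps := Real.log (1 / lam) / Real.log n

/-- The random choices of the repetitions of `CPSJoin`: for every repetition, every node of the
recursion tree and every token, a number in `[0, 1]`. -/
abbrev Seeds (τ : Type*) : Type _ := ℕ × List τ × τ → unitInterval

/-- The seeds are independent and uniform. -/
def seedMeasure (τ : Type*) : Measure (Seeds τ) :=
  Measure.infinitePi fun _ => (volume : Measure unitInterval)

/-- Embed the points by the hash functions `g` (`n * t` hash evaluations, `n * t` words), then run
`R` repetitions of `CPSJoin`, all cut off at recursion depth `k`. -/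
def simJoin (hash : H → X → β) (sim : X → X → ℝ) (lam : ℝ) (limit : ℕ) (R : ℕ) {n t : ℕ}
    (pts : Fin n → X) (g : Fin t → H) (ω : Seeds (Fin t × β)) (k : ℕ) : Exec (Fin n) Unit :=
  hold (n * t) <|
    (ticks (n * t)).bind fun _ =>
    forEach (List.range R) fun i => (ticks 1).bind fun _ =>
      cpsJoin (embeddedInput hash sim lam limit pts g) (fun p j => (ω (i, p, j) : ℝ)) k []
        (List.finRange n)

end Join

/-- The running time without cut-off (`⊤` if the recursion does not terminate). -/
def totalTime {ι : Type*} (e : ℕ → Exec ι Unit) : ℝ≥0∞ := ⨆ k, ((e k).time : ℝ≥0∞)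

/-- The number of similarity computations without cut-off. -/
def totalCmps {ι : Type*} (e : ℕ → Exec ι Unit) : ℝ≥0∞ := ⨆ k, ((e k).cmps : ℝ≥0∞)

/-- The working space without cut-off. -/
def totalSpace {ι : Type*} (e : ℕ → Exec ι Unit) : ℝ≥0∞ := ⨆ k, ((e k).space : ℝ≥0∞)

/-- The output without cut-off. -/
def totalOut {ι : Type*} (e : ℕ → Exec ι Unit) : Set (ι × ι) := ⋃ k, (e k).out

/-- Expectation of a quantity that depends on `t` independent hash functions with law `ν` and on
the seeds, which are independent of the hash functions. -/
def expect {H : Type*} [MeasurableSpace H] (ν : Measure H) (t : ℕ) (τ : Type*)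
    (F : (Fin t → H) → Seeds τ → ℝ≥0∞) : ℝ≥0∞ :=
  ∫⁻ g, ∫⁻ ω, F g ω ∂(seedMeasure τ) ∂(Measure.pi fun _ => ν)

/-- Probability of an event in the same setting. -/
def prob {H : Type*} [MeasurableSpace H] (ν : Measure H) (t : ℕ) (τ : Type*)
    (E : (Fin t → H) → Seeds τ → Prop) : ℝ≥0∞ :=
  ∫⁻ g, seedMeasure τ {ω | E g ω} ∂(Measure.pi fun _ => ν)

/-- The self-join: all pairs of points with similarity at least `lam`. -/
def joinSet {X : Type*} (sim : X → X → ℝ) (lam : ℝ) {n : ℕ} (pts : Fin n → X) :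
    Set (Fin n × Fin n) :=
  {q | lam ≤ sim (pts q.1) (pts q.2)}

/-- The cost `∑ x, min_k (∑ y ≠ x, (sim(x, y) / λ) ^ k + (1 / λ) ^ k)` of the best choice of
individual stopping depths. -/
def individualCost {X : Type*} (sim : X → X → ℝ) (lam : ℝ) {n : ℕ} (pts : Fin n → X) : ℝ :=
  ∑ x, ⨅ k : ℕ,
    (∑ y ∈ Finset.univ.erase x, (sim (pts x) (pts y) / lam) ^ k + (1 / lam) ^ k)

end CPSJoin

end

/-!
If two points share `m` of their `t` tokens, they lie together in about `(m / (λ t)) ^ k` calls at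
depth `k` in expectation, which the embedding turns into `(sim / λ) ^ k`; a single point lies in
about `(1 / λ) ^ k` of them. Give every point `x` of a call a potential: the expected number of
calls that contain `x`, and of pairs that contain `x`, at its own stopping depth `k_x`. At the root
this is the individual cost. The potential pays for all work: a point removed before depth `k_x` is,
by convexity, paid for by the pairs it would form at depth `k_x`, and a point that survives beyond
`k_x` is not heavy, so that splitting loses a fraction `ε` of its pairs, which pays for the call.

The same loss of a fraction `ε` per level leaves no pairs at depth `O(log² n)` with high
probability, which bounds the recursion stack. The calls that contain a given similar pair form a
nearly critical branching process, which survives `K` levels with probability of order `1 / K`.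
Hence `O(log² n)` repetitions find the pair with constant probability.
-/

noncomputable section

namespace CPSJoin

open Exec
open scoped Classical

attribute [simps] Exec.ret Exec.bind Exec.ticks Exec.similarity Exec.report Exec.hold

namespace Exec

variable {ι α σ : Type*}

lemma forEach_nil (f : α → Exec ι Unit) : forEach [] f = ret () := rfl

lemma forEach_cons (a : α) (l : List α) (f : α → Exec ι Unit) :
    forEach (a :: l) f = (f a).bind fun _ => forEach l f := rfl

lemma forEach_time (l : List α) (f : α → Exec ι Unit) :
    (forEach l f).time = (l.map fun a => (f a).time).sum := by
  induction l with
  | nil => rfl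
  | cons a l ih => simp [forEach_cons, ih]

lemma forEach_cmps (l : List α) (f : α → Exec ι Unit) :
    (forEach l f).cmps = (l.map fun a => (f a).cmps).sum := by
  induction l with
  | nil => rfl
  | cons a l ih => simp [forEach_cons, ih]

lemma mem_forEach_out (l : List α) (f : α → Exec ι Unit) (q : ι × ι) :
    q ∈ (forEach l f).out ↔ ∃ a ∈ l, q ∈ (f a).out := by
  induction l with
  | nil => simp [forEach_nil]
  | cons a l ih => simp [forEach_cons, ih]

lemma forEach_space_le {l : List α} {f : α → Exec ι Unit} {N : ℕ}
    (h : ∀ a ∈ l, (f a).space ≤ N) : (forEach l f).space ≤ N := by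
  induction l with
  | nil => simp [forEach_nil]
  | cons a l ih =>
    rw [List.forall_mem_cons] at h
    exact max_le h.1 (ih h.2)

lemma foldE_val (f : σ → α → Exec ι σ) (l : List α) (s : σ) :
    (foldE f l s).val = l.foldl (fun s a => (f s a).val) s := by
  induction l generalizing s with
  | nil => rfl
  | cons _ _ ih => exact ih _

lemma foldE_time_le {f : σ → α → Exec ι σ} {T : α → ℕ} (h : ∀ s a, (f s a).time ≤ T a)
    (l : List α) (s : σ) : (foldE f l s).time ≤ (l.map T).sum := by
  induction l generalizing s with
  | nil => rfl
  | cons a _ ih => exact add_le_add (h s a) (ih _)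

/-- A computation that only takes time: it compares and reports nothing and needs no working
memory of its own. -/
structure Quiet (e : Exec ι α) : Prop where
  cmps : e.cmps = 0
  space : e.space = 0
  out : e.out = ∅

lemma quiet_ret (a : α) : (ret a : Exec ι α).Quiet := ⟨rfl, rfl, rfl⟩

lemma quiet_ticks (m : ℕ) : (ticks m : Exec ι Unit).Quiet := ⟨rfl, rfl, rfl⟩

lemma Quiet.bind {e : Exec ι α} {f : α → Exec ι σ} (he : e.Quiet) (hf : ∀ a, (f a).Quiet) :
    (e.bind f).Quiet where
  cmps := by simp [he.cmps, (hf _).cmps]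
  space := by simp [he.space, (hf _).space]
  out := by simp [he.out, (hf _).out]

lemma quiet_foldE {f : σ → α → Exec ι σ} (h : ∀ s a, (f s a).Quiet) (l : List α) (s : σ) :
    (foldE f l s).Quiet := by
  induction l generalizing s with
  | nil => exact quiet_ret s
  | cons a l ih => exact (h s a).bind ih

end Exec

section BruteForce

variable {ι τ : Type*}

/-- Every record has exactly `t` distinct tokens. -/
structure Input.Regular (I : Input ι τ) : Prop where
  length_tok : ∀ x, (I.tok x).length = I.t
  nodup_tok : ∀ x, (I.tok x).Nodup

/-- The token set of a record. -/
def Input.tokens (I : Input ι τ) (x : ι) : Finset τ := (I.tok x).toFinset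

/-- The number of common tokens of two records. -/
def Input.overlap (I : Input ι τ) (x y : ι) : ℕ := (I.tokens x ∩ I.tokens y).card

/-- The condition under which the brute force step removes `x` from `S`, in terms of set overlaps
instead of the dictionary of token counts. -/
def Input.Heavy (I : Input ι τ) (S : List ι) (x : ι) : Prop :=
  (1 - I.eps) * I.lam <
    1 / ((S.length : ℝ) - 1) * ((∑ y ∈ S.toFinset.erase x, (I.overlap x y : ℝ)) / I.t)

/-- The pairs that may be reported: those on the diagonal and those that passed a comparison in one
of the two orders. -/
def Input.Reportable (I : Input ι τ) (q : ι × ι) : Prop :=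
  q.1 = q.2 ∨ I.lam ≤ I.sim q.1 q.2 ∨ I.lam ≤ I.sim q.2 q.1

variable {I : Input ι τ}

lemma Input.mem_tokens {x : ι} {j : τ} : j ∈ I.tokens x ↔ j ∈ I.tok x := List.mem_toFinset

lemma Input.Regular.card_tokens (hI : I.Regular) (x : ι) : (I.tokens x).card = I.t := by
  rw [Input.tokens, List.toFinset_card_of_nodup (hI.nodup_tok x), hI.length_tok]

lemma Input.Regular.sum_length_tok (hI : I.Regular) (S : List ι) :
    (S.map fun x => (I.tok x).length).sum = S.length * I.t := by
  simp [hI.length_tok]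

/-- One iteration of the loop `bruteForcePoint`. -/
def comparePoint (I : Input ι τ) (x y : ι) : Exec ι Unit :=
  if y = x then report (x, x)
  else (similarity (I.sim x y)).bind fun s =>
    if I.lam ≤ s then (report (x, y)).bind fun _ => report (y, x) else ret ()

lemma bruteForcePoint_eq_forEach (S : List ι) (x : ι) :
    bruteForcePoint I S x = forEach S (comparePoint I x) := rfl

lemma comparePoint_cmps (x y : ι) : (comparePoint I x y).cmps = if y = x then 0 else 1 := by
  unfold comparePoint
  split_ifs <;> simp [apply_ite Exec.cmps]

lemma comparePoint_time_le (x y : ι) : (comparePoint I x y).time ≤ 3 := by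
  by_cases hyx : y = x <;> by_cases hsim : I.lam ≤ I.sim x y <;> simp [comparePoint, hyx, hsim]

lemma comparePoint_space (x y : ι) : (comparePoint I x y).space = 0 := by
  by_cases hyx : y = x <;> by_cases hsim : I.lam ≤ I.sim x y <;> simp [comparePoint, hyx, hsim]

lemma mem_comparePoint_out {x y : ι} {q : ι × ι} :
    q ∈ (comparePoint I x y).out ↔
      (y = x ∨ I.lam ≤ I.sim x y) ∧ (q = (x, y) ∨ q = (y, x)) := by
  by_cases hyx : y = x
  · simp [comparePoint, hyx]
  · by_cases hsim : I.lam ≤ I.sim x y <;> simp [comparePoint, hyx, hsim, or_comm]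

lemma bruteForcePoint_cmps_add_count (S : List ι) (x : ι) :
    (bruteForcePoint I S x).cmps + S.count x = S.length := by
  rw [bruteForcePoint_eq_forEach]
  induction S with
  | nil => rfl
  | cons y S ih =>
    by_cases hyx : y = x <;> simp [forEach_cons, comparePoint_cmps, hyx] <;> omega

lemma bruteForcePoint_cmps_add_one {S : List ι} {x : ι} (hS : S.Nodup) (hx : x ∈ S) :
    (bruteForcePoint I S x).cmps + 1 = S.length := by
  rw [← bruteForcePoint_cmps_add_count (I := I) S x, List.count_eq_one_of_mem hS hx]

lemma bruteForcePoint_time_le (S : List ι) (x : ι) :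
    (bruteForcePoint I S x).time ≤ 3 * S.length := by
  rw [bruteForcePoint_eq_forEach, forEach_time]
  refine (List.sum_le_card_nsmul _ 3 ?_).trans (by simp [mul_comm])
  exact List.forall_mem_map.2 fun y _ => comparePoint_time_le x y

lemma bruteForcePoint_space (S : List ι) (x : ι) : (bruteForcePoint I S x).space = 0 :=
  Nat.le_zero.1 (forEach_space_le fun y _ => (comparePoint_space x y).le)

lemma mem_bruteForcePoint_out {S : List ι} {x : ι} {q : ι × ι} :
    q ∈ (bruteForcePoint I S x).out ↔
      ∃ y ∈ S, (y = x ∨ I.lam ≤ I.sim x y) ∧ (q = (x, y) ∨ q = (y, x)) := by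
  simp only [bruteForcePoint_eq_forEach, mem_forEach_out, mem_comparePoint_out]

lemma reportable_of_mem_bruteForcePoint_out {S : List ι} {x : ι} {q : ι × ι}
    (hq : q ∈ (bruteForcePoint I S x).out) : I.Reportable q := by
  obtain ⟨y, -, rfl | hsim, rfl | rfl⟩ := mem_bruteForcePoint_out.1 hq <;>
    simp [Input.Reportable, *]

lemma mem_bruteForcePairs_out {S : List ι} {q : ι × ι} :
    q ∈ (bruteForcePairs I S).out ↔ ∃ x ∈ S, q ∈ (bruteForcePoint I S x).out :=
  mem_forEach_out _ _ _

lemma bruteForcePairs_cmps {S : List ι} (hS : S.Nodup) :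
    (bruteForcePairs I S).cmps = S.length * (S.length - 1) := by
  rw [bruteForcePairs, forEach_cmps, List.map_congr_left (g := fun _ => S.length - 1)]
  · simp
  · exact fun x hx => Nat.eq_sub_of_add_eq (bruteForcePoint_cmps_add_one hS hx)

lemma bruteForcePairs_time_le (S : List ι) :
    (bruteForcePairs I S).time ≤ 3 * S.length * S.length := by
  rw [bruteForcePairs, forEach_time]
  refine (List.sum_le_card_nsmul _ (3 * S.length) ?_).trans (by simp [mul_comm])
  exact List.forall_mem_map.2 fun x _ => bruteForcePoint_time_le S x

lemma bruteForcePairs_space (S : List ι) : (bruteForcePairs I S).space = 0 :=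
  Nat.le_zero.1 (forEach_space_le fun x _ => (bruteForcePoint_space S x).le)

lemma foldl_update_count (l : List τ) (c : τ → ℕ) :
    l.foldl (fun c j => Function.update c j (c j + 1)) c = fun j => c j + l.count j := by
  induction l generalizing c with
  | nil => simp
  | cons a l ih =>
    funext j
    rw [List.foldl_cons, ih]
    by_cases hja : j = a
    · subst hja
      simp
      omega
    · simp [hja, Ne.symm hja]

lemma foldl_add_eq_add_sum {α M : Type*} [AddMonoid M] (f : α → M) (l : List α) (s : M) :
    l.foldl (fun s a => s + f a) s = s + (l.map f).sum := by
  induction l generalizing s with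
  | nil => simp
  | cons a l ih => simp [ih, add_assoc]

lemma countTokens_val (S : List ι) :
    (countTokens I S).val = fun j => (S.map fun x => (I.tok x).count j).sum := by
  have h (c : τ → ℕ) : S.foldl (fun c x => (foldE (ι := ι) (fun c j => (ticks 1).bind fun _ =>
      ret (Function.update c j (c j + 1))) (I.tok x) c).val) c =
      c + (S.map fun x j => (I.tok x).count j).sum := by
    simp only [foldE_val, bind_val, ret_val, foldl_update_count]
    exact foldl_add_eq_add_sum (fun x j => (I.tok x).count j) S c
  rw [countTokens, foldE_val, h]
  funext j
  rw [Pi.add_apply, zero_add, Pi.list_sum_apply, List.map_map]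
  rfl

lemma countTokens_time_le (S : List ι) :
    (countTokens I S).time ≤ (S.map fun x => (I.tok x).length).sum :=
  foldE_time_le (fun c x => (foldE_time_le (T := fun _ => 1) (fun _ _ => le_rfl) _ c).trans
    (by simp)) S _

lemma quiet_countTokens (S : List ι) : (countTokens I S).Quiet :=
  quiet_foldE (fun _ _ => quiet_foldE
    (fun _ _ => (quiet_ticks 1).bind fun _ => quiet_ret _) _ _) S _

/-- The sum compared with the threshold by `findHeavy`. -/
def heavyScore (I : Input ι τ) (count : τ → ℕ) (x : ι) : ℝ :=
  ((I.tok x).map fun j => ((count j : ℝ) - 1) / I.t).sum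

lemma findHeavy_val (count : τ → ℕ) (m : ℕ) (l : List ι) :
    (findHeavy I count m l).val =
      l.find? fun x => (1 - I.eps) * I.lam < 1 / ((m : ℝ) - 1) * heavyScore I count x := by
  induction l with
  | nil => rfl
  | cons x l ih =>
    simp only [findHeavy, bind_val, foldE_val, ret_val, foldl_add_eq_add_sum, zero_add,
      List.find?_cons, ← heavyScore.eq_1]
    split_ifs with h <;> simp only [h, decide_true, decide_false, ret_val, ih]

lemma findHeavy_time_le (count : τ → ℕ) (m : ℕ) (l : List ι) :
    (findHeavy I count m l).time ≤ (l.map fun x => (I.tok x).length + 1).sum := by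
  induction l with
  | nil => rfl
  | cons x l ih =>
    have hsum (s : ℝ) := foldE_time_le (ι := ι) (T := fun _ => 1)
      (f := fun (s : ℝ) j => (ticks 1).bind fun _ => ret (s + ((count j : ℝ) - 1) / I.t))
      (fun _ _ => le_rfl) (I.tok x) s
    simp only [List.map_const', List.sum_replicate, smul_eq_mul, mul_one] at hsum
    simp only [findHeavy, bind_time, ticks_time, List.map_cons, List.sum_cons, add_assoc]
    gcongr
    · exact hsum 0
    · split_ifs
      · simp
      · simpa using ih

lemma quiet_findHeavy (count : τ → ℕ) (m : ℕ) (l : List ι) : (findHeavy I count m l).Quiet := by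
  induction l with
  | nil => exact quiet_ret none
  | cons x l ih =>
    refine (quiet_foldE (fun _ _ => (quiet_ticks 1).bind fun _ => quiet_ret _) _ _).bind fun s =>
      (quiet_ticks 1).bind fun _ => ?_
    split_ifs
    exacts [quiet_ret _, ih]

/-- Double counting: the occurrences of the tokens of `x` in the other records of `S` add up to the
overlaps of `x` with these records. -/
lemma heavyScore_count (hI : I.Regular) {S : List ι} (hS : S.Nodup) {x : ι} (hx : x ∈ S) :
    heavyScore I (fun j => (S.map fun x => (I.tok x).count j).sum) x =
      (∑ y ∈ S.toFinset.erase x, (I.overlap x y : ℝ)) / I.t := by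
  have hcount (j : τ) : (S.map fun x => (I.tok x).count j).sum =
      ∑ y ∈ S.toFinset, if j ∈ I.tokens y then 1 else 0 := by
    rw [← List.sum_toFinset _ hS]
    simp only [(hI.nodup_tok _).count, Input.mem_tokens]
  calc heavyScore I (fun j => (S.map fun x => (I.tok x).count j).sum) x
    _ = ∑ j ∈ I.tokens x, (((S.map fun x => (I.tok x).count j).sum : ℕ) - 1 : ℝ) / I.t :=
        (List.sum_toFinset _ (hI.nodup_tok x)).symm
    _ = ∑ j ∈ I.tokens x, ∑ y ∈ S.toFinset.erase x,
          (if j ∈ I.tokens y then (1 : ℝ) else 0) / I.t := by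
        refine Finset.sum_congr rfl fun j hj => ?_
        rw [← Finset.sum_div, hcount, ← Finset.add_sum_erase _ _ (List.mem_toFinset.2 hx),
          if_pos hj]
        push_cast
        ring
    _ = (∑ y ∈ S.toFinset.erase x, (I.overlap x y : ℝ)) / I.t := by
        rw [Finset.sum_comm, Finset.sum_div]
        refine Finset.sum_congr rfl fun y _ => ?_
        rw [← Finset.sum_div, Finset.sum_boole, Input.overlap, Finset.filter_mem_eq_inter]

/-- One pass of the brute force step over `S` in search of a point to remove. -/
def search (I : Input ι τ) (S : List ι) : Exec ι (Option ι) :=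
  hold (2 * (S.map fun x => (I.tok x).length).sum)
    ((countTokens I S).bind fun count => findHeavy I count S.length S)

lemma search_cmps (S : List ι) : (search I S).cmps = 0 := by
  simp [search, (quiet_countTokens S).cmps, (quiet_findHeavy _ _ S).cmps]

lemma search_out (S : List ι) : (search I S).out = ∅ := by
  simp [search, (quiet_countTokens S).out, (quiet_findHeavy _ _ S).out]

lemma search_space (hI : I.Regular) (S : List ι) : (search I S).space = 2 * (S.length * I.t) := by
  simp [search, (quiet_countTokens S).space, (quiet_findHeavy _ _ S).space, hI.sum_length_tok]

lemma search_time_le (hI : I.Regular) (S : List ι) :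
    (search I S).time ≤ S.length * (2 * I.t + 1) := by
  have hcount := countTokens_time_le (I := I) S
  have hfind := findHeavy_time_le (I := I) (countTokens I S).val S.length S
  rw [List.sum_map_add] at hfind
  simp only [hI.sum_length_tok, List.map_const', List.sum_replicate, smul_eq_mul, mul_one]
    at hcount hfind
  simp only [search, hold_time, bind_time]
  linarith

lemma search_val (hI : I.Regular) {S : List ι} (hS : S.Nodup) :
    (search I S).val = S.find? fun x => I.Heavy S x := by
  rw [search, hold_val, bind_val, findHeavy_val, countTokens_val]
  refine List.find?_congr fun x hx => ?_
  rw [decide_eq_decide, heavyScore_count hI hS hx, Input.Heavy]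

/-- The possible runs of `BruteForce` on `S`: it ends with all comparisons or without finding a
heavy point, or it removes a heavy point and continues. -/
inductive BruteForceRun (I : Input ι τ) : List ι → Exec ι (List ι) → Prop
  | pairs {S : List ι} : S.Nodup → S.length ≤ I.limit →
      BruteForceRun I S ((ticks 1).bind fun _ => (bruteForcePairs I S).bind fun _ => ret [])
  | light {S : List ι} : S.Nodup → I.limit < S.length → (∀ x ∈ S, ¬ I.Heavy S x) →
      BruteForceRun I S ((ticks 1).bind fun _ => (search I S).bind fun _ => ret S)
  | remove {S : List ι} {x : ι} {e : Exec ι (List ι)} : S.Nodup → I.limit < S.length → x ∈ S →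
      I.Heavy S x → BruteForceRun I (S.erase x) e →
      BruteForceRun I S ((ticks 1).bind fun _ => (search I S).bind fun _ =>
        (bruteForcePoint I S x).bind fun _ => (ticks S.length).bind fun _ => e)

lemma bruteForceRun_bruteForceAux (hI : I.Regular) {m : ℕ} {S : List ι} (hm : S.length = m)
    (hS : S.Nodup) : BruteForceRun I S (bruteForceAux I m S) := by
  induction m generalizing S with
  | zero => exact .pairs hS (by omega)
  | succ m ih =>
    rw [bruteForceAux]
    split_ifs with hlimit
    · exact .pairs hS hlimit
    · push Not at hlimit
      change BruteForceRun I S ((ticks 1).bind fun _ => (search I S).bind _)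
      have hval := search_val hI hS
      rcases hfind : S.find? fun x => I.Heavy S x with _ | x <;> rw [hfind] at hval
      · have hnone : ∀ x ∈ S, ¬ I.Heavy S x := by simpa using hfind
        simpa only [Exec.bind, hval] using BruteForceRun.light hS hlimit hnone
      · have hx : x ∈ S := List.mem_of_find?_eq_some hfind
        have hheavy : I.Heavy S x := by simpa using List.find?_some hfind
        have hlen : (S.erase x).length = m := by rw [List.length_erase_of_mem hx, hm]; rfl
        simpa only [Exec.bind, hval] using
          BruteForceRun.remove hS hlimit hx hheavy (ih hlen (hS.erase x))

lemma bruteForceRun (hI : I.Regular) {S : List ι} (hS : S.Nodup) :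
    BruteForceRun I S (bruteForce I S) :=
  bruteForceRun_bruteForceAux hI rfl hS

namespace BruteForceRun

variable {S : List ι} {e : Exec ι (List ι)}

lemma val_sublist (h : BruteForceRun I S e) : e.val.Sublist S := by
  induction h with
  | pairs => exact List.nil_sublist _
  | light => exact List.Sublist.refl _
  | remove _ _ _ _ _ ih => exact ih.trans List.erase_sublist

lemma val_eq_nil_or (h : BruteForceRun I S e) :
    e.val = [] ∨ I.limit < e.val.length ∧ ∀ x ∈ e.val, ¬ I.Heavy e.val x := by
  induction h with
  | pairs => exact Or.inl rfl
  | light _ hlimit hlight => exact Or.inr ⟨hlimit, hlight⟩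
  | remove _ _ _ _ _ ih => exact ih

lemma space_le (hI : I.Regular) (h : BruteForceRun I S e) : e.space ≤ 2 * (S.length * I.t) := by
  induction h with
  | pairs => simp [bruteForcePairs_space]
  | light => simp [search_space hI]
  | @remove S x e _ _ _ _ _ ih =>
    have hlen : (S.erase x).length * I.t ≤ S.length * I.t :=
      Nat.mul_le_mul_right _ List.length_erase_le
    simp only [bind_space, ticks_space, search_space hI, bruteForcePoint_space]
    omega

lemma time_le (hI : I.Regular) (h : BruteForceRun I S e) :
    e.time ≤ (2 * I.t + 6) * (S.length + e.cmps) + 1 := by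
  induction h with
  | @pairs S hS _ =>
    have htime : (bruteForcePairs I S).time ≤ 6 * (S.length + S.length * (S.length - 1)) := by
      refine (bruteForcePairs_time_le S).trans ?_
      rcases S.length with _ | l
      · simp
      · rw [Nat.add_sub_cancel]
        nlinarith
    simp only [bind_time, ticks_time, ret_time, bind_cmps, ticks_cmps, bruteForcePairs_cmps hS,
      ret_cmps, zero_add, add_zero]
    nlinarith [Nat.zero_le (I.t * (S.length + S.length * (S.length - 1)))]
  | @light S _ _ _ =>
    have hsearch := search_time_le hI S
    simp only [bind_time, ticks_time, ret_time, bind_cmps, ticks_cmps, search_cmps, ret_cmps]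
    nlinarith
  | @remove S x e hS _ hx _ _ ih =>
    have hsearch := search_time_le hI S
    have hpoint := bruteForcePoint_time_le (I := I) S x
    have hcmps := bruteForcePoint_cmps_add_one (I := I) hS hx
    have hlen : (S.erase x).length + 1 = S.length := List.length_erase_add_one hx
    simp only [bind_time, ticks_time, bind_cmps, ticks_cmps, search_cmps]
    nlinarith

lemma reportable_of_mem_out (h : BruteForceRun I S e) {q : ι × ι} (hq : q ∈ e.out) :
    I.Reportable q := by
  induction h with
  | pairs =>
    simp only [bind_out, ticks_out, ret_out, Set.empty_union, Set.union_empty] at hq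
    obtain ⟨x, -, hq⟩ := mem_bruteForcePairs_out.1 hq
    exact reportable_of_mem_bruteForcePoint_out hq
  | light => simp [search_out] at hq
  | remove _ _ _ _ _ ih =>
    simp only [bind_out, ticks_out, search_out, Set.empty_union, Set.mem_union] at hq
    exact hq.elim reportable_of_mem_bruteForcePoint_out ih

lemma mem_out_or_mem_val (h : BruteForceRun I S e) {x y : ι} (hx : x ∈ S) (hy : y ∈ S)
    (hxy : I.lam ≤ I.sim x y) (hyx : I.lam ≤ I.sim y x) :
    (x, y) ∈ e.out ∨ (x ∈ e.val ∧ y ∈ e.val) := by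
  induction h with
  | pairs =>
    refine Or.inl (Or.inr (Or.inl (mem_bruteForcePairs_out.2 ⟨x, hx, ?_⟩)))
    exact mem_bruteForcePoint_out.2 ⟨y, hy, Or.inr hxy, Or.inl rfl⟩
  | light => exact Or.inr ⟨hx, hy⟩
  | @remove S z e _ _ _ _ _ ih =>
    simp only [bind_out, ticks_out, search_out, Set.empty_union, Set.mem_union, bind_val,
      mem_bruteForcePoint_out]
    by_cases hzx : x = z
    · exact Or.inl (Or.inl ⟨y, hy, Or.inr (hzx ▸ hxy), Or.inl (hzx ▸ rfl)⟩)
    by_cases hzy : y = z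
    · exact Or.inl (Or.inl ⟨x, hx, Or.inr (hzy ▸ hyx), Or.inr (hzy ▸ rfl)⟩)
    · exact (ih ((List.mem_erase_of_ne hzx).2 hx) ((List.mem_erase_of_ne hzy).2 hy)).imp_left
        Or.inr

end BruteForceRun

end BruteForce

section Split

variable {ι τ : Type*}

/-- The list stored under the key `j`, empty if there is none. -/
def lookupBucket (j : τ) : List (τ × List ι) → List ι
  | [] => []
  | b :: B => if b.1 = j then b.2 else lookupBucket j B

lemma lookupBucket_addToBucket (j i : τ) (x : ι) (B : List (τ × List ι)) :
    lookupBucket i (addToBucket j x B) =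
      if i = j then x :: lookupBucket i B else lookupBucket i B := by
  induction B with
  | nil => simp [addToBucket, lookupBucket, eq_comm]
  | cons b B ih =>
    rw [addToBucket]
    split_ifs with hbj hij hij
    · simp [lookupBucket, hbj, hij]
    · simp [lookupBucket, hbj, Ne.symm hij]
    · subst hij
      simp [lookupBucket, ih, hbj]
    · rw [lookupBucket, lookupBucket, ih, if_neg hij]

lemma keys_addToBucket (j : τ) (x : ι) (B : List (τ × List ι)) :
    (addToBucket j x B).map Prod.fst =
      if j ∈ B.map Prod.fst then B.map Prod.fst else B.map Prod.fst ++ [j] := by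
  induction B with
  | nil => simp [addToBucket]
  | cons b B ih =>
    rw [addToBucket]
    by_cases hbj : b.1 = j
    · simp [hbj]
    · simp only [hbj, if_false, List.map_cons, ih, List.mem_cons, Ne.symm hbj, false_or]
      split_ifs <;> simp

lemma nodup_keys_addToBucket {B : List (τ × List ι)} (hB : (B.map Prod.fst).Nodup) (j : τ)
    (x : ι) : ((addToBucket j x B).map Prod.fst).Nodup := by
  rw [keys_addToBucket]
  split_ifs with hj
  · exact hB
  · rw [← List.concat_eq_append]
    exact hB.concat hj

lemma snd_eq_lookupBucket {B : List (τ × List ι)} (hB : (B.map Prod.fst).Nodup) {b : τ × List ι}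
    (hb : b ∈ B) : b.2 = lookupBucket b.1 B := by
  induction B with
  | nil => simp at hb
  | cons a B ih =>
    rw [List.map_cons, List.nodup_cons] at hB
    rcases List.mem_cons.1 hb with rfl | hb
    · simp [lookupBucket]
    · have hne : a.1 ≠ b.1 := fun h => hB.1 (h ▸ List.mem_map_of_mem hb)
      simp [lookupBucket, hne, ih hB.2 hb]

/-- The dictionary obtained from `B` by adding, in this order, the records of `E` to the buckets
named with them. -/
def insertAll (E : List (τ × ι)) (B : List (τ × List ι)) : List (τ × List ι) :=
  E.foldl (fun B e => addToBucket e.1 e.2 B) B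

lemma nodup_keys_insertAll (E : List (τ × ι)) {B : List (τ × List ι)}
    (hB : (B.map Prod.fst).Nodup) : ((insertAll E B).map Prod.fst).Nodup := by
  induction E generalizing B with
  | nil => exact hB
  | cons e _ ih => exact ih (nodup_keys_addToBucket hB e.1 e.2)

lemma mem_keys_insertAll {E : List (τ × ι)} {B : List (τ × List ι)} {j : τ} :
    j ∈ (insertAll E B).map Prod.fst ↔ j ∈ B.map Prod.fst ∨ j ∈ E.map Prod.fst := by
  induction E generalizing B with
  | nil => simp [insertAll]
  | cons e E ih =>
    change j ∈ (insertAll E (addToBucket e.1 e.2 B)).map Prod.fst ↔ _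
    rw [ih, keys_addToBucket]
    by_cases he : e.1 ∈ B.map Prod.fst
    · rw [if_pos he, List.map_cons, List.mem_cons]
      constructor
      · tauto
      · rintro (h | rfl | h) <;> tauto
    · rw [if_neg he, List.mem_append, List.mem_singleton, List.map_cons, List.mem_cons, or_assoc]

lemma lookupBucket_insertAll (E : List (τ × ι)) (B : List (τ × List ι)) (j : τ) :
    lookupBucket j (insertAll E B) =
      ((E.filter fun e => e.1 = j).map Prod.snd).reverse ++ lookupBucket j B := by
  induction E generalizing B with
  | nil => rfl
  | cons e E ih =>
    change lookupBucket j (insertAll E (addToBucket e.1 e.2 B)) = _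
    rw [ih, lookupBucket_addToBucket]
    by_cases hj : e.1 = j
    · simp [hj]
    · simp [hj, Ne.symm hj]

lemma flatMap_ite_singleton (S : List ι) (P : ι → Prop) :
    (S.flatMap fun x => if P x then [x] else []) = S.filter P := by
  induction S with
  | nil => rfl
  | cons x S ih => by_cases hx : P x <;> simp [ih, hx]

/-- All tokens that occur in a list of records. -/
def Input.tokensOf (I : Input ι τ) (S : List ι) : Finset τ := S.toFinset.biUnion I.tokens

/-- The records of `S` with token `j`, in the order in which the splitting step stores them. -/
def Input.bucket (I : Input ι τ) (S : List ι) (j : τ) : List ι :=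
  (S.filter fun x => j ∈ I.tok x).reverse

/-- The insertions made by the splitting step with hash function `r`, in their order. -/
def Input.insertions (I : Input ι τ) (r : τ → ℝ) (S : List ι) : List (τ × ι) :=
  S.flatMap fun x =>
    ((I.tok x).filter fun j => r j < 1 / (I.lam * (I.tok x).length)).map fun j => (j, x)

variable {I : Input ι τ}

lemma Input.mem_tokensOf {S : List ι} {j : τ} : j ∈ I.tokensOf S ↔ ∃ x ∈ S, j ∈ I.tok x := by
  simp [Input.tokensOf, Input.mem_tokens]

lemma Input.mem_bucket {S : List ι} {j : τ} {x : ι} :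
    x ∈ I.bucket S j ↔ x ∈ S ∧ j ∈ I.tok x := by
  simp [Input.bucket]

lemma Input.nodup_bucket {S : List ι} (hS : S.Nodup) (j : τ) : (I.bucket S j).Nodup :=
  List.nodup_reverse.2 (hS.filter _)

lemma Input.length_bucket_le (S : List ι) (j : τ) : (I.bucket S j).length ≤ S.length := by
  simpa [Input.bucket] using List.length_filter_le _ S

lemma Input.length_bucket_pos {S : List ι} {j : τ} (hj : j ∈ I.tokensOf S) :
    0 < (I.bucket S j).length := by
  obtain ⟨x, hx, hj⟩ := Input.mem_tokensOf.1 hj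
  exact List.length_pos_of_mem (Input.mem_bucket.2 ⟨hx, hj⟩)

lemma Input.sum_tokensOf_sum_bucket {M : Type*} [AddCommMonoid M] (S : List ι) (F : τ → ι → M) :
    ∑ j ∈ I.tokensOf S, ∑ x ∈ (I.bucket S j).toFinset, F j x =
      ∑ x ∈ S.toFinset, ∑ j ∈ I.tokens x, F j x := by
  refine Finset.sum_comm' fun j x => ?_
  simp only [List.mem_toFinset, Input.mem_bucket, Input.mem_tokensOf, Input.mem_tokens]
  constructor
  · rintro ⟨-, hx, hj⟩
    exact ⟨hj, hx⟩
  · rintro ⟨hj, hx⟩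
    exact ⟨⟨x, hx, hj⟩, hx, hj⟩

lemma Input.Regular.sum_length_bucket (hI : I.Regular) {S : List ι} (hS : S.Nodup) :
    ∑ j ∈ I.tokensOf S, (I.bucket S j).length = S.length * I.t := by
  have hsum := Input.sum_tokensOf_sum_bucket (I := I) S fun _ _ => 1
  simp only [Finset.sum_const, smul_eq_mul, mul_one, hI.card_tokens,
    List.toFinset_card_of_nodup hS, List.toFinset_card_of_nodup (Input.nodup_bucket hS _)] at hsum
  exact hsum

lemma Input.Regular.mem_keys_insertions (hI : I.Regular) {r : τ → ℝ} {S : List ι} {j : τ} :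
    j ∈ (I.insertions r S).map Prod.fst ↔ j ∈ I.tokensOf S ∧ r j < 1 / (I.lam * I.t) := by
  simp only [Input.insertions, hI.length_tok, List.mem_map, List.mem_flatMap, List.mem_filter,
    decide_eq_true_eq, Input.mem_tokensOf]
  constructor
  · rintro ⟨_, ⟨x, hx, i, ⟨hi, hr⟩, rfl⟩, rfl⟩
    exact ⟨⟨x, hx, hi⟩, hr⟩
  · rintro ⟨⟨x, hx, hj⟩, hr⟩
    exact ⟨(j, x), ⟨x, hx, j, ⟨hj, hr⟩, rfl⟩, rfl⟩

lemma Input.Regular.filter_insertions (hI : I.Regular) {r : τ → ℝ} {S : List ι} {j : τ}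
    (hj : r j < 1 / (I.lam * I.t)) :
    ((I.insertions r S).filter fun e => e.1 = j).map Prod.snd =
      S.filter fun x => j ∈ I.tok x := by
  have hrecord (x : ι) : ((((I.tok x).filter fun i => r i < 1 / (I.lam * I.t)).map
      fun i => (i, x)).filter fun e => e.1 = j).map Prod.snd =
        if j ∈ I.tok x then [x] else [] := by
    have hcount := (hI.nodup_tok x).count (a := j)
    simp only [List.filter_map, List.map_map, List.filter_filter, Function.comp_def,
      List.map_const']
    rw [List.filter_congr (q := fun i => decide (i = j)) (by grind), ← List.countP_eq_length_filter]
    change List.replicate (List.count j (I.tok x)) x = _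
    rw [hcount]
    split_ifs <;> rfl
  simp only [Input.insertions, hI.length_tok, List.filter_flatMap, List.map_flatMap, hrecord]
  convert flatMap_ite_singleton S _

lemma split_val (r : τ → ℝ) (S : List ι) :
    (split I r S).val = insertAll (I.insertions r S) [] := by
  simp only [split, foldE_val, insertAll, Input.insertions, List.foldl_flatMap, List.foldl_map,
    List.foldl_filter, bind_val, decide_eq_true_eq]
  congr! 5
  ext j
  split_ifs <;> rfl

lemma mem_split (hI : I.Regular) (r : τ → ℝ) (S : List ι) (b : τ × List ι) :
    b ∈ (split I r S).val ↔
      b.1 ∈ I.tokensOf S ∧ r b.1 < 1 / (I.lam * I.t) ∧ b.2 = I.bucket S b.1 := by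
  have hkeys (j : τ) : j ∈ (split I r S).val.map Prod.fst ↔
      j ∈ I.tokensOf S ∧ r j < 1 / (I.lam * I.t) := by
    rw [split_val, mem_keys_insertAll, hI.mem_keys_insertions]
    simp
  have hbucket {b : τ × List ι} (hb : b ∈ (split I r S).val) : b.2 = I.bucket S b.1 := by
    have hr := ((hkeys b.1).1 (List.mem_map_of_mem hb)).2
    rw [split_val] at hb
    rw [snd_eq_lookupBucket (nodup_keys_insertAll _ (B := []) List.nodup_nil) hb,
      lookupBucket_insertAll, hI.filter_insertions hr, lookupBucket, List.append_nil, Input.bucket]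
  constructor
  · intro hb
    obtain ⟨hj, hr⟩ := (hkeys b.1).1 (List.mem_map_of_mem hb)
    exact ⟨hj, hr, hbucket hb⟩
  · rintro ⟨hj, hr, hb⟩
    obtain ⟨a, ha, hab⟩ := List.mem_map.1 ((hkeys b.1).2 ⟨hj, hr⟩)
    have haeq : a = b := Prod.ext hab (by rw [hbucket ha, hb, hab])
    exact haeq ▸ ha

lemma sum_split (hI : I.Regular) {M : Type*} [AddCommMonoid M] (r : τ → ℝ) (S : List ι)
    (F : τ × List ι → M) :
    ((split I r S).val.map F).sum =
      ∑ j ∈ I.tokensOf S, if r j < 1 / (I.lam * I.t) then F (j, I.bucket S j) else 0 := by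
  have hnodup : ((split I r S).val.map Prod.fst).Nodup := by
    rw [split_val]
    exact nodup_keys_insertAll _ (B := []) List.nodup_nil
  rw [← Finset.sum_filter, ← List.sum_toFinset F hnodup.of_map]
  refine Finset.sum_bij' (fun b _ => b.1) (fun j _ => (j, I.bucket S j)) ?_ ?_ ?_ ?_ ?_ <;>
    simp +contextual [mem_split hI, Prod.ext_iff]

lemma quiet_split (r : τ → ℝ) (S : List ι) : (split I r S).Quiet := by
  refine quiet_foldE (fun _ _ => quiet_foldE (fun _ _ => (quiet_ticks 1).bind fun _ => ?_) _ _) S _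
  split_ifs
  exacts [(quiet_ticks 1).bind fun _ => quiet_ret _, quiet_ret _]

lemma split_time_le (hI : I.Regular) (r : τ → ℝ) (S : List ι) :
    (split I r S).time ≤ 2 * (S.length * I.t) := by
  refine (foldE_time_le (T := fun x => ((I.tok x).map fun _ => 2).sum)
    (fun B x => foldE_time_le (T := fun _ => 2) (fun B j => ?_) _ B) S _).trans_eq ?_
  · rw [bind_time]
    split_ifs <;> simp
  · simp only [List.map_const', List.sum_replicate, smul_eq_mul, hI.length_tok]
    ring

lemma sum_length_split_le (hI : I.Regular) {S : List ι} (hS : S.Nodup) (r : τ → ℝ) :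
    ((split I r S).val.map fun b => b.2.length + 1).sum ≤ 2 * (S.length * I.t) := by
  rw [sum_split hI, ← hI.sum_length_bucket hS, Finset.mul_sum]
  refine Finset.sum_le_sum fun j hj => ?_
  have hpos := Input.length_bucket_pos hj
  split_ifs <;> simp only [zero_le]
  omega

lemma length_split_le (hI : I.Regular) {S : List ι} (hS : S.Nodup) (r : τ → ℝ) :
    (split I r S).val.length ≤ S.length * I.t := by
  have hlength : (split I r S).val.length = ((split I r S).val.map fun _ => 1).sum := by simp
  rw [hlength, sum_split hI, ← hI.sum_length_bucket hS]
  refine Finset.sum_le_sum fun j hj => ?_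
  have hpos := Input.length_bucket_pos hj
  split_ifs <;> omega

end Split

/-! ### The recursion tree -/

section RecursionTree

variable {ι τ : Type*}

/-- The total weight of the recursion tree cut off at depth `k`, where a call on `S` weighs
`node S` and a call that is cut off weighs `leaf S`. -/
def treeCost (I : Input ι τ) (node leaf : List ι → ℕ) (r : List τ → τ → ℝ) :
    ℕ → List τ → List ι → ℕ
  | 0, _, S => leaf S
  | k + 1, p, S => node S +
      ∑ j ∈ I.tokensOf (bruteForce I S).val, if r p j < 1 / (I.lam * I.t) then
        treeCost I node leaf r k (p ++ [j]) (I.bucket (bruteForce I S).val j) else 0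

/-- The comparisons in the brute force step of a call on `S`. -/
def callCmps (I : Input ι τ) (S : List ι) : ℕ := (bruteForce I S).cmps

/-- The number of points of a call on `S` plus the comparisons in its brute force step. Up to a
factor `O(t)` this bounds the time of the call without its recursive calls. -/
def callWork (I : Input ι τ) (S : List ι) : ℕ := S.length + (bruteForce I S).cmps

/-- The number of ordered pairs of distinct points. As a leaf weight it detects the calls with at
least two points. -/
def orderedPairs (S : List ι) : ℕ := S.length * (S.length - 1)

variable {I : Input ι τ}

lemma Input.Regular.nodup_bruteForce (hI : I.Regular) {S : List ι} (hS : S.Nodup) :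
    (bruteForce I S).val.Nodup :=
  (bruteForceRun hI hS).val_sublist.nodup hS

lemma Input.Regular.length_bruteForce_le (hI : I.Regular) {S : List ι} (hS : S.Nodup) :
    (bruteForce I S).val.length ≤ S.length :=
  (bruteForceRun hI hS).val_sublist.length_le

lemma treeCost_le_succ (node : List ι → ℕ) (r : List τ → τ → ℝ) (k : ℕ) (p : List τ)
    (S : List ι) :
    treeCost I node (fun _ => 0) r k p S ≤ treeCost I node (fun _ => 0) r (k + 1) p S := by
  induction k generalizing p S with
  | zero => simp [treeCost]
  | succ k ih =>
    rw [treeCost, treeCost]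
    gcongr with j
    split_ifs
    · exact ih _ _
    · exact le_rfl

lemma cpsJoin_cmps (hI : I.Regular) (r : List τ → τ → ℝ) (k : ℕ) (p : List τ) (S : List ι) :
    (cpsJoin I r k p S).cmps = treeCost I (callCmps I) (fun _ => 0) r k p S := by
  induction k generalizing p S with
  | zero => rfl
  | succ k ih =>
    simp only [cpsJoin, treeCost, callCmps, hold_cmps, bind_cmps, ticks_cmps,
      (quiet_split _ _).cmps, forEach_cmps, ih, zero_add]
    rw [sum_split hI]

lemma sum_map_add_split_le (hI : I.Regular) {S : List ι} (hS : S.Nodup) (r : τ → ℝ) (m : ℕ)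
    {T F : τ → List ι → ℕ}
    (hTF : ∀ j ∈ I.tokensOf S, T j (I.bucket S j) ≤ m * F j (I.bucket S j)) :
    ((split I r S).val.map fun b => 1 + T b.1 b.2).sum ≤ S.length * I.t +
      m * ∑ j ∈ I.tokensOf S, if r j < 1 / (I.lam * I.t) then F j (I.bucket S j) else 0 := by
  rw [List.sum_map_add]
  refine Nat.add_le_add (by simpa using length_split_le hI hS r) ?_
  rw [sum_split hI, Finset.mul_sum]
  gcongr with j hj
  split_ifs
  · exact hTF j hj
  · simp

lemma cpsJoin_time_le (hI : I.Regular) (r : List τ → τ → ℝ) (k : ℕ) (p : List τ) {S : List ι}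
    (hS : S.Nodup) (hne : S ≠ []) :
    (cpsJoin I r k p S).time ≤ (5 * I.t + 9) * treeCost I (callWork I) (fun _ => 0) r k p S := by
  induction k generalizing p S with
  | zero => simp [cpsJoin, treeCost]
  | succ k ih =>
    simp only [cpsJoin, treeCost, callWork, hold_time, bind_time, ticks_time, forEach_time]
    have hS' := hI.nodup_bruteForce hS
    have hbrute := (bruteForceRun hI hS).time_le hI
    have hsplit := split_time_le hI (r p) (bruteForce I S).val
    have hlen := Nat.mul_le_mul_right I.t (hI.length_bruteForce_le hS)
    have hpos : 1 ≤ S.length := List.length_pos_of_ne_nil hne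
    have hchildren := sum_map_add_split_le hI hS' (r p) (5 * I.t + 9)
      (T := fun j S' => (cpsJoin I r k (p ++ [j]) S').time)
      (F := fun j S' => treeCost I (callWork I) (fun _ => 0) r k (p ++ [j]) S') fun j hj =>
        ih _ (Input.nodup_bucket hS' j) (List.ne_nil_of_length_pos (Input.length_bucket_pos hj))
    have hcmps : 0 ≤ I.t * (bruteForce I S).cmps := Nat.zero_le _
    change _ ≤ (5 * I.t + 9) * (S.length + (bruteForce I S).cmps + _)
    nlinarith

lemma mem_cpsJoin_out_succ (hI : I.Regular) (r : List τ → τ → ℝ) (k : ℕ) (p : List τ)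
    (S : List ι) (q : ι × ι) :
    q ∈ (cpsJoin I r (k + 1) p S).out ↔ q ∈ (bruteForce I S).out ∨
      ∃ j ∈ I.tokensOf (bruteForce I S).val, r p j < 1 / (I.lam * I.t) ∧
        q ∈ (cpsJoin I r k (p ++ [j]) (I.bucket (bruteForce I S).val j)).out := by
  simp only [cpsJoin, hold_out, bind_out, ticks_out, (quiet_split _ _).out, Set.empty_union,
    Set.mem_union, mem_forEach_out, mem_split hI, Prod.exists]
  refine or_congr Iff.rfl ⟨?_, ?_⟩
  · rintro ⟨j, _, ⟨hj, hr, rfl⟩, hq⟩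
    exact ⟨j, hj, hr, hq⟩
  · rintro ⟨j, hj, hr, hq⟩
    exact ⟨j, _, ⟨hj, hr, rfl⟩, hq⟩

lemma reportable_of_mem_cpsJoin_out (hI : I.Regular) (r : List τ → τ → ℝ) (k : ℕ) (p : List τ)
    {S : List ι} (hS : S.Nodup) {q : ι × ι} (hq : q ∈ (cpsJoin I r k p S).out) :
    I.Reportable q := by
  induction k generalizing p S with
  | zero => simp [cpsJoin] at hq
  | succ k ih =>
    rcases (mem_cpsJoin_out_succ hI r k p S q).1 hq with hq | ⟨j, _, _, hq⟩
    · exact (bruteForceRun hI hS).reportable_of_mem_out hq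
    · exact ih _ (Input.nodup_bucket (hI.nodup_bruteForce hS) j) hq

lemma bruteForce_val_eq_nil (hI : I.Regular) {S : List ι} (hS : S.Nodup)
    (hlen : S.length ≤ I.limit) : (bruteForce I S).val = [] :=
  (bruteForceRun hI hS).val_eq_nil_or.resolve_right fun h =>
    (hlen.trans_lt h.1).not_ge (hI.length_bruteForce_le hS)

lemma treeCost_orderedPairs_eq_zero {r : List τ → τ → ℝ} {K : ℕ} {p : List τ}
    {S : List ι} (h : treeCost I (fun _ => 0) orderedPairs r (K + 1) p S = 0) {j : τ}
    (hj : j ∈ I.tokensOf (bruteForce I S).val) (hr : r p j < 1 / (I.lam * I.t)) :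
    treeCost I (fun _ => 0) orderedPairs r K (p ++ [j]) (I.bucket (bruteForce I S).val j) = 0 := by
  rw [treeCost, zero_add, Finset.sum_eq_zero_iff] at h
  exact (if_pos hr).symm.trans (h j hj)

/-- If no call at depth `K` has two points, the stack never has more than `K + 1` frames. -/
lemma cpsJoin_space_le (hI : I.Regular) (hlimit : 1 ≤ I.limit) (r : List τ → τ → ℝ) {n : ℕ}
    (K k : ℕ) (p : List τ) {S : List ι} (hS : S.Nodup) (hn : S.length ≤ n)
    (hK : treeCost I (fun _ => 0) orderedPairs r K p S = 0) :
    (cpsJoin I r k p S).space ≤ (K + 1) * (n + 1 + 4 * (n * I.t)) := by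
  induction K generalizing k p S with
  | zero =>
    cases k with
    | zero => simp [cpsJoin]
    | succ k =>
      have hlen : S.length ≤ 1 := by
        simp only [treeCost, orderedPairs, mul_eq_zero] at hK
        omega
      have hbrute := (bruteForceRun hI hS).space_le hI
      have hnt := Nat.mul_le_mul_right I.t hn
      simp only [cpsJoin, hold_space, bind_space, ticks_space, (quiet_split _ _).space,
        bruteForce_val_eq_nil hI hS (hlen.trans hlimit)]
      simp only [split, foldE, ret_val, forEach_nil, List.map_nil, List.sum_nil, ret_space]
      omega
  | succ K ih =>
    cases k with
    | zero => simp [cpsJoin]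
    | succ k =>
      have hbrute := (bruteForceRun hI hS).space_le hI
      have hnt := Nat.mul_le_mul_right I.t hn
      have hS' := hI.nodup_bruteForce hS
      have hlen := hI.length_bruteForce_le hS
      have hlen' := Nat.mul_le_mul_right I.t hlen
      have hstored := sum_length_split_le hI hS' (r p)
      have hchildren : (forEach (split I (r p) (bruteForce I S).val).val fun b =>
          (ticks 1).bind fun _ => cpsJoin I r k (p ++ [b.1]) b.2).space ≤
          (K + 1) * (n + 1 + 4 * (n * I.t)) := by
        refine forEach_space_le fun b hb => ?_
        obtain ⟨hj, hr, hb⟩ := (mem_split hI _ _ _).1 hb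
        simp only [bind_space, ticks_space, hb, Nat.zero_max]
        exact ih k _ (Input.nodup_bucket hS' _) ((Input.length_bucket_le _ _).trans (hlen.trans hn))
          (treeCost_orderedPairs_eq_zero hK hj hr)
      simp only [cpsJoin, hold_space, bind_space, ticks_space, (quiet_split _ _).space]
      rw [add_mul (K + 1)]
      omega

end RecursionTree

/-! ### Independence of the seeds -/

section Product

open ProbabilityTheory

variable {κ : Type*} {Ω : κ → Type*} [∀ i, MeasurableSpace (Ω i)] {P : ∀ i, Measure (Ω i)}
  [∀ i, IsProbabilityMeasure (P i)]

lemma measurable_iSup_comap_of_dependsOn [Nonempty (∀ i, Ω i)] {α : Type*} [MeasurableSpace α]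
    {f : (∀ i, Ω i) → α} {B : Set κ} (hf : Measurable f) (hfB : DependsOn f B) :
    Measurable[⨆ i ∈ B, MeasurableSpace.comap (fun ω : ∀ i, Ω i => ω i) inferInstance] f := by
  obtain ⟨ω₀⟩ := ‹Nonempty (∀ i, Ω i)›
  have hcomp : f = f ∘ fun ω => B.piecewise ω ω₀ :=
    funext fun ω => hfB fun i hi => (Set.piecewise_eq_of_mem B _ _ hi).symm
  rw [hcomp]
  refine hf.comp ?_
  rw [@measurable_pi_iff]
  intro i
  by_cases hi : i ∈ B
  · simp only [Set.piecewise_eq_of_mem B _ _ hi]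
    exact (comap_measurable _).mono (le_iSup₂_of_le i hi le_rfl) le_rfl
  · simp only [Set.piecewise_eq_of_notMem B _ _ hi]
    exact measurable_const

lemma indepFun_of_dependsOn {α γ : Type*} [MeasurableSpace α] [MeasurableSpace γ] {B C : Set κ}
    (hBC : Disjoint B C) {f : (∀ i, Ω i) → α} {g : (∀ i, Ω i) → γ} (hf : Measurable f)
    (hg : Measurable g) (hfB : DependsOn f B) (hgC : DependsOn g C) :
    f ⟂ᵢ[Measure.infinitePi P] g := by
  have : Nonempty (∀ i, Ω i) := (Measure.infinitePi P).nonempty_of_neZero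
  have hcoord : iIndepFun (fun i (ω : ∀ i, Ω i) => ω i) (Measure.infinitePi P) :=
    iIndepFun_infinitePi (X := fun _ => id) fun _ => measurable_id
  exact indep_of_indep_of_le_left (indep_of_indep_of_le_right
    (indep_iSup_of_disjoint (fun i => (measurable_pi_apply i).comap_le) hcoord hBC)
    (measurable_iSup_comap_of_dependsOn hg hgC).comap_le)
    (measurable_iSup_comap_of_dependsOn hf hfB).comap_le

lemma measure_inter_of_dependsOn {B C : Set κ} (hBC : Disjoint B C) {A A' : Set (∀ i, Ω i)}
    (hA : MeasurableSet A) (hA' : MeasurableSet A') (hAB : DependsOn (· ∈ A) B)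
    (hAC : DependsOn (· ∈ A') C) :
    Measure.infinitePi P (A ∩ A') = Measure.infinitePi P A * Measure.infinitePi P A' := by
  have hindep := indepFun_of_dependsOn (P := P) hBC hA.mem hA'.mem hAB hAC
  simpa using hindep.measure_inter_preimage_eq_mul {True} {True} trivial trivial

lemma measure_biInter_of_dependsOn {J : Type*} (s : Finset J) {B : J → Set κ}
    (hB : (s : Set J).PairwiseDisjoint B) {A : J → Set (∀ i, Ω i)}
    (hA : ∀ j ∈ s, MeasurableSet (A j)) (hAB : ∀ j ∈ s, DependsOn (· ∈ A j) (B j)) :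
    Measure.infinitePi P (⋂ j ∈ s, A j) = ∏ j ∈ s, Measure.infinitePi P (A j) := by
  induction s using Finset.induction_on with
  | empty => simp
  | insert a s ha ih =>
    rw [Finset.coe_insert, Set.pairwiseDisjoint_insert_of_notMem (by simpa using ha)] at hB
    rw [Finset.forall_mem_insert] at hA hAB
    rw [Finset.set_biInter_insert, Finset.prod_insert ha, ← ih hB.1 hA.2 hAB.2]
    refine measure_inter_of_dependsOn (B := B a) (C := ⋃ j ∈ s, B j) ?_ hA.1
      (s.measurableSet_biInter hA.2) hAB.1 fun x y hxy => ?_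
    · exact Set.disjoint_iUnion₂_right.2 hB.2
    · simp only [Set.mem_iInter, eq_iff_iff]
      exact forall₂_congr fun j hj => iff_of_eq <|
        hAB.2 j hj fun i hi => hxy i (Set.mem_biUnion hj hi)

end Product

section Seeds

open ProbabilityTheory

variable {ι τ : Type*}

instance (τ : Type*) : IsProbabilityMeasure (seedMeasure τ) := by
  unfold seedMeasure; infer_instance

/-- The hash functions of repetition `i`. -/
def seedHash (i : ℕ) (ω : Seeds τ) : List τ → τ → ℝ := fun p j => (ω (i, p, j) : ℝ)

/-- The indices of the seeds used by repetition `i` in the subtree of node `p`. -/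
def subtreeSeeds (i : ℕ) (p : List τ) : Set (ℕ × List τ × τ) := {s | s.1 = i ∧ p <+: s.2.1}

lemma measurable_seedHash (i : ℕ) (p : List τ) (j : τ) :
    Measurable fun ω : Seeds τ => seedHash i ω p j :=
  measurable_subtype_coe.comp (measurable_pi_apply _)

lemma measurableSet_seedHash_lt (i : ℕ) (p : List τ) (j : τ) (c : ℝ) :
    MeasurableSet {ω : Seeds τ | seedHash i ω p j < c} :=
  measurableSet_lt (measurable_seedHash i p j) measurable_const

lemma seedMeasure_seedHash_lt (i : ℕ) (p : List τ) (j : τ) {c : ℝ} (hc : c ∈ Set.Icc (0 : ℝ) 1) :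
    seedMeasure τ {ω : Seeds τ | seedHash i ω p j < c} = ENNReal.ofReal c :=
  ((measurePreserving_eval_infinitePi
    (fun _ : ℕ × List τ × τ => (volume : Measure unitInterval)) (i, p, j)).measure_preimage
    (s := Set.Iio ⟨c, hc⟩) measurableSet_Iio.nullMeasurableSet).trans
      (unitInterval.volume_Iio ⟨c, hc⟩)

lemma dependsOn_seedHash_lt (i : ℕ) (p : List τ) (j : τ) (c : ℝ) :
    DependsOn (fun ω : Seeds τ => seedHash i ω p j < c) {(i, p, j)} := by
  intro x y hxy
  simp only [seedHash, hxy _ rfl]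

lemma subtreeSeeds_append_subset (i : ℕ) (p q : List τ) :
    subtreeSeeds i (p ++ q) ⊆ subtreeSeeds i p :=
  fun _ hs => ⟨hs.1, (List.prefix_append p q).trans hs.2⟩

lemma disjoint_singleton_subtreeSeeds (i : ℕ) (p : List τ) (j j' : τ) :
    Disjoint {(i, p, j)} (subtreeSeeds i (p ++ [j'])) := by
  rw [Set.disjoint_singleton_left]
  intro hmem
  simpa using hmem.2.length_le

lemma disjoint_subtreeSeeds (i : ℕ) (p : List τ) {j j' : τ} (hj : j ≠ j') :
    Disjoint (subtreeSeeds i (p ++ [j])) (subtreeSeeds i (p ++ [j'])) := by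
  rw [Set.disjoint_left]
  rintro s ⟨-, hprefix⟩ ⟨-, hprefix'⟩
  have heq := (List.prefix_of_prefix_length_le hprefix hprefix' (by simp)).eq_of_length (by simp)
  exact hj (by simpa using heq)

variable {I : Input ι τ}

lemma dependsOn_treeCost (node leaf : List ι → ℕ) (i k : ℕ) (p : List τ) (S : List ι) :
    DependsOn (fun ω : Seeds τ => treeCost I node leaf (seedHash i ω) k p S)
      (subtreeSeeds i p) := by
  induction k generalizing p S with
  | zero => exact fun _ _ _ => rfl
  | succ k ih =>
    intro x y hxy
    simp only [treeCost]
    congr 1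
    refine Finset.sum_congr rfl fun j _ => ?_
    have hhash : seedHash i x p j = seedHash i y p j :=
      congrArg Subtype.val (hxy (i, p, j) ⟨rfl, List.prefix_refl p⟩)
    have hchild := ih (p ++ [j]) (I.bucket (bruteForce I S).val j)
      fun s hs => hxy s (subtreeSeeds_append_subset i p [j] hs)
    simp only at hchild
    rw [hhash, hchild]

lemma measurable_treeCost (node leaf : List ι → ℕ) (i k : ℕ) (p : List τ) (S : List ι) :
    Measurable fun ω : Seeds τ => treeCost I node leaf (seedHash i ω) k p S := by
  induction k generalizing p S with
  | zero => exact measurable_const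
  | succ k ih =>
    simp only [treeCost]
    refine measurable_const.add (Finset.measurable_sum _ fun j _ => ?_)
    exact Measurable.ite (measurableSet_seedHash_lt i p j _) (ih _ _) measurable_const

/-- The set `S` may be the set of a call at node `p`: all records contain all tokens of `p`. -/
def ValidCall (I : Input ι τ) (p : List τ) (S : List ι) : Prop :=
  S.Nodup ∧ ∀ x ∈ S, ∀ j ∈ p, j ∈ I.tok x

lemma ValidCall.bruteForce (hI : I.Regular) {p : List τ} {S : List ι} (hS : ValidCall I p S) :
    ValidCall I p (bruteForce I S).val :=
  ⟨hI.nodup_bruteForce hS.1, fun x hx => hS.2 x ((bruteForceRun hI hS.1).val_sublist.subset hx)⟩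

lemma ValidCall.bucket {p : List τ} {S : List ι} (hS : ValidCall I p S) (j : τ) :
    ValidCall I (p ++ [j]) (I.bucket S j) := by
  refine ⟨Input.nodup_bucket hS.1 j, fun x hx i hi => ?_⟩
  obtain ⟨hx, hj⟩ := Input.mem_bucket.1 hx
  rcases List.mem_append.1 hi with hi | hi
  · exact hS.2 x hx i hi
  · exact List.mem_singleton.1 hi ▸ hj

lemma lintegral_ite_treeCost (node leaf : List ι → ℕ) (i k : ℕ) (p : List τ) (j j' : τ)
    (S : List ι) {c : ℝ} (hc : c ∈ Set.Icc (0 : ℝ) 1) :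
    ∫⁻ ω, ((if seedHash i ω p j < c then treeCost I node leaf (seedHash i ω) k (p ++ [j']) S
      else 0 : ℕ) : ℝ≥0∞) ∂(seedMeasure τ) = ENNReal.ofReal c *
        ∫⁻ ω, (treeCost I node leaf (seedHash i ω) k (p ++ [j']) S : ℝ≥0∞) ∂(seedMeasure τ) := by
  have hevent := measurableSet_seedHash_lt i p j c
  have hindep : (fun ω => if seedHash i ω p j < c then (1 : ℝ≥0∞) else 0) ⟂ᵢ[seedMeasure τ]
      fun ω => (treeCost I node leaf (seedHash i ω) k (p ++ [j']) S : ℝ≥0∞) :=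
    (indepFun_of_dependsOn (disjoint_singleton_subtreeSeeds i p j j') hevent.mem
      (measurable_treeCost node leaf i k (p ++ [j']) S) (dependsOn_seedHash_lt i p j c)
      (dependsOn_treeCost node leaf i k (p ++ [j']) S)).comp
        (φ := fun q : Prop => if q then (1 : ℝ≥0∞) else 0) (ψ := fun m : ℕ => (m : ℝ≥0∞))
        (measurable_of_countable _) (measurable_of_countable _)
  have hprob : ∫⁻ ω : Seeds τ, (if seedHash i ω p j < c then (1 : ℝ≥0∞) else 0) ∂seedMeasure τ =
      ENNReal.ofReal c := by
    rw [← seedMeasure_seedHash_lt i p j hc, ← lintegral_indicator_one hevent]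
    rfl
  have hcost : Measurable fun ω : Seeds τ =>
      (treeCost I node leaf (seedHash i ω) k (p ++ [j']) S : ℝ≥0∞) :=
    (measurable_of_countable _).comp (measurable_treeCost _ _ _ _ _ _)
  rw [← hprob, ← lintegral_mul_eq_lintegral_mul_lintegral_of_indepFun
    (Measurable.ite hevent measurable_const measurable_const)
    hcost hindep]
  refine lintegral_congr fun ω => ?_
  by_cases h : seedHash i ω p j < c <;> simp [h]

lemma lintegral_treeCost_succ (node leaf : List ι → ℕ) (i k : ℕ) (p : List τ) (S : List ι)
    (hsize : 1 ≤ I.lam * I.t) :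
    ∫⁻ ω, (treeCost I node leaf (seedHash i ω) (k + 1) p S : ℝ≥0∞) ∂(seedMeasure τ) =
      node S + ∑ j ∈ I.tokensOf (bruteForce I S).val, ENNReal.ofReal (1 / (I.lam * I.t)) *
        ∫⁻ ω, (treeCost I node leaf (seedHash i ω) k (p ++ [j])
          (I.bucket (bruteForce I S).val j) : ℝ≥0∞) ∂(seedMeasure τ) := by
  have hc : 1 / (I.lam * I.t) ∈ Set.Icc (0 : ℝ) 1 :=
    ⟨by positivity, (div_le_one (by positivity)).2 hsize⟩
  simp only [treeCost, Nat.cast_add, Nat.cast_sum]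
  have hmeas (j : τ) : Measurable fun ω : Seeds τ => ((if seedHash i ω p j < 1 / (I.lam * I.t) then
      treeCost I node leaf (seedHash i ω) k (p ++ [j]) (I.bucket (bruteForce I S).val j)
      else 0 : ℕ) : ℝ≥0∞) :=
    (measurable_of_countable _).comp (Measurable.ite (measurableSet_seedHash_lt i p j _)
      (measurable_treeCost node leaf i k _ _) measurable_const)
  rw [lintegral_add_left measurable_const, lintegral_finsetSum _ fun j _ => hmeas j]
  simp only [lintegral_const, measure_univ, mul_one,
    lintegral_ite_treeCost node leaf i k p _ _ _ hc]

theorem lintegral_treeCost_le (hI : I.Regular) (hsize : 1 ≤ I.lam * I.t)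
    (node leaf : List ι → ℕ) (Pot : ℕ → List τ → List ι → ℝ)
    (hPot : ∀ k p S, 0 ≤ Pot k p S)
    (hleaf : ∀ p S, ValidCall I p S → (leaf S : ℝ) ≤ Pot 0 p S)
    (hstep : ∀ k p S, ValidCall I p S → (node S : ℝ) + 1 / (I.lam * I.t) *
      ∑ j ∈ I.tokensOf (bruteForce I S).val, Pot k (p ++ [j]) (I.bucket (bruteForce I S).val j) ≤
        Pot (k + 1) p S)
    (i k : ℕ) (p : List τ) (S : List ι) (hS : ValidCall I p S) :
    ∫⁻ ω, (treeCost I node leaf (seedHash i ω) k p S : ℝ≥0∞) ∂(seedMeasure τ) ≤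
      ENNReal.ofReal (Pot k p S) := by
  induction k generalizing p S with
  | zero =>
    simp only [treeCost, lintegral_const, measure_univ, mul_one]
    rw [← ENNReal.ofReal_natCast]
    exact ENNReal.ofReal_le_ofReal (hleaf p S hS)
  | succ k ih =>
    rw [lintegral_treeCost_succ node leaf i k p S hsize]
    refine le_trans ?_ (ENNReal.ofReal_le_ofReal (hstep k p S hS))
    rw [ENNReal.ofReal_add (by positivity)
      (mul_nonneg (by positivity) (Finset.sum_nonneg fun j _ => hPot _ _ _)),
      ENNReal.ofReal_natCast, Finset.mul_sum, ENNReal.ofReal_sum_of_nonneg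
        (fun j _ => mul_nonneg (by positivity) (hPot _ _ _))]
    gcongr with j
    rw [ENNReal.ofReal_mul (by positivity)]
    gcongr
    exact ih _ _ ((hS.bruteForce hI).bucket j)

end Seeds

/-! ### The potential of a point -/

section Potential

variable {ι τ : Type*}

/-- For two records with `m` common tokens and a node whose path has `D` distinct tokens, the
expected number of nodes below it that contain both records and are the first on their branch with
`k` distinct tokens on the path. Here `L = λ t`. -/
def pairWeight (L : ℝ) (k D m : ℕ) : ℝ := ∏ j ∈ Finset.Ico D k, ((m - j : ℕ) : ℝ) / (L - j)

lemma pairWeight_of_le (L : ℝ) {k D : ℕ} (hkD : k ≤ D) (m : ℕ) : pairWeight L k D m = 1 := by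
  simp [pairWeight, Finset.Ico_eq_empty_of_le hkD]

lemma pairWeight_nonneg {L : ℝ} {k : ℕ} (hk : (k : ℝ) < L) (D m : ℕ) : 0 ≤ pairWeight L k D m := by
  refine Finset.prod_nonneg fun j hj => div_nonneg (Nat.cast_nonneg _) ?_
  have hjk : (j : ℝ) < k := by exact_mod_cast (Finset.mem_Ico.1 hj).2
  linarith

/-- Of the `m` common tokens, `D` already lie on the path and `m - D` extend it. -/
lemma pairWeight_step {L : ℝ} {k D m : ℕ} (hk : (k : ℝ) < L) (hD : D < k) (hm : D ≤ m) :
    D * pairWeight L k D m + (m - D : ℝ) * pairWeight L k (D + 1) m = L * pairWeight L k D m := by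
  have hDk : (D : ℝ) < k := by exact_mod_cast hD
  have hsucc : pairWeight L k D m = ((m - D : ℝ) / (L - D)) * pairWeight L k (D + 1) m := by
    rw [pairWeight, Finset.prod_eq_prod_Ico_succ_bot hD, Nat.cast_sub hm]
    rfl
  have hne : L - D ≠ 0 := by linarith
  rw [hsucc]
  field_simp
  ring

/-- The number of distinct tokens on a path. Since a token may be drawn again, it is smaller than
the depth in general, and the analysis is in terms of it. -/
def distinct (p : List τ) : ℕ := p.toFinset.card

lemma distinct_append (p : List τ) (j : τ) :
    distinct (p ++ [j]) = if j ∈ p then distinct p else distinct p + 1 := by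
  have hinsert : (p ++ [j]).toFinset = insert j p.toFinset := by ext; simp
  rw [distinct, hinsert, Finset.card_insert_eq_ite]
  simp only [List.mem_toFinset, distinct]

lemma sum_distinct_append {p : List τ} {T : Finset τ} (hp : p.toFinset ⊆ T) (f : ℕ → ℝ) :
    ∑ j ∈ T, f (distinct (p ++ [j])) =
      distinct p * f (distinct p) + ((T.card : ℝ) - distinct p) * f (distinct p + 1) := by
  rw [← Finset.sum_sdiff hp, add_comm]
  congr 1
  · rw [Finset.sum_congr rfl (g := fun _ => f (distinct p))]
    · simp [distinct]
    · intro j hj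
      rw [distinct_append, if_pos (List.mem_toFinset.1 hj)]
  · rw [Finset.sum_congr rfl (g := fun _ => f (distinct p + 1))]
    · rw [Finset.sum_const, Finset.card_sdiff_of_subset hp, nsmul_eq_mul,
        Nat.cast_sub (Finset.card_le_card hp)]
      rfl
    · intro j hj
      rw [distinct_append, if_neg]
      simpa using (Finset.mem_sdiff.1 hj).2

lemma card_toFinset_erase {S : List ι} (hS : S.Nodup) {x : ι} (hx : x ∈ S) :
    ((S.toFinset.erase x).card : ℝ) = S.length - 1 := by
  rw [Finset.card_erase_of_mem (List.mem_toFinset.2 hx), List.toFinset_card_of_nodup hS,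
    Nat.cast_sub (List.length_pos_of_mem hx), Nat.cast_one]

/-- The potential of the record `x` in the call on `S` at node `p`: `a` pays for the calls that
contain `x`, the sum for the comparisons of `x` with other records. -/
def pointPotential (I : Input ι τ) (k : ℕ) (a : ℕ → ℝ) (c : ℝ) (p : List τ) (S : Finset ι)
    (x : ι) : ℝ :=
  a (distinct p) + c * ∑ y ∈ S.erase x, pairWeight (I.lam * I.t) k (distinct p) (I.overlap x y)

/-- Conditions under which `pointPotential` pays for `w` units of work per record and call and for
all comparisons. -/
structure IsPotential (I : Input ι τ) (w : ℝ) (k : ℕ) (a : ℕ → ℝ) (c : ℝ) : Prop where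
  lt_size : (k : ℝ) < I.lam * I.t
  weight_nonneg : 0 ≤ w
  one_le : 1 ≤ c
  weight_le : ∀ D, w ≤ a D
  eventually_const : ∀ D, k ≤ D → a D = a k
  split_lt : ∀ D < k, w + (D * a D + (I.t - D) * a (D + 1)) / (I.lam * I.t) ≤ a D
  split_ge : w + a k / I.lam ≤ a k + c * I.eps
  limit_le : ∀ D < k, w + (I.limit - 1) ≤ a D
  heavy_le : ∀ (S : List ι) (x : ι) (D : ℕ), S.Nodup → x ∈ S → I.limit < S.length → I.Heavy S x →
    D < k → (S.length : ℝ) - 1 ≤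
      c * ∑ y ∈ S.toFinset.erase x, pairWeight (I.lam * I.t) k D (I.overlap x y)

variable {I : Input ι τ}

lemma ValidCall.toFinset_subset_tokens {p : List τ} {S : List ι} (hS : ValidCall I p S) {x : ι}
    (hx : x ∈ S) : p.toFinset ⊆ I.tokens x := fun j hj =>
  Input.mem_tokens.2 (hS.2 x hx j (List.mem_toFinset.1 hj))

lemma sum_overlap_le_of_not_heavy (hsize : 0 < I.lam * I.t) {S : List ι} {x : ι}
    (hlen : 1 < S.length) (hx : ¬ I.Heavy S x) :
    (∑ y ∈ S.toFinset.erase x, (I.overlap x y : ℝ)) / (I.lam * I.t) ≤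
      (1 - I.eps) * (S.length - 1) := by
  have hlen' : (0 : ℝ) < S.length - 1 := sub_pos.2 (by exact_mod_cast hlen)
  have ht : (0 : ℝ) < I.t :=
    lt_of_le_of_ne (Nat.cast_nonneg _) (right_ne_zero_of_mul hsize.ne').symm
  rw [Input.Heavy, not_lt, one_div, inv_mul_eq_div, div_le_iff₀ hlen', div_le_iff₀ ht] at hx
  rw [div_le_iff₀ hsize]
  linarith

lemma Input.sum_tokens_sum_bucket_erase (S : List ι) (x : ι) (F : τ → ι → ℝ) :
    ∑ j ∈ I.tokens x, ∑ y ∈ (I.bucket S j).toFinset.erase x, F j y =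
      ∑ y ∈ S.toFinset.erase x, ∑ j ∈ I.tokens x ∩ I.tokens y, F j y := by
  refine Finset.sum_comm' fun j y => ?_
  simp only [Finset.mem_erase, List.mem_toFinset, Input.mem_bucket, Finset.mem_inter,
    Input.mem_tokens]
  tauto

lemma sum_pointPotential_bucket (hI : I.Regular) (k : ℕ) (a : ℕ → ℝ) (c : ℝ) {p : List τ}
    {S : List ι} (hS : ValidCall I p S) {x : ι} (hx : x ∈ S) :
    ∑ j ∈ I.tokens x, pointPotential I k a c (p ++ [j]) (I.bucket S j).toFinset x =
      (distinct p * a (distinct p) + ((I.t : ℝ) - distinct p) * a (distinct p + 1)) +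
      c * ∑ y ∈ S.toFinset.erase x,
        (distinct p * pairWeight (I.lam * I.t) k (distinct p) (I.overlap x y) +
          ((I.overlap x y : ℝ) - distinct p) *
            pairWeight (I.lam * I.t) k (distinct p + 1) (I.overlap x y)) := by
  have hxp := hS.toFinset_subset_tokens hx
  simp only [pointPotential]
  rw [Finset.sum_add_distrib, sum_distinct_append hxp, hI.card_tokens, ← Finset.mul_sum]
  congr 2
  rw [Input.sum_tokens_sum_bucket_erase]
  refine Finset.sum_congr rfl fun y hy => ?_
  exact sum_distinct_append (Finset.subset_inter hxp (hS.toFinset_subset_tokens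
    (List.mem_toFinset.1 (Finset.mem_of_mem_erase hy)))) fun D =>
      pairWeight (I.lam * I.t) k D (I.overlap x y)

variable {w : ℝ} {k : ℕ} {a : ℕ → ℝ} {c : ℝ}

lemma IsPotential.size_pos (hP : IsPotential I w k a c) : 0 < I.lam * I.t :=
  (Nat.cast_nonneg k).trans_lt hP.lt_size

lemma IsPotential.nonneg (hP : IsPotential I w k a c) : 0 ≤ c := zero_le_one.trans hP.one_le

lemma IsPotential.split_of_lt (hI : I.Regular) (hP : IsPotential I w k a c) {p : List τ}
    {S : List ι} (hS : ValidCall I p S) {x : ι} (hx : x ∈ S) (hD : distinct p < k) :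
    w + 1 / (I.lam * I.t) *
      ∑ j ∈ I.tokens x, pointPotential I k a c (p ++ [j]) (I.bucket S j).toFinset x ≤
        pointPotential I k a c p S.toFinset x := by
  have hL := hP.size_pos
  have hpairs : ∑ y ∈ S.toFinset.erase x,
      (distinct p * pairWeight (I.lam * I.t) k (distinct p) (I.overlap x y) +
        ((I.overlap x y : ℝ) - distinct p) *
          pairWeight (I.lam * I.t) k (distinct p + 1) (I.overlap x y)) =
      (I.lam * I.t) * ∑ y ∈ S.toFinset.erase x,
        pairWeight (I.lam * I.t) k (distinct p) (I.overlap x y) := by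
    rw [Finset.mul_sum]
    refine Finset.sum_congr rfl fun y hy => pairWeight_step hP.lt_size hD ?_
    exact Finset.card_le_card (Finset.subset_inter (hS.toFinset_subset_tokens hx)
      (hS.toFinset_subset_tokens (List.mem_toFinset.1 (Finset.mem_of_mem_erase hy))))
  have ht : (I.t : ℝ) ≠ 0 := right_ne_zero_of_mul hL.ne'
  have hlam : I.lam ≠ 0 := left_ne_zero_of_mul hL.ne'
  have hfactor (u v : ℝ) : w + 1 / (I.lam * I.t) * (u + c * (I.lam * I.t * v)) =
      w + u / (I.lam * I.t) + c * v := by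
    field_simp
    ring
  rw [sum_pointPotential_bucket hI k a c hS hx, hpairs, hfactor, pointPotential]
  linarith [hP.split_lt _ hD]

/-- After the stopping depth all weights are `1`, and the comparisons saved because `x` is not heavy
pay for the call. -/
lemma IsPotential.split_of_ge (hI : I.Regular) (hP : IsPotential I w k a c) (heps : 0 ≤ I.eps)
    {p : List τ} {S : List ι} (hS : ValidCall I p S) {x : ι} (hx : x ∈ S) (hlen : 1 < S.length)
    (hlight : ¬ I.Heavy S x) (hD : k ≤ distinct p) :
    w + 1 / (I.lam * I.t) *
      ∑ j ∈ I.tokens x, pointPotential I k a c (p ++ [j]) (I.bucket S j).toFinset x ≤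
        pointPotential I k a c p S.toFinset x := by
  have hD' : k ≤ distinct p + 1 := by omega
  have ht : (I.t : ℝ) ≠ 0 := right_ne_zero_of_mul hP.size_pos.ne'
  have hlam : I.lam ≠ 0 := left_ne_zero_of_mul hP.size_pos.ne'
  have hoverlap := mul_le_mul_of_nonneg_left
    (sum_overlap_le_of_not_heavy hP.size_pos hlen hlight) hP.nonneg
  rw [sum_pointPotential_bucket hI k a c hS hx, pointPotential]
  simp only [pairWeight_of_le _ hD, pairWeight_of_le _ hD', hP.eventually_const _ hD,
    hP.eventually_const _ hD', mul_one, add_sub_cancel, Finset.sum_const, nsmul_eq_mul,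
    card_toFinset_erase hS.1 hx]
  have hfactor (u : ℝ) : 1 / (I.lam * I.t) *
      ((distinct p * a k + ((I.t : ℝ) - distinct p) * a k) + c * u) =
        a k / I.lam + c * (u / (I.lam * I.t)) := by
    field_simp
    ring
  rw [hfactor]
  have hlen' : (0 : ℝ) ≤ S.length - 2 := sub_nonneg.2 (by exact_mod_cast hlen)
  nlinarith [hP.split_ge, mul_nonneg (mul_nonneg hP.nonneg heps) hlen']

lemma pointPotential_mono (hP : IsPotential I w k a c) (p : List τ) {S T : Finset ι} (hST : S ⊆ T)
    (x : ι) : pointPotential I k a c p S x ≤ pointPotential I k a c p T x := by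
  have hc := hP.nonneg
  unfold pointPotential
  gcongr
  exact fun y _ _ => pairWeight_nonneg hP.lt_size _ _

lemma weight_le_pointPotential (hP : IsPotential I w k a c) (p : List τ) (S : Finset ι) (x : ι) :
    w ≤ pointPotential I k a c p S x :=
  (hP.weight_le _).trans <| le_add_of_nonneg_right <|
    mul_nonneg hP.nonneg (Finset.sum_nonneg fun _ _ => pairWeight_nonneg hP.lt_size _ _)

lemma IsPotential.add_length_sub_one_le (hP : IsPotential I w k a c) (p : List τ) {S : List ι}
    (hS : S.Nodup) {x : ι} (hx : x ∈ S)
    (h : S.length ≤ I.limit ∨ I.limit < S.length ∧ I.Heavy S x) :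
    w + ((S.length : ℝ) - 1) ≤ pointPotential I k a c p S.toFinset x := by
  have hw := hP.weight_le (distinct p)
  rw [pointPotential]
  rcases lt_or_ge (distinct p) k with hD | hD
  · rcases h with hlimit | ⟨hlimit, hheavy⟩
    · have hlimit' : (S.length : ℝ) ≤ I.limit := by exact_mod_cast hlimit
      have hpairs : 0 ≤ c * ∑ y ∈ S.toFinset.erase x,
          pairWeight (I.lam * I.t) k (distinct p) (I.overlap x y) :=
        mul_nonneg hP.nonneg (Finset.sum_nonneg fun _ _ => pairWeight_nonneg hP.lt_size _ _)
      linarith [hP.limit_le _ hD]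
    · linarith [hP.heavy_le S x _ hS hx hlimit hheavy hD]
  · simp only [pairWeight_of_le _ hD, Finset.sum_const, nsmul_eq_mul, mul_one,
      card_toFinset_erase hS hx]
    have hpos : (1 : ℝ) ≤ S.length := by exact_mod_cast List.length_pos_of_mem hx
    nlinarith [hP.one_le]

end Potential

section CallPotential

variable {ι τ : Type*} {I : Input ι τ}

/-- The sum of the potentials of the records of a call, each with its own parameters. -/
def callPotential (I : Input ι τ) (k : ι → ℕ) (a : ι → ℕ → ℝ) (c : ι → ℝ) (p : List τ)
    (S : List ι) : ℝ :=
  ∑ x ∈ S.toFinset, pointPotential I (k x) (a x) (c x) p S.toFinset x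

variable {w : ℝ} {k : ι → ℕ} {a : ι → ℕ → ℝ} {c : ι → ℝ}

lemma callPotential_nonneg (hP : ∀ x, IsPotential I w (k x) (a x) (c x)) (p : List τ)
    (S : List ι) : 0 ≤ callPotential I k a c p S :=
  Finset.sum_nonneg fun x _ =>
    (hP x).weight_nonneg.trans (weight_le_pointPotential (hP x) _ _ _)

lemma callPotential_erase_add_le (hP : ∀ x, IsPotential I w (k x) (a x) (c x)) (p : List τ)
    {S : List ι} (hS : S.Nodup) {x : ι} (hx : x ∈ S) :
    callPotential I k a c p (S.erase x) + pointPotential I (k x) (a x) (c x) p S.toFinset x ≤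
      callPotential I k a c p S := by
  have hset : (S.erase x).toFinset = S.toFinset.erase x := by
    ext y
    simp [hS.mem_erase_iff]
  rw [callPotential, callPotential, hset, ← Finset.add_sum_erase _ _ (List.mem_toFinset.2 hx),
    add_comm]
  gcongr with y
  exact pointPotential_mono (hP y) p (Finset.erase_subset _ _) y

lemma sum_toFinset_const {S : List ι} (hS : S.Nodup) (u : ℝ) :
    ∑ _x ∈ S.toFinset, u = u * S.length := by
  rw [Finset.sum_const, List.toFinset_card_of_nodup hS, nsmul_eq_mul, mul_comm]

lemma BruteForceRun.add_callPotential_le (hP : ∀ x, IsPotential I w (k x) (a x) (c x))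
    (p : List τ) {S : List ι} {e : Exec ι (List ι)} (hrun : BruteForceRun I S e) :
    w * S.length + e.cmps + (callPotential I k a c p e.val - w * e.val.length) ≤
      callPotential I k a c p S := by
  induction hrun with
  | @pairs S hS hlimit =>
    simp only [bind_cmps, ticks_cmps, bruteForcePairs_cmps hS, ret_cmps, bind_val, ret_val,
      List.length_nil, callPotential, List.toFinset_nil, Finset.sum_empty, zero_add, add_zero]
    have hcost : w * S.length + ((S.length * (S.length - 1) : ℕ) : ℝ) =
        ∑ x ∈ S.toFinset, (w + ((S.length : ℝ) - 1)) := by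
      rw [sum_toFinset_const hS]
      rcases S.length with _ | l
      · simp
      · push_cast [Nat.add_sub_cancel]
        ring
    rw [hcost, Nat.cast_zero, mul_zero, sub_zero, add_zero]
    exact Finset.sum_le_sum fun x hx =>
      (hP x).add_length_sub_one_le p hS (List.mem_toFinset.1 hx) (.inl hlimit)
  | light _ _ _ => simp [search_cmps]
  | @remove S x e hS hlimit hx hheavy _ ih =>
    have hcmps : ((bruteForcePoint I S x).cmps : ℝ) = S.length - 1 := by
      rw [← bruteForcePoint_cmps_add_one (I := I) hS hx]
      push_cast
      ring
    have hlen : ((S.erase x).length : ℝ) = S.length - 1 := by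
      rw [List.length_erase_of_mem hx, Nat.cast_sub (List.length_pos_of_mem hx), Nat.cast_one]
    have herase := callPotential_erase_add_le hP p hS hx
    have hpay := (hP x).add_length_sub_one_le p hS hx (.inr ⟨hlimit, hheavy⟩)
    simp only [bind_cmps, ticks_cmps, search_cmps, bind_val]
    push_cast
    rw [hlen] at ih
    linarith

lemma add_sum_callPotential_bucket_le (hI : I.Regular) (heps : 0 ≤ I.eps)
    (hP : ∀ x, IsPotential I w (k x) (a x) (c x)) {p : List τ} {S : List ι}
    (hS : ValidCall I p S) (hlen : 1 < S.length) (hlight : ∀ x ∈ S, ¬ I.Heavy S x) :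
    w * S.length + 1 / (I.lam * I.t) * ∑ j ∈ I.tokensOf S,
      callPotential I k a c (p ++ [j]) (I.bucket S j) ≤ callPotential I k a c p S := by
  have hswap : ∑ j ∈ I.tokensOf S, callPotential I k a c (p ++ [j]) (I.bucket S j) =
      ∑ x ∈ S.toFinset, ∑ j ∈ I.tokens x,
        pointPotential I (k x) (a x) (c x) (p ++ [j]) (I.bucket S j).toFinset x :=
    Input.sum_tokensOf_sum_bucket S _
  rw [hswap, ← sum_toFinset_const hS.1, Finset.mul_sum, ← Finset.sum_add_distrib, callPotential]
  refine Finset.sum_le_sum fun x hx => ?_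
  have hx := List.mem_toFinset.1 hx
  rcases lt_or_ge (distinct p) (k x) with hD | hD
  · exact (hP x).split_of_lt hI hS hx hD
  · exact (hP x).split_of_ge hI heps hS hx hlen (hlight x hx) hD

theorem lintegral_treeCost_le_callPotential (hI : I.Regular) (hlimit : 1 ≤ I.limit)
    (hsize : 1 ≤ I.lam * I.t) (heps : 0 ≤ I.eps) (hP : ∀ x, IsPotential I w (k x) (a x) (c x))
    {node : List ι → ℕ} (hnode : ∀ S, (node S : ℝ) = w * S.length + (bruteForce I S).cmps)
    (i d : ℕ) {S : List ι} (hS : S.Nodup) :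
    ∫⁻ ω, (treeCost I node (fun _ => 0) (seedHash i ω) d [] S : ℝ≥0∞) ∂(seedMeasure τ) ≤
      ENNReal.ofReal (callPotential I k a c [] S) := by
  refine lintegral_treeCost_le hI hsize node (fun _ => 0) (fun _ => callPotential I k a c)
    (fun _ => callPotential_nonneg hP) (fun p S _ => by simpa using callPotential_nonneg hP p S)
    (fun _ p S hS => ?_) i d [] S ⟨hS, by simp⟩
  have hrun := bruteForceRun hI hS.1
  have hbrute := hrun.add_callPotential_le hP p
  suffices hsplit : w * (bruteForce I S).val.length + 1 / (I.lam * I.t) *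
      ∑ j ∈ I.tokensOf (bruteForce I S).val,
        callPotential I k a c (p ++ [j]) (I.bucket (bruteForce I S).val j) ≤
        callPotential I k a c p (bruteForce I S).val by
    rw [hnode]
    linarith
  rcases hrun.val_eq_nil_or with hnil | ⟨hlen, hlight⟩
  · simp [hnil, Input.tokensOf, callPotential]
  · exact add_sum_callPotential_bucket_le hI heps hP (hS.bruteForce hI) (hlimit.trans_lt hlen)
      hlight

end CallPotential

/-! ### Two potentials -/

section TwoPotentials

variable {ι τ : Type*} {I : Input ι τ}

lemma exp_neg_two_mul_le {u : ℝ} (h0 : 0 ≤ u) (h1 : u ≤ 1 / 2) : Real.exp (-(2 * u)) ≤ 1 - u := by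
  rw [Real.exp_neg]
  calc (Real.exp (2 * u))⁻¹ ≤ (2 * u + 1)⁻¹ := by
        gcongr
        exact Real.add_one_le_exp (2 * u)
    _ ≤ 1 - u := by
        rw [inv_le_iff_one_le_mul₀ (by linarith)]
        nlinarith

lemma exp_neg_four_le_one_sub_pow {u : ℝ} {k m : ℕ} (h0 : 0 ≤ u) (h1 : u ≤ 1 / 2)
    (hku : k * u ≤ 2) (hm : m ≤ k) : Real.exp (-4) ≤ (1 - u) ^ m :=
  calc Real.exp (-4) ≤ Real.exp (k * -(2 * u)) := Real.exp_le_exp.2 (by linarith)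
    _ = Real.exp (-(2 * u)) ^ k := Real.exp_nat_mul _ _
    _ ≤ (1 - u) ^ k := by
        gcongr
        exact exp_neg_two_mul_le h0 h1
    _ ≤ (1 - u) ^ m := pow_le_pow_of_le_one (by linarith) (by linarith) hm

lemma sub_div_pow_le_pairWeight {L : ℝ} {k : ℕ} (hk : (k : ℝ) < L) (D m : ℕ) :
    (((m - k : ℕ) : ℝ) / L) ^ (k - D) ≤ pairWeight L k D m := by
  have hL : 0 ≤ L := (Nat.cast_nonneg k).trans hk.le
  rw [pairWeight, ← Nat.card_Ico D k, ← Finset.prod_const]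
  refine Finset.prod_le_prod (fun _ _ => by positivity) fun j hj => ?_
  have hjk : j < k := (Finset.mem_Ico.1 hj).2
  have hjL : (j : ℝ) < L := lt_trans (by exact_mod_cast hjk) hk
  refine div_le_div₀ (Nat.cast_nonneg _) ?_ (sub_pos.2 hjL) (sub_le_self _ (Nat.cast_nonneg j))
  exact_mod_cast (by omega : m - k ≤ m - j)

lemma Input.Heavy.mul_le_sum {S : List ι} {x : ι} (hheavy : I.Heavy S x) (hS : S.Nodup)
    (hx : x ∈ S) (hlen : 1 < S.length) (hsize : 0 < I.lam * I.t) (k : ℕ) :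
    (1 - (I.eps + k / (I.lam * I.t))) * (S.length - 1) ≤
      ∑ y ∈ S.toFinset.erase x, ((I.overlap x y - k : ℕ) : ℝ) / (I.lam * I.t) := by
  have hlen' : (0 : ℝ) < S.length - 1 := sub_pos.2 (by exact_mod_cast hlen)
  have ht : (0 : ℝ) < I.t :=
    lt_of_le_of_ne (Nat.cast_nonneg _) (right_ne_zero_of_mul hsize.ne').symm
  rw [Input.Heavy, one_div, inv_mul_eq_div, lt_div_iff₀ hlen', lt_div_iff₀ ht] at hheavy
  have hcancel : k / (I.lam * I.t) * (S.length - 1) * (I.lam * I.t) = k * ((S.length : ℝ) - 1) := by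
    rw [mul_right_comm, div_mul_cancel₀ _ hsize.ne']
  calc (1 - (I.eps + k / (I.lam * I.t))) * (S.length - 1)
      ≤ (∑ y ∈ S.toFinset.erase x, ((I.overlap x y : ℝ) - k)) / (I.lam * I.t) := by
        rw [le_div_iff₀ hsize, Finset.sum_sub_distrib, Finset.sum_const, nsmul_eq_mul,
          card_toFinset_erase hS hx]
        linarith
    _ ≤ ∑ y ∈ S.toFinset.erase x, ((I.overlap x y - k : ℕ) : ℝ) / (I.lam * I.t) := by
        rw [Finset.sum_div]
        gcongr with y
        rw [sub_le_iff_le_add]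
        exact_mod_cast (by omega : I.overlap x y ≤ I.overlap x y - k + k)

/-- The parameters of an input and the stopping depths `k` for which the potentials below are
valid: paths of `k` tokens are short compared with `λ t` and with `1 / ε`. -/
structure Admissible (lam : ℝ) (t limit : ℕ) (eps : ℝ) (k : ℕ) : Prop where
  lam_mem : lam ∈ Set.Ioo (0 : ℝ) 1
  limit_pos : 1 ≤ limit
  eps_nonneg : 0 ≤ eps
  size : 4 * (k : ℝ) ^ 2 < lam * t
  depth : k = 0 ∨ (eps ≤ 1 / 4 ∧ (k : ℝ) * eps ≤ 1)

variable {lam eps : ℝ} {t limit k : ℕ}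

lemma Admissible.size_pos (h : Admissible lam t limit eps k) : 0 < lam * t :=
  lt_of_le_of_lt (by positivity) h.size

lemma Admissible.lt_size (h : Admissible lam t limit eps k) : (k : ℝ) < lam * t := by
  have hsq : (k : ℝ) ≤ (k : ℝ) ^ 2 := by exact_mod_cast Nat.le_self_pow two_ne_zero k
  nlinarith [h.size, sq_nonneg (k : ℝ)]

lemma Admissible.mul_div_size_le (h : Admissible lam t limit eps k) :
    k * (k / (lam * t)) ≤ (1 / 4 : ℝ) := by
  rw [← mul_div_assoc, div_le_iff₀ h.size_pos]
  nlinarith [h.size]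

/-- By convexity, the comparisons of a heavy point are paid for by what they would cost later. -/
lemma Admissible.heavy_le (h : Admissible I.lam I.t I.limit I.eps k) {c : ℝ}
    (hc : Real.exp 4 ≤ c) (S : List ι) (x : ι) (D : ℕ) (hS : S.Nodup) (hx : x ∈ S)
    (hlen : I.limit < S.length) (hheavy : I.Heavy S x) (hD : D < k) : (S.length : ℝ) - 1 ≤
      c * ∑ y ∈ S.toFinset.erase x, pairWeight (I.lam * I.t) k D (I.overlap x y) := by
  obtain ⟨heps, hkeps⟩ := h.depth.resolve_left (by omega)
  set L := I.lam * I.t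
  set T := S.toFinset.erase x
  have hlen1 : 1 < S.length := h.limit_pos.trans_lt hlen
  have hN : (0 : ℝ) < S.length - 1 := sub_pos.2 (by exact_mod_cast hlen1)
  have hk1 : (1 : ℝ) ≤ k := by exact_mod_cast (by omega : 1 ≤ k)
  have hL := h.size_pos
  have hkL := h.mul_div_size_le
  have hkL0 : (0 : ℝ) ≤ k / L := by positivity
  have heps0 := h.eps_nonneg
  have hmean : 1 - (I.eps + k / L) ≤
      ∑ y ∈ T, ((S.length : ℝ) - 1)⁻¹ * (((I.overlap x y - k : ℕ) : ℝ) / L) := by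
    rw [← Finset.mul_sum, inv_mul_eq_div, le_div_iff₀ hN]
    exact hheavy.mul_le_sum hS hx hlen1 hL k
  have hjensen := Real.pow_arith_mean_le_arith_mean_pow T (fun _ => ((S.length : ℝ) - 1)⁻¹)
    (fun y => ((I.overlap x y - k : ℕ) : ℝ) / L) (fun _ _ => inv_nonneg.2 hN.le)
    (by rw [Finset.sum_const, nsmul_eq_mul, card_toFinset_erase hS hx, mul_inv_cancel₀ hN.ne'])
    (fun y _ => by positivity) (k - D)
  have hpow : Real.exp (-4) ≤
      ∑ y ∈ T, ((S.length : ℝ) - 1)⁻¹ * (((I.overlap x y - k : ℕ) : ℝ) / L) ^ (k - D) :=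
    (exp_neg_four_le_one_sub_pow (by positivity) (by nlinarith) (by linarith)
      (Nat.sub_le k D)).trans <|
        (pow_le_pow_left₀ (by nlinarith) hmean _).trans hjensen
  rw [← Finset.mul_sum, inv_mul_eq_div, le_div_iff₀ hN] at hpow
  calc (S.length : ℝ) - 1 = Real.exp 4 * (Real.exp (-4) * (S.length - 1)) := by
        rw [← mul_assoc, ← Real.exp_add, add_neg_cancel, Real.exp_zero, one_mul]
    _ ≤ c * ∑ y ∈ T, pairWeight L k D (I.overlap x y) := by
        refine mul_le_mul hc (hpow.trans ?_) (by positivity) ((Real.exp_pos 4).le.trans hc)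
        exact Finset.sum_le_sum fun y _ => sub_div_pow_le_pairWeight h.lt_size D _

/-- The expected number of buckets that contain a given record, corrected for tokens that are
drawn again along a path of length at most `k`. -/
def branching (lam t : ℝ) (k : ℕ) : ℝ := t / (lam * t - k)

lemma Admissible.one_le_branching (h : Admissible lam t limit eps k) : 1 ≤ branching lam t k := by
  rw [branching, one_le_div (sub_pos.2 h.lt_size)]
  nlinarith [h.lam_mem.2, Nat.cast_nonneg (α := ℝ) t, Nat.cast_nonneg (α := ℝ) k]

lemma Admissible.sub_mul_branching_pow_succ (h : Admissible lam t limit eps k) (m : ℕ) :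
    (lam * t - k) * branching lam t k ^ (m + 1) = t * branching lam t k ^ m := by
  rw [pow_succ', ← mul_assoc, branching, mul_div_cancel₀ _ (sub_pos.2 h.lt_size).ne']

lemma Admissible.branching_pow_le (h : Admissible lam t limit eps k) :
    branching lam t k ^ k ≤ 2 * (1 / lam) ^ k := by
  have hL := h.size_pos
  have ht : (t : ℝ) ≠ 0 := right_ne_zero_of_mul hL.ne'
  have hlam := h.lam_mem.1
  have hfrac : 0 < 1 - k / (lam * t) := by
    rw [sub_pos, div_lt_one hL]
    exact h.lt_size
  have hbranching : branching lam t k = (1 - k / (lam * t))⁻¹ * (1 / lam) := by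
    rw [branching, one_sub_div hL.ne']
    field_simp
  have hbernoulli : 1 / 2 ≤ (1 - k / (lam * t)) ^ k := by
    have := one_add_mul_le_pow (a := -((k : ℝ) / (lam * t))) (by linarith) k
    rw [← sub_eq_add_neg] at this
    linarith [h.mul_div_size_le]
  rw [hbranching, mul_pow, inv_pow]
  gcongr
  rw [inv_le_comm₀ (by positivity) two_pos]
  linarith

lemma add_div_le_of_le_sub_mul {L t w a a' : ℝ} {D k : ℕ} (hL : 0 < L) (hD : D ≤ k) (ha : 0 ≤ a)
    (ha' : 0 ≤ a') (h : w * L + t * a' ≤ (L - k) * a) : w + (D * a + (t - D) * a') / L ≤ a := by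
  have hDk : (D : ℝ) ≤ k := by exact_mod_cast hD
  rw [← le_sub_iff_add_le', div_le_iff₀ hL]
  nlinarith [mul_le_mul_of_nonneg_right hDk ha, mul_nonneg (Nat.cast_nonneg (α := ℝ) D) ha']

lemma Admissible.isPotential_cmps (h : Admissible I.lam I.t I.limit I.eps k) :
    IsPotential I 0 k (fun D => if D < k then I.limit * branching I.lam I.t k ^ (k - D) else 0)
      (Real.exp 4) where
  lt_size := h.lt_size
  weight_nonneg := le_rfl
  one_le := Real.one_le_exp (by norm_num)
  weight_le D := by
    have := h.one_le_branching
    split_ifs <;> positivity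
  eventually_const D hD := by simp only [hD.not_gt, lt_irrefl, if_false]
  split_lt D hD := by
    have hB := h.one_le_branching
    have hnext : (if D + 1 < k then (I.limit : ℝ) * branching I.lam I.t k ^ (k - (D + 1)) else 0) ≤
        I.limit * branching I.lam I.t k ^ (k - (D + 1)) := by
      split_ifs
      · rfl
      · positivity
    have hstep := h.sub_mul_branching_pow_succ (k - (D + 1))
    rw [show k - (D + 1) + 1 = k - D by omega] at hstep
    simp only [hD, if_true]
    refine add_div_le_of_le_sub_mul h.size_pos hD.le (by positivity)
      (by split_ifs <;> positivity) ?_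
    calc 0 * (I.lam * I.t) + I.t * _ ≤ I.t * (I.limit * branching I.lam I.t k ^ (k - (D + 1))) := by
          rw [zero_mul, zero_add]
          gcongr
      _ = (I.lam * I.t - k) * (I.limit * branching I.lam I.t k ^ (k - D)) := by
          linear_combination -(I.limit : ℝ) * hstep
  split_ge := by
    simp only [lt_irrefl, if_false, zero_div, zero_add]
    exact mul_nonneg (Real.exp_pos 4).le h.eps_nonneg
  limit_le D hD := by
    have hB : 1 ≤ branching I.lam I.t k ^ (k - D) := one_le_pow₀ h.one_le_branching
    simp only [hD, if_true, zero_add]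
    nlinarith [Nat.cast_nonneg (α := ℝ) I.limit]
  heavy_le := h.heavy_le le_rfl

/-- A bound for the expected number of calls that contain a given record below a node whose path
lacks `m` of the `k` distinct tokens. The subtracted `λ` makes the recursion
`Admissible.size_add_mul_expectedCalls_le` and the value `1` at `m = 0` hold together. -/
def expectedCalls (lam t : ℝ) (k m : ℕ) : ℝ := (branching lam t k ^ m - lam) / (1 - lam)

lemma Admissible.one_le_expectedCalls (h : Admissible lam t limit eps k) (m : ℕ) :
    1 ≤ expectedCalls lam t k m := by
  rw [expectedCalls, one_le_div (sub_pos.2 h.lam_mem.2)]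
  linarith [one_le_pow₀ h.one_le_branching (n := m)]

lemma Admissible.expectedCalls_zero (h : Admissible lam t limit eps k) :
    expectedCalls lam t k 0 = 1 := by
  rw [expectedCalls, pow_zero, div_self (sub_pos.2 h.lam_mem.2).ne']

lemma Admissible.size_add_mul_expectedCalls_le (h : Admissible lam t limit eps k) (m : ℕ) :
    lam * t + t * expectedCalls lam t k m ≤
      (lam * t - k) * expectedCalls lam t k (m + 1) := by
  have hlam1 : 0 < 1 - lam := sub_pos.2 h.lam_mem.2
  have hstep := h.sub_mul_branching_pow_succ m
  simp only [expectedCalls]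
  rw [mul_div_assoc', mul_div_assoc', le_div_iff₀ hlam1, add_mul, div_mul_cancel₀ _ hlam1.ne']
  nlinarith [mul_nonneg (Nat.cast_nonneg (α := ℝ) k) h.lam_mem.1.le]

lemma Admissible.isPotential_work (h : Admissible I.lam I.t I.limit I.eps k) (heps : 0 < I.eps) :
    IsPotential I 1 k (fun D => I.limit * expectedCalls I.lam I.t k (k - D))
      (Real.exp 4 + (1 + I.limit / I.lam) / I.eps) where
  lt_size := h.lt_size
  weight_nonneg := zero_le_one
  one_le := by
    have hlam := h.lam_mem.1
    exact (Real.one_le_exp (by norm_num)).trans (le_add_of_nonneg_right (by positivity))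
  weight_le D := one_le_mul_of_one_le_of_one_le (by exact_mod_cast h.limit_pos)
    (h.one_le_expectedCalls _)
  eventually_const D hD := by rw [Nat.sub_eq_zero_of_le hD, Nat.sub_self]
  split_lt D hD := by
    have hlimit : (1 : ℝ) ≤ I.limit := by exact_mod_cast h.limit_pos
    have hcalls (m : ℕ) : 0 ≤ (I.limit : ℝ) * expectedCalls I.lam I.t k m :=
      mul_nonneg (Nat.cast_nonneg _) (zero_le_one.trans (h.one_le_expectedCalls m))
    refine add_div_le_of_le_sub_mul h.size_pos hD.le (hcalls _) (hcalls _) ?_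
    have hstep := h.size_add_mul_expectedCalls_le (k - (D + 1))
    rw [show k - (D + 1) + 1 = k - D by omega] at hstep
    nlinarith [mul_le_mul_of_nonneg_left hstep (Nat.cast_nonneg I.limit), h.size_pos]
  split_ge := by
    have hpay : (1 + I.limit / I.lam) / I.eps * I.eps = 1 + I.limit / I.lam :=
      div_mul_cancel₀ _ heps.ne'
    rw [Nat.sub_self, h.expectedCalls_zero, mul_one, add_mul, hpay]
    have := mul_nonneg (Real.exp_pos 4).le heps.le
    linarith [Nat.cast_nonneg (α := ℝ) I.limit]
  limit_le D _ := by
    nlinarith [h.one_le_expectedCalls (k - D), Nat.cast_nonneg (α := ℝ) I.limit]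
  heavy_le := by
    have hlam := h.lam_mem.1
    exact h.heavy_le (le_add_of_nonneg_right (by positivity))

end TwoPotentials

/-! ### The depth of the recursion -/

section Depth

variable {ι τ : Type*} {I : Input ι τ}

lemma orderedPairs_eq_sum {S : List ι} (hS : S.Nodup) :
    (orderedPairs S : ℝ) = ∑ x ∈ S.toFinset, ∑ _y ∈ S.toFinset.erase x, (1 : ℝ) := by
  have hinner : ∀ x ∈ S.toFinset, ∑ _y ∈ S.toFinset.erase x, (1 : ℝ) = S.length - 1 :=
    fun x hx => by
      rw [Finset.sum_const, nsmul_eq_mul, mul_one,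
        card_toFinset_erase hS (List.mem_toFinset.1 hx)]
  rw [Finset.sum_congr rfl hinner, sum_toFinset_const hS, orderedPairs]
  rcases S.length with _ | l
  · simp
  · push_cast [Nat.add_sub_cancel]
    ring

lemma orderedPairs_mono {S T : List ι} (h : S.length ≤ T.length) :
    orderedPairs S ≤ orderedPairs T :=
  Nat.mul_le_mul h (Nat.sub_le_sub_right h 1)

lemma sum_orderedPairs_bucket {S : List ι} (hS : S.Nodup) :
    ∑ j ∈ I.tokensOf S, (orderedPairs (I.bucket S j) : ℝ) =
      ∑ x ∈ S.toFinset, ∑ y ∈ S.toFinset.erase x, (I.overlap x y : ℝ) := by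
  simp only [orderedPairs_eq_sum (Input.nodup_bucket hS _)]
  rw [Input.sum_tokensOf_sum_bucket S fun j x => ∑ _y ∈ (I.bucket S j).toFinset.erase x, (1 : ℝ)]
  refine Finset.sum_congr rfl fun x _ => ?_
  rw [Input.sum_tokens_sum_bucket_erase]
  simp only [Finset.sum_const, nsmul_eq_mul, mul_one, Input.overlap]

lemma sum_orderedPairs_bucket_le (hsize : 0 < I.lam * I.t) {S : List ι} (hS : S.Nodup)
    (hlen : 1 < S.length) (hlight : ∀ x ∈ S, ¬ I.Heavy S x) :
    1 / (I.lam * I.t) * ∑ j ∈ I.tokensOf S, (orderedPairs (I.bucket S j) : ℝ) ≤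
      max (1 - I.eps) 0 * orderedPairs S := by
  have hlen' : (0 : ℝ) ≤ S.length - 1 := sub_nonneg.2 (by exact_mod_cast hlen.le)
  rw [sum_orderedPairs_bucket hS, orderedPairs_eq_sum hS, Finset.mul_sum, Finset.mul_sum]
  refine Finset.sum_le_sum fun x hx => ?_
  have hx := List.mem_toFinset.1 hx
  calc 1 / (I.lam * I.t) * ∑ y ∈ S.toFinset.erase x, (I.overlap x y : ℝ)
      ≤ (1 - I.eps) * (S.length - 1) := by
        rw [one_div_mul_eq_div]
        exact sum_overlap_le_of_not_heavy hsize hlen (hlight x hx)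
    _ ≤ max (1 - I.eps) 0 * ∑ _y ∈ S.toFinset.erase x, (1 : ℝ) := by
        rw [Finset.sum_const, nsmul_eq_mul, mul_one, card_toFinset_erase hS hx]
        gcongr
        exact le_max_left _ _

/-- Every level of the recursion loses in expectation the fraction `ε` of the pairs. -/
theorem lintegral_orderedPairs_le (hI : I.Regular) (hlimit : 1 ≤ I.limit)
    (hsize : 1 ≤ I.lam * I.t) (i K : ℕ) {S : List ι} (hS : S.Nodup) :
    ∫⁻ ω, (treeCost I (fun _ => 0) orderedPairs (seedHash i ω) K [] S : ℝ≥0∞) ∂(seedMeasure τ) ≤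
      ENNReal.ofReal (max (1 - I.eps) 0 ^ K * orderedPairs S) := by
  refine lintegral_treeCost_le hI hsize (fun _ => 0) orderedPairs
    (fun k _ S => max (1 - I.eps) 0 ^ k * orderedPairs S) (fun k _ S => by positivity)
    (fun p S _ => by simp) (fun k _ S hS => ?_) i K [] S ⟨hS, by simp⟩
  have hrun := bruteForceRun hI hS.1
  have hmono : (orderedPairs (bruteForce I S).val : ℝ) ≤ orderedPairs S := by
    exact_mod_cast orderedPairs_mono hrun.val_sublist.length_le
  have hdecay : 1 / (I.lam * I.t) * ∑ j ∈ I.tokensOf (bruteForce I S).val,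
      (orderedPairs (I.bucket (bruteForce I S).val j) : ℝ) ≤
        max (1 - I.eps) 0 * orderedPairs (bruteForce I S).val := by
    rcases hrun.val_eq_nil_or with hnil | ⟨hlen, hlight⟩
    · simp [hnil, Input.tokensOf, orderedPairs]
    · exact sum_orderedPairs_bucket_le (zero_lt_one.trans_le hsize) (hI.nodup_bruteForce hS.1)
        (hlimit.trans_lt hlen) hlight
  rw [← Finset.mul_sum, Nat.cast_zero, zero_add, mul_left_comm, pow_succ, mul_assoc]
  exact mul_le_mul_of_nonneg_left (hdecay.trans (by gcongr)) (by positivity)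

lemma seedMeasure_treeCost_ne_zero_le (hI : I.Regular) (hlimit : 1 ≤ I.limit)
    (hsize : 1 ≤ I.lam * I.t) (i K : ℕ) {S : List ι} (hS : S.Nodup) :
    seedMeasure τ {ω | treeCost I (fun _ => 0) orderedPairs (seedHash i ω) K [] S ≠ 0} ≤
      ENNReal.ofReal (max (1 - I.eps) 0 ^ K * orderedPairs S) := by
  have hmeas : Measurable fun ω : Seeds τ =>
      (treeCost I (fun _ => 0) orderedPairs (seedHash i ω) K [] S : ℝ≥0∞) :=
    (measurable_of_countable _).comp (measurable_treeCost _ _ _ _ _ _)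
  have hmarkov := mul_meas_ge_le_lintegral (μ := seedMeasure τ) hmeas 1
  rw [one_mul] at hmarkov
  refine ((measure_mono fun ω hω => ?_).trans hmarkov).trans
    (lintegral_orderedPairs_le hI hlimit hsize i K hS)
  exact Nat.one_le_cast (α := ℝ≥0∞).2 (Nat.one_le_iff_ne_zero.2 hω)

end Depth

/-! ### Recall -/

section Recall

variable {ι τ : Type*} {I : Input ι τ}

lemma dependsOn_mem_cpsJoin_out (hI : I.Regular) (q : ι × ι) (i k : ℕ) (p : List τ) (S : List ι) :
    DependsOn (fun ω : Seeds τ => q ∈ (cpsJoin I (seedHash i ω) k p S).out)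
      (subtreeSeeds i p) := by
  induction k generalizing p S with
  | zero => exact fun _ _ _ => rfl
  | succ k ih =>
    intro ω ω' h
    have hseed (j : τ) : seedHash i ω p j = seedHash i ω' p j :=
      congrArg Subtype.val (h (i, p, j) ⟨rfl, List.prefix_refl p⟩)
    have hrec (j : τ) := ih (p ++ [j]) (I.bucket (bruteForce I S).val j)
      fun s hs => h s (subtreeSeeds_append_subset i p [j] hs)
    simp only [mem_cpsJoin_out_succ hI, hseed, hrec]

lemma measurableSet_mem_cpsJoin_out (hI : I.Regular) (q : ι × ι) (i k : ℕ) (p : List τ)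
    (S : List ι) : MeasurableSet {ω : Seeds τ | q ∈ (cpsJoin I (seedHash i ω) k p S).out} := by
  induction k generalizing p S with
  | zero => simp [cpsJoin]
  | succ k ih =>
    have hunion : {ω : Seeds τ | q ∈ (cpsJoin I (seedHash i ω) (k + 1) p S).out} =
        {_ω | q ∈ (bruteForce I S).out} ∪
        ⋃ j ∈ I.tokensOf (bruteForce I S).val, {ω | seedHash i ω p j < 1 / (I.lam * I.t)} ∩
          {ω | q ∈ (cpsJoin I (seedHash i ω) k (p ++ [j])
            (I.bucket (bruteForce I S).val j)).out} := by
      ext ω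
      simp only [mem_cpsJoin_out_succ hI, Set.mem_union, Set.mem_ofPred_eq, Set.mem_iUnion,
        Set.mem_inter_iff, exists_prop]
    rw [hunion]
    exact (MeasurableSet.const _).union (Finset.measurableSet_biUnion _ fun j _ =>
      (measurableSet_seedHash_lt i p j _).inter (ih _ _))

/-- The pair `q` has not been reported by the first `k + 1` levels of the recursion although no
call at depth `k` has two points. -/
def missed (I : Input ι τ) (q : ι × ι) (i k : ℕ) (p : List τ) (S : List ι) : Set (Seeds τ) :=
  {ω | q ∉ (cpsJoin I (seedHash i ω) (k + 1) p S).out ∧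
    treeCost I (fun _ => 0) orderedPairs (seedHash i ω) k p S = 0}

lemma measurableSet_missed (hI : I.Regular) (q : ι × ι) (i k : ℕ) (p : List τ) (S : List ι) :
    MeasurableSet (missed I q i k p S) :=
  (measurableSet_mem_cpsJoin_out hI q i (k + 1) p S).compl.inter
    ((measurable_treeCost _ _ i k p S) (measurableSet_singleton 0))

lemma dependsOn_missed (hI : I.Regular) (q : ι × ι) (i k : ℕ) (p : List τ) (S : List ι) :
    DependsOn (· ∈ missed I q i k p S) (subtreeSeeds i p) := fun _ _ h =>
  congrArg₂ (fun (A : Prop) (m : ℕ) => ¬ A ∧ m = 0)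
    (dependsOn_mem_cpsJoin_out hI q i (k + 1) p S h)
    (dependsOn_treeCost (I := I) (fun _ => 0) orderedPairs i k p S h)

lemma missed_eq_empty_of_mem_out (hI : I.Regular) {q : ι × ι} {S : List ι}
    (hq : q ∈ (bruteForce I S).out) (i k : ℕ) (p : List τ) : missed I q i k p S = ∅ :=
  Set.eq_empty_of_forall_notMem fun _ hω => hω.1 ((mem_cpsJoin_out_succ hI _ _ _ _ _).2 (.inl hq))

/-- The splitting step at node `p` opens the bucket `T` of the token `j`, and the recursion on it
does not miss the pair `q`. -/
def foundBelow (I : Input ι τ) (q : ι × ι) (i k : ℕ) (p : List τ) (T : List ι) (j : τ) :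
    Set (Seeds τ) :=
  {ω | seedHash i ω p j < 1 / (I.lam * I.t)} ∩ (missed I q i k (p ++ [j]) T)ᶜ

lemma missed_succ_subset (hI : I.Regular) (q : ι × ι) (i k : ℕ) (p : List τ) (S : List ι) :
    missed I q i (k + 1) p S ⊆ ⋂ j ∈ I.tokensOf (bruteForce I S).val,
      (foundBelow I q i k p (I.bucket (bruteForce I S).val j) j)ᶜ := by
  rintro ω ⟨hout, hcost⟩
  refine Set.mem_iInter₂.2 fun j hj ⟨hopen, hfound⟩ =>
    hfound ⟨fun hmem => hout ?_, treeCost_orderedPairs_eq_zero hcost hj hopen⟩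
  exact (mem_cpsJoin_out_succ hI _ _ _ _ _).2 (.inr ⟨j, hj, hopen, hmem⟩)

lemma measurableSet_foundBelow (hI : I.Regular) (q : ι × ι) (i k : ℕ) (p : List τ) (T : List ι)
    (j : τ) : MeasurableSet (foundBelow I q i k p T j) :=
  (measurableSet_seedHash_lt i p j _).inter (measurableSet_missed hI q i k _ T).compl

lemma seedMeasure_foundBelow (hI : I.Regular) (hsize : 1 ≤ I.lam * I.t) (q : ι × ι) (i k : ℕ)
    (p : List τ) (T : List ι) (j : τ) :
    (seedMeasure τ).real (foundBelow I q i k p T j) =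
      1 / (I.lam * I.t) * (1 - (seedMeasure τ).real (missed I q i k (p ++ [j]) T)) := by
  have hc : 1 / (I.lam * I.t) ∈ Set.Icc (0 : ℝ) 1 :=
    ⟨by positivity, (div_le_one (by positivity)).2 hsize⟩
  have hmeas := measurableSet_missed hI q i k (p ++ [j]) T
  rw [← probReal_compl_eq_one_sub hmeas, foundBelow, Measure.real, seedMeasure,
    measure_inter_of_dependsOn (disjoint_singleton_subtreeSeeds i p j j)
      (measurableSet_seedHash_lt i p j _) hmeas.compl (dependsOn_seedHash_lt i p j _)
      fun _ _ h => congrArg Not (dependsOn_missed hI q i k (p ++ [j]) T h),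
    ← seedMeasure, ENNReal.toReal_mul, seedMeasure_seedHash_lt i p j hc,
    ENNReal.toReal_ofReal hc.1, Measure.real]

lemma seedMeasure_biInter_compl_foundBelow (hI : I.Regular) (hsize : 1 ≤ I.lam * I.t) (q : ι × ι)
    (i k : ℕ) (p : List τ) (T : τ → List ι) (J : Finset τ) :
    (seedMeasure τ).real (⋂ j ∈ J, (foundBelow I q i k p (T j) j)ᶜ) =
      ∏ j ∈ J, (1 - 1 / (I.lam * I.t) *
        (1 - (seedMeasure τ).real (missed I q i k (p ++ [j]) (T j)))) := by
  have hindep : seedMeasure τ (⋂ j ∈ J, (foundBelow I q i k p (T j) j)ᶜ) =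
      ∏ j ∈ J, seedMeasure τ (foundBelow I q i k p (T j) j)ᶜ := by
    refine measure_biInter_of_dependsOn J
      (B := fun j => {(i, p, j)} ∪ subtreeSeeds i (p ++ [j])) (fun j _ j' _ hne => ?_)
      (fun j _ => (measurableSet_foundBelow hI q i k p (T j) j).compl) fun j _ ω ω' h => ?_
    · simp only [Function.onFun, Set.disjoint_union_left, Set.disjoint_union_right]
      exact ⟨⟨by simpa using hne, (disjoint_singleton_subtreeSeeds i p j' j).symm⟩,
        disjoint_singleton_subtreeSeeds i p j j', disjoint_subtreeSeeds i p hne⟩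
    · exact congrArg₂ (fun A B : Prop => ¬ (A ∧ ¬ B))
        (dependsOn_seedHash_lt i p j _ fun s hs => h s (.inl hs))
        (dependsOn_missed hI q i k (p ++ [j]) (T j) fun s hs => h s (.inr hs))
  rw [Measure.real, hindep, ENNReal.toReal_prod]
  refine Finset.prod_congr rfl fun j _ => ?_
  rw [← seedMeasure_foundBelow hI hsize,
    ← probReal_compl_eq_one_sub (measurableSet_foundBelow hI q i k p (T j) j), Measure.real]

/-- The recursion for the extinction probability of a branching process in which every record pair
has at least `β λ t` potential children, each present with probability `1 / (λ t)`. -/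
lemma seedMeasure_missed_succ_le (hI : I.Regular) (hsize : 1 ≤ I.lam * I.t) {q : ι × ι} {i k : ℕ}
    {p : List τ} {S : List ι} {J : Finset τ} (hJ : J ⊆ I.tokensOf (bruteForce I S).val)
    {β g : ℝ} (hβ : β * (I.lam * I.t) ≤ J.card) (hg : g ∈ Set.Icc (0 : ℝ) 1)
    (hchild : ∀ j ∈ J, (seedMeasure τ).real
      (missed I q i k (p ++ [j]) (I.bucket (bruteForce I S).val j)) ≤ 1 - g) :
    (seedMeasure τ).real (missed I q i (k + 1) p S) ≤ Real.exp (-(β * g)) := by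
  have hpos : 0 < I.lam * I.t := zero_lt_one.trans_le hsize
  have hc1 : 1 / (I.lam * I.t) ≤ 1 := (div_le_one hpos).2 hsize
  calc (seedMeasure τ).real (missed I q i (k + 1) p S)
      ≤ (seedMeasure τ).real
          (⋂ j ∈ J, (foundBelow I q i k p (I.bucket (bruteForce I S).val j) j)ᶜ) :=
        measureReal_mono ((missed_succ_subset hI q i k p S).trans
          (Set.biInter_subset_biInter_left hJ))
    _ = ∏ j ∈ J, (1 - 1 / (I.lam * I.t) * (1 - (seedMeasure τ).real
          (missed I q i k (p ++ [j]) (I.bucket (bruteForce I S).val j)))) :=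
        seedMeasure_biInter_compl_foundBelow hI hsize q i k p _ J
    _ ≤ ∏ _j ∈ J, Real.exp (-(1 / (I.lam * I.t) * g)) := by
        refine Finset.prod_le_prod (fun j _ => ?_) fun j hj => ?_
        · exact sub_nonneg.2 (mul_le_one₀ hc1 (sub_nonneg.2 measureReal_le_one)
            (sub_le_self _ measureReal_nonneg))
        · refine le_trans ?_ (Real.one_sub_le_exp_neg _)
          gcongr
          linarith [hchild j hj]
    _ ≤ Real.exp (-(β * g)) := by
        rw [Finset.prod_const, ← Real.exp_nat_mul, Real.exp_le_exp, mul_neg, neg_le_neg_iff,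
          ← mul_assoc, mul_one_div]
        exact mul_le_mul_of_nonneg_right ((le_div_iff₀ hpos).2 hβ) hg.1

lemma pow_div_succ_mem_Icc {β : ℝ} (hβ : β ∈ Set.Ioc (0 : ℝ) 1) (k : ℕ) :
    β ^ k / (k + 1) ∈ Set.Icc (0 : ℝ) 1 := by
  have := hβ.1
  refine ⟨by positivity, (div_le_one (by positivity)).2 ?_⟩
  linarith [pow_le_one₀ hβ.1.le hβ.2 (n := k), Nat.cast_nonneg (α := ℝ) k]

lemma exp_neg_mul_pow_div_succ_le {β : ℝ} (hβ : β ∈ Set.Ioc (0 : ℝ) 1) (k : ℕ) :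
    Real.exp (-(β * (β ^ k / (k + 1)))) ≤ 1 - β ^ (k + 1) / ((k + 1 : ℕ) + 1) := by
  have hpos : 0 < β ^ (k + 1) := pow_pos hβ.1 _
  have hle : β ^ (k + 1) ≤ 1 := pow_le_one₀ hβ.1.le hβ.2
  rw [show β * (β ^ k / (k + 1)) = β ^ (k + 1) / (k + 1) by ring, Real.exp_neg]
  calc (Real.exp (β ^ (k + 1) / (k + 1)))⁻¹ ≤ (β ^ (k + 1) / (k + 1) + 1)⁻¹ := by
        gcongr
        exact Real.add_one_le_exp _
    _ = 1 - β ^ (k + 1) / (k + 1 + β ^ (k + 1)) := by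
        field_simp
        ring
    _ ≤ 1 - β ^ (k + 1) / ((k + 1 : ℕ) + 1) := by
        push_cast
        gcongr

/-- The calls that contain both records form a nearly critical branching process. -/
theorem seedMeasure_missed_le (hI : I.Regular) (hlimit : 1 ≤ I.limit) (hsize : 1 ≤ I.lam * I.t)
    {x y : ι} (hxy : I.lam ≤ I.sim x y) (hyx : I.lam ≤ I.sim y x) {β : ℝ}
    (hβ : β ∈ Set.Ioc (0 : ℝ) 1) (hoverlap : β * (I.lam * I.t) ≤ I.overlap x y) (i k : ℕ)
    (p : List τ) {S : List ι} (hS : S.Nodup) (hx : x ∈ S) (hy : y ∈ S) :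
    (seedMeasure τ).real (missed I (x, y) i k p S) ≤ 1 - β ^ k / (k + 1) := by
  induction k generalizing p S with
  | zero =>
    suffices missed I (x, y) i 0 p S = ∅ by simp [this]
    refine Set.eq_empty_of_forall_notMem fun ω hω => ?_
    have hlen : S.length ≤ 1 := by
      have hcost := hω.2
      simp only [treeCost, orderedPairs, mul_eq_zero] at hcost
      omega
    have hq := ((bruteForceRun hI hS).mem_out_or_mem_val hx hy hxy hyx).resolve_right fun h => by
      simpa [bruteForce_val_eq_nil hI hS (hlen.trans hlimit)] using h.1
    exact (missed_eq_empty_of_mem_out hI hq i 0 p).le hω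
  | succ k ih =>
    rcases (bruteForceRun hI hS).mem_out_or_mem_val hx hy hxy hyx with hq | ⟨hx', hy'⟩
    · rw [missed_eq_empty_of_mem_out hI hq, measureReal_empty, sub_nonneg]
      exact (pow_div_succ_mem_Icc hβ (k + 1)).2
    · refine (seedMeasure_missed_succ_le hI hsize (J := I.tokens x ∩ I.tokens y) (fun j hj => ?_)
        hoverlap (pow_div_succ_mem_Icc hβ k) fun j hj => ?_).trans
          (exp_neg_mul_pow_div_succ_le hβ k)
      · exact Input.mem_tokensOf.2 ⟨x, hx', Input.mem_tokens.1 (Finset.mem_inter.1 hj).1⟩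
      · obtain ⟨hjx, hjy⟩ := Finset.mem_inter.1 hj
        exact ih _ (Input.nodup_bucket (hI.nodup_bruteForce hS) j)
          (Input.mem_bucket.2 ⟨hx', Input.mem_tokens.1 hjx⟩)
          (Input.mem_bucket.2 ⟨hy', Input.mem_tokens.1 hjy⟩)

lemma seedMeasure_not_reported_once_le (hI : I.Regular) (hlimit : 1 ≤ I.limit)
    (hsize : 1 ≤ I.lam * I.t) {x y : ι} (hxy : I.lam ≤ I.sim x y) (hyx : I.lam ≤ I.sim y x)
    {β : ℝ} (hβ : β ∈ Set.Ioc (0 : ℝ) 1) (hoverlap : β * (I.lam * I.t) ≤ I.overlap x y) (i K : ℕ)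
    {S : List ι} (hS : S.Nodup) (hx : x ∈ S) (hy : y ∈ S) :
    (seedMeasure τ).real {ω | (x, y) ∉ (cpsJoin I (seedHash i ω) (K + 1) [] S).out} ≤
      1 - β ^ K / (K + 1) + max (1 - I.eps) 0 ^ K * orderedPairs S := by
  have hsub : {ω | (x, y) ∉ (cpsJoin I (seedHash i ω) (K + 1) [] S).out} ⊆
      missed I (x, y) i K [] S ∪
        {ω | treeCost I (fun _ => 0) orderedPairs (seedHash i ω) K [] S ≠ 0} := fun ω hω =>
    (em (treeCost I (fun _ => 0) orderedPairs (seedHash i ω) K [] S = 0)).imp (⟨hω, ·⟩) id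
  refine (measureReal_mono hsub).trans ((measureReal_union_le _ _).trans (add_le_add
    (seedMeasure_missed_le hI hlimit hsize hxy hyx hβ hoverlap i K [] hS hx hy) ?_))
  exact ENNReal.toReal_le_of_le_ofReal (by positivity)
    (seedMeasure_treeCost_ne_zero_le hI hlimit hsize i K hS)

theorem seedMeasure_not_reported_le (hI : I.Regular) (hlimit : 1 ≤ I.limit)
    (hsize : 1 ≤ I.lam * I.t) {x y : ι} (hxy : I.lam ≤ I.sim x y) (hyx : I.lam ≤ I.sim y x)
    {β : ℝ} (hβ : β ∈ Set.Ioc (0 : ℝ) 1) (hoverlap : β * (I.lam * I.t) ≤ I.overlap x y) (R K : ℕ)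
    {S : List ι} (hS : S.Nodup) (hx : x ∈ S) (hy : y ∈ S) :
    (seedMeasure τ).real {ω | ∀ i < R, (x, y) ∉ (cpsJoin I (seedHash i ω) (K + 1) [] S).out} ≤
      (1 - β ^ K / (K + 1) + max (1 - I.eps) 0 ^ K * orderedPairs S) ^ R := by
  have hinter : {ω : Seeds τ | ∀ i < R, (x, y) ∉ (cpsJoin I (seedHash i ω) (K + 1) [] S).out} =
      ⋂ i ∈ Finset.range R, {ω | (x, y) ∉ (cpsJoin I (seedHash i ω) (K + 1) [] S).out} := by
    ext ω
    simp
  have hindep : seedMeasure τ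
      (⋂ i ∈ Finset.range R, {ω | (x, y) ∉ (cpsJoin I (seedHash i ω) (K + 1) [] S).out}) =
      ∏ i ∈ Finset.range R,
        seedMeasure τ {ω | (x, y) ∉ (cpsJoin I (seedHash i ω) (K + 1) [] S).out} := by
    refine measure_biInter_of_dependsOn _ (B := fun i => subtreeSeeds i []) (fun i _ j _ hne => ?_)
      (fun i _ => (measurableSet_mem_cpsJoin_out hI (x, y) i (K + 1) [] S).compl)
      fun i _ ω ω' h => congrArg Not (dependsOn_mem_cpsJoin_out hI (x, y) i (K + 1) [] S h)
    exact Set.disjoint_left.2 fun s hi hj => hne (hi.1.symm.trans hj.1)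
  rw [hinter, Measure.real, hindep, ENNReal.toReal_prod]
  calc _ ≤ ∏ _i ∈ Finset.range R,
        (1 - β ^ K / (K + 1) + max (1 - I.eps) 0 ^ K * orderedPairs S) :=
        Finset.prod_le_prod (fun _ _ => ENNReal.toReal_nonneg) fun i _ =>
          seedMeasure_not_reported_once_le hI hlimit hsize hxy hyx hβ hoverlap i K hS hx hy
    _ = _ := by rw [Finset.prod_const, Finset.card_range]

end Recall

/-! ### The embedding -/

section Hits

variable {H : Type*} {t : ℕ}

/-- The number of the `t` samples in `g` that fall into `A`. -/
def hits (A : Set H) (g : Fin t → H) : ℕ := (Finset.univ.filter fun i => g i ∈ A).card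

lemma hits_eq_sum (A : Set H) :
    (fun g : Fin t → H => (hits A g : ℝ)) =
      ∑ i, fun g : Fin t → H => A.indicator (1 : H → ℝ) (g i) := by
  ext g
  simp [hits, Set.indicator_apply]

lemma choose_hits (A : Set H) (k : ℕ) (g : Fin t → H) :
    ((hits A g).choose k : ℝ≥0∞) = ∑ T ∈ Finset.powersetCard k (Finset.univ : Finset (Fin t)),
      {g : Fin t → H | ∀ i ∈ T, g i ∈ A}.indicator 1 g := by
  rw [hits, ← Finset.card_powersetCard]
  simp only [Set.indicator, Set.mem_ofPred_eq, Pi.one_apply]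
  rw [Finset.sum_boole]
  congr 2
  ext T
  simp only [Finset.mem_powersetCard, Finset.mem_filter, Finset.subset_iff, Finset.mem_univ,
    true_and, implies_true]
  tauto

lemma setOf_forall_mem_eq_pi (A : Set H) (T : Finset (Fin t)) :
    {g : Fin t → H | ∀ i ∈ T, g i ∈ A} =
      Set.pi Set.univ fun i => if i ∈ T then A else Set.univ := by
  ext g
  simp only [Set.mem_ofPred_eq, Set.mem_pi, Set.mem_univ, true_implies]
  refine forall_congr' fun i => ?_
  split_ifs with hi <;> simp [hi]

variable [MeasurableSpace H] {A : Set H}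

lemma measurableSet_forall_mem (hA : MeasurableSet A) (T : Finset (Fin t)) :
    MeasurableSet {g : Fin t → H | ∀ i ∈ T, g i ∈ A} := by
  rw [setOf_forall_mem_eq_pi]
  exact MeasurableSet.univ_pi fun i => by split_ifs <;> simp [hA]

lemma measurable_choose_hits (hA : MeasurableSet A) (k : ℕ) :
    Measurable fun g : Fin t → H => ((hits A g).choose k : ℝ≥0∞) := by
  simp only [choose_hits]
  exact Finset.measurable_sum _ fun T _ => measurable_one.indicator (measurableSet_forall_mem hA T)

variable (ν : Measure H) [IsProbabilityMeasure ν]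

lemma measure_pi_forall_mem (A : Set H) (T : Finset (Fin t)) :
    Measure.pi (fun _ : Fin t => ν) {g | ∀ i ∈ T, g i ∈ A} = ν A ^ T.card := by
  rw [setOf_forall_mem_eq_pi, Measure.pi_pi]
  simp only [apply_ite ν, measure_univ]
  rw [Finset.prod_ite_mem, Finset.univ_inter, Finset.prod_const]

/-- Factorial moments of the binomial distribution. -/
lemma lintegral_choose_hits (hA : MeasurableSet A) (k : ℕ) :
    ∫⁻ g : Fin t → H, ((hits A g).choose k : ℝ≥0∞) ∂(Measure.pi fun _ => ν) =
      (t.choose k : ℝ≥0∞) * ν A ^ k := by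
  simp only [choose_hits]
  rw [lintegral_finsetSum _ fun T _ => measurable_one.indicator (measurableSet_forall_mem hA T),
    Finset.sum_congr rfl (g := fun _ => ν A ^ k), Finset.sum_const, Finset.card_powersetCard,
    Finset.card_fin, nsmul_eq_mul]
  intro T hT
  rw [lintegral_indicator_one (measurableSet_forall_mem hA T), measure_pi_forall_mem,
    (Finset.mem_powersetCard.1 hT).2]

lemma memLp_indicator_one (hA : MeasurableSet A) :
    MemLp (A.indicator (1 : H → ℝ)) 2 ν :=
  memLp_indicator_const 2 hA 1 (Or.inr (measure_ne_top ν A))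

lemma memLp_hits (hA : MeasurableSet A) :
    MemLp (fun g : Fin t → H => (hits A g : ℝ)) 2 (Measure.pi fun _ => ν) := by
  rw [hits_eq_sum]
  exact memLp_finsetSum' _ fun i _ =>
    (memLp_indicator_one ν hA).comp_measurePreserving (measurePreserving_eval _ i)

lemma integral_hits (hA : MeasurableSet A) :
    ∫ g : Fin t → H, (hits A g : ℝ) ∂(Measure.pi fun _ => ν) = t * ν.real A := by
  have hint := (memLp_indicator_one ν hA).integrable one_le_two
  have heval (i : Fin t) : ∫ g : Fin t → H, A.indicator (1 : H → ℝ) (g i)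
      ∂(Measure.pi fun _ => ν) = ν.real A :=
    (integral_comp_eval (μ := fun _ => ν) hint.aestronglyMeasurable).trans
      (integral_indicator_one hA)
  calc ∫ g : Fin t → H, (hits A g : ℝ) ∂(Measure.pi fun _ => ν)
      = ∫ g : Fin t → H, ∑ i, A.indicator (1 : H → ℝ) (g i) ∂(Measure.pi fun _ => ν) := by
        simp only [hits_eq_sum, Finset.sum_fn]
    _ = t * ν.real A := by
        rw [integral_finsetSum _ fun i _ => integrable_comp_eval (μ := fun _ => ν) hint]
        simp [heval]

lemma variance_hits_le (hA : MeasurableSet A) :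
    ProbabilityTheory.variance (fun g : Fin t → H => (hits A g : ℝ)) (Measure.pi fun _ => ν) ≤
      t := by
  rw [hits_eq_sum, ProbabilityTheory.variance_sum_pi fun _ => memLp_indicator_one ν hA]
  refine (Finset.sum_le_card_nsmul _ _ 1 fun i _ => ?_).trans_eq (by simp)
  refine (ProbabilityTheory.variance_le_sq_of_bounded (a := 0) (b := 1)
    (Filter.Eventually.of_forall fun h => ?_)
    (measurable_one.indicator hA).aemeasurable).trans (by norm_num)
  by_cases hh : h ∈ A <;> simp [hh]

lemma measure_hits_le (hA : MeasurableSet A) {δ : ℝ} (hδ : 0 < δ) :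
    (Measure.pi fun _ : Fin t => ν).real {g | (hits A g : ℝ) ≤ t * ν.real A - δ} ≤ t / δ ^ 2 := by
  have hchebyshev := ProbabilityTheory.meas_ge_le_variance_div_sq (memLp_hits (t := t) ν hA) hδ
  rw [integral_hits ν hA] at hchebyshev
  refine ENNReal.toReal_le_of_le_ofReal (by positivity) ((measure_mono fun g hg => ?_).trans
    (hchebyshev.trans (ENNReal.ofReal_le_ofReal (by gcongr; exact variance_hits_le ν hA))))
  have hdev : (hits A g : ℝ) ≤ t * ν.real A - δ := hg
  change δ ≤ |(hits A g : ℝ) - t * ν.real A|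
  exact le_abs.2 (Or.inr (by linarith))

lemma pairWeight_zero_eq (L : ℝ) (k m : ℕ) :
    pairWeight L k 0 m =
      (m.choose k : ℝ) * (k.factorial / ∏ j ∈ Finset.range k, (L - j)) := by
  rw [pairWeight, ← Finset.range_eq_Ico, Finset.prod_div_distrib, ← Nat.cast_prod,
    ← Nat.descFactorial_eq_prod_range, Nat.descFactorial_eq_factorial_mul_choose]
  push_cast
  ring

lemma pairWeight_zero_le {L : ℝ} {k : ℕ} (hk : (k : ℝ) < L) (m : ℕ) :
    pairWeight L k 0 m ≤ (m / (L - k)) ^ k := by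
  rw [pairWeight, ← Finset.range_eq_Ico]
  have hlt : ∀ j ∈ Finset.range k, (j : ℝ) < k := fun j hj => by
    exact_mod_cast Finset.mem_range.1 hj
  refine (Finset.prod_le_prod (fun j hj => div_nonneg (Nat.cast_nonneg _)
    (by linarith [hlt j hj])) fun j hj => ?_).trans_eq
      ((Finset.prod_const _).trans (by rw [Finset.card_range]))
  exact div_le_div₀ (Nat.cast_nonneg _) (by exact_mod_cast Nat.sub_le m j) (by linarith)
    (by linarith [hlt j hj])

lemma measurable_pairWeight_hits (hA : MeasurableSet A) (L : ℝ) (k : ℕ) :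
    Measurable fun g : Fin t → H => pairWeight L k 0 (hits A g) := by
  simp only [pairWeight_zero_eq]
  have hchoose := (measurable_choose_hits (t := t) hA k).ennreal_toReal
  simp only [ENNReal.toReal_natCast] at hchoose
  exact hchoose.mul_const _

lemma lintegral_pairWeight_hits (hA : MeasurableSet A) {L : ℝ} {k : ℕ} (hk : (k : ℝ) < L) :
    ∫⁻ g : Fin t → H, ENNReal.ofReal (pairWeight L k 0 (hits A g)) ∂(Measure.pi fun _ => ν) =
      ENNReal.ofReal (pairWeight L k 0 t * ν.real A ^ k) := by
  have hmul (m : ℕ) : ENNReal.ofReal (pairWeight L k 0 m) = (m.choose k : ℝ≥0∞) *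
      ENNReal.ofReal (k.factorial / ∏ j ∈ Finset.range k, (L - j)) := by
    rw [pairWeight_zero_eq, ENNReal.ofReal_mul (by positivity), ENNReal.ofReal_natCast]
  simp only [hmul]
  rw [lintegral_mul_const _ (measurable_choose_hits hA k), lintegral_choose_hits ν hA,
    ENNReal.ofReal_mul (pairWeight_nonneg hk _ _), hmul, ENNReal.ofReal_pow measureReal_nonneg,
    ofReal_measureReal, mul_right_comm]

lemma lintegral_pairWeight_hits_le (hA : MeasurableSet A) {L : ℝ} {k : ℕ} (hk : (k : ℝ) < L) :
    ∫⁻ g : Fin t → H, ENNReal.ofReal (pairWeight L k 0 (hits A g)) ∂(Measure.pi fun _ => ν) ≤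
      ENNReal.ofReal ((t / (L - k)) ^ k * ν.real A ^ k) := by
  rw [lintegral_pairWeight_hits ν hA hk]
  gcongr
  exact pairWeight_zero_le hk t

end Hits

section Embedding

variable {X H β : Type*} {hash : H → X → β} {sim : X → X → ℝ} {lam : ℝ} {limit : ℕ} {n t : ℕ}
  {pts : Fin n → X}

lemma embeddedInput_regular (g : Fin t → H) :
    (embeddedInput hash sim lam limit pts g).Regular :=
  ⟨fun x => by simp [embeddedInput], fun _ =>
    List.Nodup.map (fun _ _ h => (Prod.ext_iff.1 h).1) (List.nodup_finRange t)⟩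

lemma embeddedInput_overlap (g : Fin t → H) (x y : Fin n) :
    (embeddedInput hash sim lam limit pts g).overlap x y =
      hits {h | hash h (pts x) = hash h (pts y)} g := by
  rw [Input.overlap, hits, ← Finset.card_map
    ⟨fun i => (i, hash (g i) (pts x)), fun i j h => (Prod.ext_iff.1 h).1⟩]
  congr 1
  ext ⟨i, b⟩
  simp only [Finset.mem_inter, Input.mem_tokens, embeddedInput, List.mem_map, List.mem_finRange,
    true_and, Prod.mk.injEq, exists_eq_left, Finset.mem_map, Finset.mem_filter, Finset.mem_univ,
    Set.mem_ofPred_eq]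
  constructor
  · rintro ⟨hx, hy⟩
    exact ⟨i, hx.trans hy.symm, Prod.ext rfl hx⟩
  · rintro ⟨j, hxy, hj⟩
    obtain ⟨rfl, hx⟩ := Prod.mk.inj hj
    exact ⟨hx, hxy.symm.trans hx⟩

end Embedding

section SimJoin

variable {X H β : Type*} {hash : H → X → β} {sim : X → X → ℝ} {lam : ℝ} {limit : ℕ} {n t : ℕ}
  {pts : Fin n → X}

lemma IsLSHFamily.symm [MeasurableSpace H] {ν : Measure H} (h : IsLSHFamily ν hash sim) (x y : X) :
    sim x y = sim y x := by
  rw [← (h x y).2, ← (h y x).2]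
  simp only [eq_comm]

lemma IsLSHFamily.self [MeasurableSpace H] {ν : Measure H} [IsProbabilityMeasure ν]
    (h : IsLSHFamily ν hash sim) (x : X) : sim x x = 1 := by
  rw [← (h x x).2]
  simp

lemma mem_totalOut_simJoin {R : ℕ} {g : Fin t → H} {ω : Seeds (Fin t × β)} {q : Fin n × Fin n} :
    q ∈ totalOut (simJoin hash sim lam limit R pts g ω) ↔ ∃ k, ∃ i < R,
      q ∈ (cpsJoin (embeddedInput hash sim lam limit pts g) (seedHash i ω) k []
        (List.finRange n)).out := by
  simp only [totalOut, Set.mem_iUnion, simJoin, hold_out, bind_out, ticks_out, Set.empty_union,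
    mem_forEach_out, List.mem_range]
  rfl

lemma totalOut_subset_joinSet [MeasurableSpace H] {ν : Measure H} [IsProbabilityMeasure ν]
    (h : IsLSHFamily ν hash sim) (hlam : lam ≤ 1) (R : ℕ) (g : Fin t → H)
    (ω : Seeds (Fin t × β)) :
    totalOut (simJoin hash sim lam limit R pts g ω) ⊆ joinSet sim lam pts := by
  intro q hq
  obtain ⟨k, i, -, hq⟩ := mem_totalOut_simJoin.1 hq
  rcases reportable_of_mem_cpsJoin_out (embeddedInput_regular g) _ _ _ (List.nodup_finRange n) hq
    with hdiag | hsim | hsim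
  · exact hlam.trans_eq (by rw [hdiag, h.self])
  · exact hsim
  · exact hsim.trans_eq (h.symm _ _)

lemma simJoin_cmps (R : ℕ) (g : Fin t → H) (ω : Seeds (Fin t × β)) (k : ℕ) :
    (simJoin hash sim lam limit R pts g ω k).cmps = ∑ i ∈ Finset.range R,
      treeCost (embeddedInput hash sim lam limit pts g)
        (callCmps (embeddedInput hash sim lam limit pts g)) (fun _ => 0) (seedHash i ω) k []
        (List.finRange n) := by
  simp only [simJoin, hold_cmps, bind_cmps, ticks_cmps, zero_add, forEach_cmps,
    cpsJoin_cmps (embeddedInput_regular g)]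
  rw [← List.sum_toFinset _ List.nodup_range, List.toFinset_range]
  rfl

lemma simJoin_time_le (hn : 1 ≤ n) (R : ℕ) (g : Fin t → H) (ω : Seeds (Fin t × β)) (k : ℕ) :
    (simJoin hash sim lam limit R pts g ω k).time ≤ (n * t + R) +
      (5 * t + 9) * ∑ i ∈ Finset.range R,
      treeCost (embeddedInput hash sim lam limit pts g)
        (callWork (embeddedInput hash sim lam limit pts g)) (fun _ => 0) (seedHash i ω) k []
        (List.finRange n) := by
  simp only [simJoin, hold_time, bind_time, ticks_time, forEach_time]
  rw [← List.sum_toFinset _ List.nodup_range, List.toFinset_range, Finset.sum_add_distrib,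
    Finset.sum_const, Finset.card_range, smul_eq_mul, mul_one, Finset.mul_sum, add_assoc]
  gcongr with i
  exact cpsJoin_time_le (embeddedInput_regular g) (seedHash i ω) k [] (List.nodup_finRange n)
    (List.ne_nil_of_length_pos (by rw [List.length_finRange]; exact hn))

lemma simJoin_space_le (hlimit : 1 ≤ limit) (R : ℕ) (g : Fin t → H) (ω : Seeds (Fin t × β))
    (K k : ℕ)
    (h : ∀ i < R, treeCost (embeddedInput hash sim lam limit pts g) (fun _ => 0) orderedPairs
      (seedHash i ω) K [] (List.finRange n) = 0) :
    (simJoin hash sim lam limit R pts g ω k).space ≤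
      n * t + (K + 1) * (n + 1 + 4 * (n * t)) := by
  simp only [simJoin, hold_space, bind_space, ticks_space]
  gcongr
  refine max_le (Nat.zero_le _) (forEach_space_le fun i hi => ?_)
  simp only [bind_space, ticks_space, Nat.zero_max]
  exact cpsJoin_space_le (embeddedInput_regular g) hlimit (seedHash i ω) K k []
    (List.nodup_finRange n) (by simp) (h i (List.mem_range.1 hi))

end SimJoin

lemma lintegral_iSup_treeCost_le {ι τ : Type*} {I : Input ι τ} {node : List ι → ℕ} {S : List ι}
    {b : ℝ≥0∞} (hb : ∀ i k, ∫⁻ ω, (treeCost I node (fun _ => 0) (seedHash i ω) k [] S : ℝ≥0∞)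
      ∂(seedMeasure τ) ≤ b) (R c A : ℕ) :
    ∫⁻ ω, ⨆ k, ((c + A * ∑ i ∈ Finset.range R,
      treeCost I node (fun _ => 0) (seedHash i ω) k [] S : ℕ) : ℝ≥0∞) ∂(seedMeasure τ) ≤
      c + A * (R * b) := by
  have hmeas (i k : ℕ) : Measurable fun ω : Seeds τ =>
      (treeCost I node (fun _ => 0) (seedHash i ω) k [] S : ℝ≥0∞) :=
    (measurable_of_countable _).comp (measurable_treeCost _ _ _ _ _ _)
  have hmeas_sum (k : ℕ) : Measurable fun ω : Seeds τ => ∑ i ∈ Finset.range R,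
      (treeCost I node (fun _ => 0) (seedHash i ω) k [] S : ℝ≥0∞) :=
    Finset.measurable_sum _ fun i _ => hmeas i k
  have hmeas_affine (k : ℕ) : Measurable fun ω : Seeds τ => (c : ℝ≥0∞) + A *
      ∑ i ∈ Finset.range R, (treeCost I node (fun _ => 0) (seedHash i ω) k [] S : ℝ≥0∞) :=
    measurable_const.add ((hmeas_sum k).const_mul _)
  push_cast
  rw [lintegral_iSup hmeas_affine]
  · refine iSup_le fun k => ?_
    rw [lintegral_add_left measurable_const, lintegral_const_mul _ (hmeas_sum k),
      lintegral_finsetSum _ fun i _ => hmeas i k, lintegral_const, measure_univ, mul_one]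
    gcongr
    refine (Finset.sum_le_card_nsmul _ _ b fun i _ => hb i k).trans_eq ?_
    rw [Finset.card_range, nsmul_eq_mul]
  · refine monotone_nat_of_le_succ fun k ω => ?_
    gcongr
    exact treeCost_le_succ _ _ _ _ _

/-! ### Expected cost -/

section StopCost

variable {X : Type*} {sim : X → X → ℝ} {lam : ℝ} {limit n t : ℕ} {pts : Fin n → X}

/-- The cost of the stopping depth `k` for the point `x`, a summand of `individualCost`. -/
def stopCost (sim : X → X → ℝ) (lam : ℝ) (pts : Fin n → X) (x : Fin n) (k : ℕ) : ℝ :=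
  ∑ y ∈ Finset.univ.erase x, (sim (pts x) (pts y) / lam) ^ k + (1 / lam) ^ k

lemma individualCost_eq : individualCost sim lam pts = ∑ x, ⨅ k, stopCost sim lam pts x k := rfl

lemma one_le_one_div_pow (hlam : lam ∈ Set.Ioo (0 : ℝ) 1) (k : ℕ) : 1 ≤ (1 / lam) ^ k :=
  one_le_pow₀ (one_le_one_div hlam.1 hlam.2.le)

lemma log_one_div_pos (hlam : lam ∈ Set.Ioo (0 : ℝ) 1) : 0 < Real.log (1 / lam) :=
  Real.log_pos (one_lt_one_div hlam.1 hlam.2)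

lemma one_div_pow_le_stopCost (hlam : 0 < lam) (hsim : ∀ x y, 0 ≤ sim x y) (x : Fin n) (k : ℕ) :
    (1 / lam) ^ k ≤ stopCost sim lam pts x k :=
  le_add_of_nonneg_left <|
    Finset.sum_nonneg fun _ _ => pow_nonneg (div_nonneg (hsim _ _) hlam.le) _

lemma one_le_iInf_stopCost (hlam : lam ∈ Set.Ioo (0 : ℝ) 1) (hsim : ∀ x y, 0 ≤ sim x y)
    (x : Fin n) : 1 ≤ ⨅ k, stopCost sim lam pts x k :=
  le_ciInf fun k => (one_le_one_div_pow hlam k).trans (one_div_pow_le_stopCost hlam.1 hsim x k)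

lemma le_individualCost (hlam : lam ∈ Set.Ioo (0 : ℝ) 1) (hsim : ∀ x y, 0 ≤ sim x y) :
    (n : ℝ) ≤ individualCost sim lam pts := by
  rw [individualCost_eq]
  have := Finset.card_nsmul_le_sum Finset.univ (fun x => ⨅ k, stopCost sim lam pts x k) 1
    fun x _ => one_le_iInf_stopCost hlam hsim x
  simpa using this

lemma stopCost_zero (x : Fin n) : stopCost sim lam pts x 0 = n := by
  simp [stopCost, Finset.card_erase_of_mem, Nat.cast_pred x.pos]

lemma le_mul_stopCost_of_not (hlam : lam ∈ Set.Ioo (0 : ℝ) 1) (hsim : ∀ x y, 0 ≤ sim x y)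
    (x : Fin n) {k : ℕ}
    (h : ¬ (Real.log (1 / lam) / Real.log n ≤ 1 / 4 ∧ (1 / lam) ^ k < n)) :
    (n : ℝ) ≤ (1 / lam) ^ 4 * stopCost sim lam pts x k := by
  have hn : (1 : ℝ) ≤ n := by exact_mod_cast x.pos
  have hlam0 := hlam.1
  have hpow := one_le_one_div_pow hlam
  have hk := one_div_pow_le_stopCost (pts := pts) hlam.1 hsim x k
  rw [not_and_or, not_le, not_lt] at h
  rcases h with heps | hkn
  · have hlogn : Real.log n ≤ Real.log ((1 / lam) ^ 4) := by
      rcases (Real.log_nonneg hn).eq_or_lt with h0 | hpos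
      · rw [← h0]
        exact Real.log_nonneg (hpow 4)
      · rw [lt_div_iff₀ hpos] at heps
        rw [Real.log_pow]
        push_cast
        linarith
    have hn4 := (Real.log_le_log_iff (by linarith) (by positivity)).1 hlogn
    exact hn4.trans (le_mul_of_one_le_right (by positivity) ((hpow k).trans hk))
  · exact (hkn.trans hk).trans
      (le_mul_of_one_le_left (zero_le_one.trans ((hpow k).trans hk)) (hpow 4))

lemma one_le_of_size (hsize : 4 * (1 + Real.log n / Real.log (1 / lam)) ^ 2 ≤ lam * t)
    (hlam : lam ∈ Set.Ioo (0 : ℝ) 1) : 1 ≤ lam * t := by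
  have hquot : 0 ≤ Real.log n / Real.log (1 / lam) :=
    div_nonneg (Real.log_natCast_nonneg n) (log_one_div_pos hlam).le
  nlinarith

/-- Stopping depths beyond `log n / log (1 / λ)` are never needed: the price of such a depth is at
least `n`, the price of stopping at once. For `n < (1 / λ) ^ 4` stopping at once is good enough. -/
lemma exists_admissible_depth (hlam : lam ∈ Set.Ioo (0 : ℝ) 1) (hlimit : 1 ≤ limit)
    (hsim : ∀ x y, 0 ≤ sim x y)
    (hsize : 4 * (1 + Real.log n / Real.log (1 / lam)) ^ 2 ≤ lam * t) (x : Fin n) :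
    ∃ k : ℕ, Admissible lam t limit (Real.log (1 / lam) / Real.log n) k ∧
      stopCost sim lam pts x k ≤ 2 * (1 / lam) ^ 4 * ⨅ k, stopCost sim lam pts x k := by
  have hlog := log_one_div_pos hlam
  have hlam0 := hlam.1
  have hlogn := Real.log_natCast_nonneg n
  have heps : 0 ≤ Real.log (1 / lam) / Real.log n := by positivity
  have hinf := one_le_iInf_stopCost (pts := pts) hlam hsim x
  have h4 := one_le_one_div_pow hlam 4
  obtain ⟨k, hk⟩ : ∃ k, stopCost sim lam pts x k < 2 * ⨅ k, stopCost sim lam pts x k :=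
    exists_lt_of_ciInf_lt (by linarith)
  by_cases hdepth : Real.log (1 / lam) / Real.log n ≤ 1 / 4 ∧ (1 / lam) ^ k < n
  · have hklog : k * Real.log (1 / lam) ≤ Real.log n := by
      rw [← Real.log_pow]
      exact Real.log_le_log (by positivity) hdepth.2.le
    have hkquot : (k : ℝ) ≤ Real.log n / Real.log (1 / lam) := by rwa [le_div_iff₀ hlog]
    refine ⟨k, ⟨hlam, hlimit, heps, ?_, Or.inr ⟨hdepth.1, ?_⟩⟩, ?_⟩
    · nlinarith [Nat.cast_nonneg (α := ℝ) k]
    · rw [← mul_div_assoc]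
      exact div_le_one_of_le₀ hklog hlogn
    · nlinarith
  · refine ⟨0, ⟨hlam, hlimit, heps, ?_, Or.inl rfl⟩, ?_⟩
    · rw [Nat.cast_zero]
      linarith [one_le_of_size hsize hlam]
    · rw [stopCost_zero]
      have := le_mul_stopCost_of_not (pts := pts) hlam hsim x hdepth
      nlinarith

end StopCost

section Cost

variable {X H β : Type*} {hash : H → X → β} {sim : X → X → ℝ} {lam eps : ℝ} {limit n t : ℕ}
  {pts : Fin n → X} {k : Fin n → ℕ} {a : Fin n → ℕ → ℝ} {A c : ℝ}

lemma callPotential_root (g : Fin t → H) (k : Fin n → ℕ) (a : Fin n → ℕ → ℝ) (c : Fin n → ℝ) :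
    callPotential (embeddedInput hash sim lam limit pts g) k a c [] (List.finRange n) =
      ∑ x, (a x 0 + c x * ∑ y ∈ Finset.univ.erase x,
        pairWeight (lam * t) (k x) 0 (hits {h | hash h (pts x) = hash h (pts y)} g)) := by
  have hdistinct : distinct ([] : List (Fin t × β)) = 0 := by simp [distinct]
  simp only [callPotential, pointPotential, hdistinct, embeddedInput_overlap]
  refine Finset.sum_congr (by ext; simp) fun x _ => ?_
  congr 2
  exact Finset.sum_congr (by ext; simp) fun y _ => rfl

lemma ofReal_sum_add_mul_sum {κ : Type*} {s : Finset κ} {s' : κ → Finset κ} {a c : κ → ℝ}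
    {w : κ → κ → ℝ} (ha : ∀ x, 0 ≤ a x) (hc : ∀ x, 0 ≤ c x) (hw : ∀ x y, 0 ≤ w x y) :
    ENNReal.ofReal (∑ x ∈ s, (a x + c x * ∑ y ∈ s' x, w x y)) =
      ∑ x ∈ s, (ENNReal.ofReal (a x) +
        ENNReal.ofReal (c x) * ∑ y ∈ s' x, ENNReal.ofReal (w x y)) := by
  have hprod (x : κ) : 0 ≤ c x * ∑ y ∈ s' x, w x y :=
    mul_nonneg (hc x) (Finset.sum_nonneg fun y _ => hw x y)
  rw [ENNReal.ofReal_sum_of_nonneg fun x _ => add_nonneg (ha x) (hprod x)]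
  refine Finset.sum_congr rfl fun x _ => ?_
  rw [ENNReal.ofReal_add (ha x) (hprod x), ENNReal.ofReal_mul (hc x),
    ENNReal.ofReal_sum_of_nonneg fun y _ => hw x y]

lemma add_mul_sum_le_mul_stopCost (hlam : 0 < lam) (hsim : ∀ x y, 0 ≤ sim x y) {a : ℝ}
    (hA : 0 ≤ A) (hc : 0 ≤ c) {x : Fin n} {k : ℕ} (ha : a ≤ A * (1 / lam) ^ k) :
    a + c * ∑ y ∈ Finset.univ.erase x, 2 * (sim (pts x) (pts y) / lam) ^ k ≤
      (A + 2 * c) * stopCost sim lam pts x k := by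
  have hsum : 0 ≤ ∑ y ∈ Finset.univ.erase x, (sim (pts x) (pts y) / lam) ^ k :=
    Finset.sum_nonneg fun y _ => pow_nonneg (div_nonneg (hsim _ _) hlam.le) _
  rw [← Finset.mul_sum, stopCost]
  have hAsum := mul_nonneg hA hsum
  have hcpow : 0 ≤ c * (1 / lam) ^ k := by positivity
  linarith

variable [MeasurableSpace H] {ν : Measure H}

lemma IsLSHFamily.nonneg (h : IsLSHFamily ν hash sim) (x y : X) : 0 ≤ sim x y := by
  rw [← (h x y).2]
  exact measureReal_nonneg

variable [IsProbabilityMeasure ν]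

lemma lintegral_pairWeight_collisions_le (h : IsLSHFamily ν hash sim) {k : ℕ}
    (hadm : Admissible lam t limit eps k) (x y : X) :
    ∫⁻ g : Fin t → H, ENNReal.ofReal (pairWeight (lam * t) k 0
      (hits {h | hash h x = hash h y} g)) ∂(Measure.pi fun _ => ν) ≤
      ENNReal.ofReal (2 * (sim x y / lam) ^ k) := by
  refine (lintegral_pairWeight_hits_le ν (h x y).1 hadm.lt_size).trans
    (ENNReal.ofReal_le_ofReal ?_)
  rw [(h x y).2]
  have hpow : 0 ≤ sim x y ^ k := pow_nonneg (h.nonneg x y) k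
  calc branching lam t k ^ k * sim x y ^ k ≤ 2 * (1 / lam) ^ k * sim x y ^ k := by
        gcongr
        exact hadm.branching_pow_le
    _ = 2 * (sim x y / lam) ^ k := by rw [div_pow, div_pow, one_pow]; ring

lemma lintegral_callPotential_le (h : IsLSHFamily ν hash sim)
    (hadm : ∀ x, Admissible lam t limit eps (k x)) {c : Fin n → ℝ} (ha : ∀ x, 0 ≤ a x 0)
    (hc : ∀ x, 0 ≤ c x) :
    ∫⁻ g : Fin t → H, ENNReal.ofReal (callPotential (embeddedInput hash sim lam limit pts g)
      k a c [] (List.finRange n)) ∂(Measure.pi fun _ => ν) ≤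
      ENNReal.ofReal (∑ x, (a x 0 + c x * ∑ y ∈ Finset.univ.erase x,
        2 * (sim (pts x) (pts y) / lam) ^ k x)) := by
  have hmeas (x y : Fin n) : Measurable fun g : Fin t → H => ENNReal.ofReal
      (pairWeight (lam * t) (k x) 0 (hits {h | hash h (pts x) = hash h (pts y)} g)) :=
    (measurable_pairWeight_hits (h _ _).1 _ _).ennreal_ofReal
  have hmeas_sum (x : Fin n) : Measurable fun g : Fin t → H =>
      ∑ y ∈ Finset.univ.erase x, ENNReal.ofReal
        (pairWeight (lam * t) (k x) 0 (hits {h | hash h (pts x) = hash h (pts y)} g)) :=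
    Finset.measurable_sum _ fun y _ => hmeas x y
  have hbound_nonneg (x y : Fin n) : 0 ≤ 2 * (sim (pts x) (pts y) / lam) ^ k x :=
    mul_nonneg zero_le_two
      (pow_nonneg (div_nonneg (h.nonneg _ _) (hadm x).lam_mem.1.le) _)
  simp only [callPotential_root]
  rw [ofReal_sum_add_mul_sum ha hc hbound_nonneg]
  simp only [ofReal_sum_add_mul_sum ha hc
    fun x _ => pairWeight_nonneg (hadm x).lt_size 0 (hits _ _)]
  rw [lintegral_finsetSum _ fun x _ => show Measurable fun _ => _ + _ from
    measurable_const.add ((hmeas_sum x).const_mul _)]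
  refine Finset.sum_le_sum fun x _ => ?_
  rw [lintegral_add_left measurable_const, lintegral_const, measure_univ, mul_one,
    lintegral_const_mul _ (hmeas_sum x), lintegral_finsetSum _ fun y _ => hmeas x y]
  gcongr with y
  exact lintegral_pairWeight_collisions_le h (hadm x) (pts x) (pts y)

lemma lintegral_callPotential_le_individualCost (h : IsLSHFamily ν hash sim)
    (hadm : ∀ x, Admissible lam t limit eps (k x))
    (hopt : ∀ x, stopCost sim lam pts x (k x) ≤
      2 * (1 / lam) ^ 4 * ⨅ k, stopCost sim lam pts x k)
    (hA : 0 ≤ A) (hc : 0 ≤ c) (ha : ∀ x, 0 ≤ a x 0) (haA : ∀ x, a x 0 ≤ A * (1 / lam) ^ k x) :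
    ∫⁻ g : Fin t → H, ENNReal.ofReal (callPotential (embeddedInput hash sim lam limit pts g)
      k a (fun _ => c) [] (List.finRange n)) ∂(Measure.pi fun _ => ν) ≤
      ENNReal.ofReal ((A + 2 * c) * (2 * (1 / lam) ^ 4) * individualCost sim lam pts) := by
  refine (lintegral_callPotential_le h hadm ha fun _ => hc).trans (ENNReal.ofReal_le_ofReal ?_)
  rw [individualCost_eq, Finset.mul_sum]
  refine Finset.sum_le_sum fun x _ =>
    (add_mul_sum_le_mul_stopCost (hadm x).lam_mem.1 h.nonneg hA hc (haA x)).trans ?_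
  rw [mul_assoc (A + 2 * c)]
  gcongr
  exact hopt x

end Cost

section ExpectedCost

/-- The constant factor in the bound for the expected number of similarity computations: the
potential of `Admissible.isPotential_cmps`, averaged over the embedding, for almost optimal
admissible stopping depths. -/
def cmpsConstant (lam : ℝ) (limit : ℕ) : ℝ :=
  (2 * limit + 2 * Real.exp 4) * (2 * (1 / lam) ^ 4)

/-- The constant factor in the bound for the expected work, obtained from
`Admissible.isPotential_work` in the same way as `cmpsConstant`. -/
def timeConstant (lam : ℝ) (limit : ℕ) : ℝ :=
  (2 * limit / (1 - lam) + 2 * Real.exp 4 + 2 * (1 + limit / lam) / Real.log (1 / lam)) *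
    (2 * (1 / lam) ^ 4)

variable {X H β : Type*} {hash : H → X → β} {sim : X → X → ℝ} {lam eps : ℝ} {limit n t k : ℕ}
  {pts : Fin n → X}

lemma cmpsConstant_nonneg (hlam : 0 < lam) (limit : ℕ) : 0 ≤ cmpsConstant lam limit := by
  rw [cmpsConstant]
  positivity

lemma one_le_timeConstant (hlam : lam ∈ Set.Ioo (0 : ℝ) 1) (limit : ℕ) :
    1 ≤ timeConstant lam limit := by
  have hlam0 := hlam.1
  have hlam1 : 0 < 1 - lam := sub_pos.2 hlam.2
  have hlog := log_one_div_pos hlam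
  have hexp := Real.one_le_exp (by norm_num : (0 : ℝ) ≤ 4)
  have hcalls : 0 ≤ 2 * (limit : ℝ) / (1 - lam) := by positivity
  have hwork : 0 ≤ 2 * (1 + limit / lam) / Real.log (1 / lam) := by positivity
  exact one_le_mul_of_one_le_of_one_le (by linarith) (by linarith [one_le_one_div_pow hlam 4])

lemma Admissible.limit_mul_branching_pow_le (h : Admissible lam t limit eps k) :
    limit * branching lam t k ^ k ≤ 2 * limit * (1 / lam) ^ k := by
  rw [mul_comm 2 (limit : ℝ), mul_assoc]
  exact mul_le_mul_of_nonneg_left h.branching_pow_le (Nat.cast_nonneg limit)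

lemma Admissible.limit_mul_expectedCalls_le (h : Admissible lam t limit eps k) :
    limit * expectedCalls lam t k k ≤ 2 * limit / (1 - lam) * (1 / lam) ^ k := by
  have hlam1 : 0 < 1 - lam := sub_pos.2 h.lam_mem.2
  have hlam0 := h.lam_mem.1
  calc limit * ((branching lam t k ^ k - lam) / (1 - lam))
      ≤ limit * (2 * (1 / lam) ^ k / (1 - lam)) := by
        gcongr
        linarith [h.branching_pow_le]
    _ = 2 * limit / (1 - lam) * (1 / lam) ^ k := by ring

lemma treeCost_callWork_le_one {ι τ : Type*} {I : Input ι τ} (hI : I.Regular)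
    (hlimit : 1 ≤ I.limit) (r : List τ → τ → ℝ) (k : ℕ) (p : List τ) {S : List ι} (hS : S.Nodup)
    (hlen : S.length ≤ 1) :
    treeCost I (callWork I) (fun _ => 0) r k p S ≤ 1 := by
  have hcmps : (bruteForce I S).cmps = 0 := by
    have run := bruteForceRun hI hS
    generalize bruteForce I S = e at run ⊢
    cases run with
    | pairs hS _ =>
      simp only [bind_cmps, ticks_cmps, bruteForcePairs_cmps hS, ret_cmps, zero_add, add_zero,
        mul_eq_zero]
      omega
    | light => omega
    | remove => omega
  cases k with
  | zero => simp [treeCost]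
  | succ k =>
    rw [treeCost, bruteForce_val_eq_nil hI hS (hlen.trans hlimit), callWork, hcmps]
    simpa [Input.tokensOf] using hlen

variable [MeasurableSpace H] {ν : Measure H} [IsProbabilityMeasure ν]

theorem expect_totalCmps_le (h : IsLSHFamily ν hash sim) (hlam : lam ∈ Set.Ioo (0 : ℝ) 1)
    (hlimit : 1 ≤ limit) (hsize : 4 * (1 + Real.log n / Real.log (1 / lam)) ^ 2 ≤ lam * t)
    (R : ℕ) :
    expect ν t (Fin t × β) (fun g ω => totalCmps (simJoin hash sim lam limit R pts g ω)) ≤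
      ENNReal.ofReal (R * (cmpsConstant lam limit * individualCost sim lam pts)) := by
  choose k hadm hopt using exists_admissible_depth (pts := pts) hlam hlimit h.nonneg hsize
  set a : Fin n → ℕ → ℝ := fun x D =>
    if D < k x then limit * branching lam t (k x) ^ (k x - D) else 0 with ha
  have hbranching (x : Fin n) : 0 ≤ branching lam t (k x) :=
    zero_le_one.trans (hadm x).one_le_branching
  have ha_nonneg (x : Fin n) : 0 ≤ a x 0 := by
    have := hbranching x
    simp only [ha]
    split_ifs <;> positivity
  have ha_le (x : Fin n) : a x 0 ≤ 2 * limit * (1 / lam) ^ k x := by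
    simp only [ha]
    split_ifs
    · exact (hadm x).limit_mul_branching_pow_le
    · exact mul_nonneg (by positivity) (zero_le_one.trans (one_le_one_div_pow hlam _))
  have hinner (g : Fin t → H) : ∫⁻ ω, totalCmps (simJoin hash sim lam limit R pts g ω)
      ∂(seedMeasure (Fin t × β)) ≤ R * ENNReal.ofReal (callPotential
        (embeddedInput hash sim lam limit pts g) k a (fun _ => Real.exp 4) []
        (List.finRange n)) := by
    have hbound := lintegral_iSup_treeCost_le (fun i d => lintegral_treeCost_le_callPotential
      (embeddedInput_regular g) hlimit (one_le_of_size hsize hlam)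
      (div_nonneg (log_one_div_pos hlam).le (Real.log_natCast_nonneg n))
      (fun x => Admissible.isPotential_cmps (I := embeddedInput hash sim lam limit pts g) (hadm x))
      (node := callCmps (embeddedInput hash sim lam limit pts g))
      (fun S => by rw [zero_mul, zero_add]; rfl) i d (List.nodup_finRange n)) R 0 1
    simp only [Nat.cast_zero, zero_add, Nat.cast_one, one_mul] at hbound
    refine le_trans (le_of_eq ?_) hbound
    simp only [totalCmps, simJoin_cmps]
  calc expect ν t (Fin t × β) (fun g ω => totalCmps (simJoin hash sim lam limit R pts g ω))
      ≤ ∫⁻ g, R * ENNReal.ofReal (callPotential (embeddedInput hash sim lam limit pts g) k a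
          (fun _ => Real.exp 4) [] (List.finRange n)) ∂(Measure.pi fun _ => ν) :=
        lintegral_mono hinner
    _ ≤ R * ENNReal.ofReal (cmpsConstant lam limit * individualCost sim lam pts) := by
        rw [lintegral_const_mul' _ _ (ENNReal.natCast_ne_top R)]
        gcongr
        exact lintegral_callPotential_le_individualCost h hadm hopt (by positivity)
          (Real.exp_pos 4).le ha_nonneg ha_le
    _ = ENNReal.ofReal (R * (cmpsConstant lam limit * individualCost sim lam pts)) := by
        rw [ENNReal.ofReal_mul (Nat.cast_nonneg R), ENNReal.ofReal_natCast]

lemma add_two_mul_le_timeConstant (hlam : lam ∈ Set.Ioo (0 : ℝ) 1) (limit n : ℕ) :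
    (2 * limit / (1 - lam) +
        2 * (Real.exp 4 + (1 + limit / lam) / (Real.log (1 / lam) / Real.log n))) *
      (2 * (1 / lam) ^ 4) ≤ timeConstant lam limit * (1 + Real.log n) := by
  have hlam0 := hlam.1
  have hlam1 : 0 < 1 - lam := sub_pos.2 hlam.2
  have hlog := log_one_div_pos hlam
  have hlogn := Real.log_natCast_nonneg n
  have hcalls : 0 ≤ 2 * (limit : ℝ) / (1 - lam) := by positivity
  have hwork : 0 ≤ (1 + (limit : ℝ) / lam) / Real.log (1 / lam) := by positivity
  have hexp := (Real.exp_pos 4).le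
  rw [timeConstant, mul_right_comm, ← div_mul, mul_div_assoc 2 (1 + (limit : ℝ) / lam)]
  refine mul_le_mul_of_nonneg_right ?_ (by positivity)
  nlinarith [mul_nonneg hcalls hlogn, mul_nonneg hexp hlogn, mul_nonneg hwork hlogn]

lemma lintegral_callPotential_work_le (h : IsLSHFamily ν hash sim)
    (hlam : lam ∈ Set.Ioo (0 : ℝ) 1) {k : Fin n → ℕ}
    (hadm : ∀ x, Admissible lam t limit (Real.log (1 / lam) / Real.log n) (k x))
    (hopt : ∀ x, stopCost sim lam pts x (k x) ≤
      2 * (1 / lam) ^ 4 * ⨅ k, stopCost sim lam pts x k) :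
    ∫⁻ g : Fin t → H, ENNReal.ofReal (callPotential (embeddedInput hash sim lam limit pts g)
      k (fun x D => limit * expectedCalls lam t (k x) (k x - D))
      (fun _ => Real.exp 4 + (1 + limit / lam) / (Real.log (1 / lam) / Real.log n)) []
      (List.finRange n)) ∂(Measure.pi fun _ => ν) ≤
      ENNReal.ofReal (timeConstant lam limit * (1 + Real.log n) *
        individualCost sim lam pts) := by
  have hlam0 := hlam.1
  have hlam1 : 0 < 1 - lam := sub_pos.2 hlam.2
  have hlog := log_one_div_pos hlam
  have hcalls (x : Fin n) : 0 ≤ (limit : ℝ) * expectedCalls lam t (k x) (k x - 0) :=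
    mul_nonneg (Nat.cast_nonneg _) (zero_le_one.trans ((hadm x).one_le_expectedCalls _))
  refine (lintegral_callPotential_le_individualCost h hadm hopt (A := 2 * limit / (1 - lam))
    (by positivity) (by positivity) hcalls
    fun x => (hadm x).limit_mul_expectedCalls_le).trans (ENNReal.ofReal_le_ofReal ?_)
  exact mul_le_mul_of_nonneg_right (add_two_mul_le_timeConstant hlam limit n)
    ((Nat.cast_nonneg n).trans (le_individualCost hlam h.nonneg))

/-- For `n = 1` the potentials degenerate, since `ε = log (1 / λ) / 0 = 0`, but there is no
work beyond the root. -/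
lemma exists_lintegral_callWork_le (h : IsLSHFamily ν hash sim) (hlam : lam ∈ Set.Ioo (0 : ℝ) 1)
    (hlimit : 1 ≤ limit) (hn : 1 ≤ n)
    (hsize : 4 * (1 + Real.log n / Real.log (1 / lam)) ^ 2 ≤ lam * t) :
    ∃ b : (Fin t → H) → ℝ≥0∞,
      (∀ g i d, ∫⁻ ω, (treeCost (embeddedInput hash sim lam limit pts g)
        (callWork (embeddedInput hash sim lam limit pts g)) (fun _ => 0) (seedHash i ω) d []
        (List.finRange n) : ℝ≥0∞) ∂(seedMeasure (Fin t × β)) ≤ b g) ∧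
      ∫⁻ g, b g ∂(Measure.pi fun _ => ν) ≤
        ENNReal.ofReal (timeConstant lam limit * (1 + Real.log n) *
          individualCost sim lam pts) := by
  rcases hn.eq_or_lt with rfl | hn
  · refine ⟨fun _ => 1, fun g i d => ?_, ?_⟩
    · calc _ ≤ ∫⁻ _, 1 ∂(seedMeasure (Fin t × β)) := lintegral_mono fun ω =>
            Nat.cast_le_one.2 <| treeCost_callWork_le_one (embeddedInput_regular g) hlimit
              (seedHash i ω) d [] (List.nodup_finRange 1) (by simp)
        _ = 1 := by rw [lintegral_const, measure_univ, mul_one]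
    · have hcost := le_individualCost (pts := pts) hlam h.nonneg
      rw [lintegral_const, measure_univ, mul_one, ENNReal.one_le_ofReal, Nat.cast_one,
        Real.log_one, add_zero, mul_one]
      exact one_le_mul_of_one_le_of_one_le (one_le_timeConstant hlam limit) (by simpa using hcost)
  · choose k hadm hopt using exists_admissible_depth (pts := pts) hlam hlimit h.nonneg hsize
    have heps : 0 < Real.log (1 / lam) / Real.log n :=
      div_pos (log_one_div_pos hlam) (Real.log_pos (by exact_mod_cast hn))
    refine ⟨_, fun g i d => ?_, lintegral_callPotential_work_le h hlam hadm hopt⟩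
    exact lintegral_treeCost_le_callPotential (embeddedInput_regular g) hlimit
      (one_le_of_size hsize hlam) heps.le
      (fun x => Admissible.isPotential_work (I := embeddedInput hash sim lam limit pts g)
        (hadm x) heps)
      (node := callWork (embeddedInput hash sim lam limit pts g))
      (fun S => by rw [one_mul, callWork]; push_cast; rfl) i d (List.nodup_finRange n)

theorem expect_totalTime_le (h : IsLSHFamily ν hash sim) (hlam : lam ∈ Set.Ioo (0 : ℝ) 1)
    (hlimit : 1 ≤ limit) (hn : 1 ≤ n)
    (hsize : 4 * (1 + Real.log n / Real.log (1 / lam)) ^ 2 ≤ lam * t) (R : ℕ) :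
    expect ν t (Fin t × β) (fun g ω => totalTime (simJoin hash sim lam limit R pts g ω)) ≤
      ENNReal.ofReal ((n * t + R) + (5 * t + 9) *
        (R * (timeConstant lam limit * (1 + Real.log n) * individualCost sim lam pts))) := by
  obtain ⟨b, hb, hb_int⟩ := exists_lintegral_callWork_le (pts := pts) h hlam hlimit hn hsize
  have hQ_nonneg : 0 ≤ timeConstant lam limit * (1 + Real.log n) * individualCost sim lam pts := by
    have := zero_le_one.trans (one_le_timeConstant hlam limit)
    have := (Nat.cast_nonneg n).trans (le_individualCost (pts := pts) hlam h.nonneg)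
    positivity
  generalize timeConstant lam limit * (1 + Real.log n) * individualCost sim lam pts = Q
    at hb_int hQ_nonneg ⊢
  calc expect ν t (Fin t × β) (fun g ω => totalTime (simJoin hash sim lam limit R pts g ω))
      ≤ ∫⁻ g, ((n * t + R : ℕ) + (5 * t + 9 : ℕ) * (R * b g)) ∂(Measure.pi fun _ => ν) := by
        refine lintegral_mono fun g => (lintegral_mono fun ω => iSup_mono fun d => ?_).trans
          (lintegral_iSup_treeCost_le (hb g) R (n * t + R) (5 * t + 9))
        exact_mod_cast simJoin_time_le hn R g ω d
    _ ≤ (n * t + R : ℕ) + (5 * t + 9 : ℕ) * (R * ENNReal.ofReal Q) := by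
        rw [lintegral_add_left measurable_const, lintegral_const, measure_univ, mul_one,
          lintegral_const_mul' _ _ (ENNReal.natCast_ne_top _),
          lintegral_const_mul' _ _ (ENNReal.natCast_ne_top _)]
        gcongr
    _ = ENNReal.ofReal ((n * t + R) + (5 * t + 9) * (R * Q)) := by
        rw [ENNReal.ofReal_add (by positivity) (by positivity),
          ENNReal.ofReal_mul (by positivity), ENNReal.ofReal_mul (Nat.cast_nonneg R)]
        norm_cast

end ExpectedCost

/-! ### Recall and space -/

section Guarantees

/-- The bound for the expected number of ordered pairs of points that have not been separated in a
recursion tree at depth `K`. -/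
def pairsBound (lam : ℝ) (n K : ℕ) : ℝ :=
  max (1 - Real.log (1 / lam) / Real.log n) 0 ^ K * orderedPairs (List.finRange n)

lemma pairsBound_nonneg (lam : ℝ) (n K : ℕ) : 0 ≤ pairsBound lam n K :=
  mul_nonneg (pow_nonneg (le_max_right _ _) _) (Nat.cast_nonneg _)

lemma exp_neg_two_le_one_sub_one_div_pow {K : ℕ} (hK : 2 ≤ K) :
    Real.exp (-2) ≤ (1 - 1 / (K : ℝ)) ^ K := by
  have hK' : (2 : ℝ) ≤ K := by exact_mod_cast hK
  calc Real.exp (-2) = Real.exp (-(2 * (1 / K))) ^ K := by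
        rw [← Real.exp_nat_mul]
        congr 1
        field_simp
    _ ≤ (1 - 1 / (K : ℝ)) ^ K := by
        gcongr
        exact exp_neg_two_mul_le (by positivity) (by gcongr)

/-- If separating all pairs fails with probability `q` at most half of the survival probability of
a similar pair, then `R` repetitions succeed up to an exponentially small error. -/
lemma one_sub_one_div_pow_div_add_pow_le {K : ℕ} (hK : 2 ≤ K) {q : ℝ} (hq0 : 0 ≤ q)
    (hq : q ≤ Real.exp (-2) / (2 * (K + 1))) (R : ℕ) :
    (1 - (1 - 1 / (K : ℝ)) ^ K / (K + 1) + q) ^ R ≤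
      Real.exp (-(R * (Real.exp (-2) / (2 * (K + 1))))) := by
  have hbase : 1 - 1 / (K : ℝ) ∈ Set.Icc (0 : ℝ) 1 := by
    have : (1 : ℝ) / K ≤ 1 := by
      rw [div_le_one (by positivity)]
      exact_mod_cast (by omega : 1 ≤ K)
    exact ⟨sub_nonneg.2 this, sub_le_self _ (by positivity)⟩
  have hsurvive : (1 - 1 / (K : ℝ)) ^ K / (K + 1) ≤ 1 :=
    div_le_one_of_le₀ ((pow_le_one₀ hbase.1 hbase.2).trans (by simp)) (by positivity)
  have hhalf : 2 * (Real.exp (-2) / (2 * (K + 1))) ≤ (1 - 1 / (K : ℝ)) ^ K / (K + 1) := by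
    rw [← mul_div_assoc, mul_div_mul_left _ _ two_ne_zero]
    gcongr
    exact exp_neg_two_le_one_sub_one_div_pow hK
  have hstep := Real.one_sub_le_exp_neg (Real.exp (-2) / (2 * ((K : ℝ) + 1)))
  rw [← mul_neg, Real.exp_nat_mul]
  exact pow_le_pow_left₀ (by linarith) (by linarith) R

variable {X H β : Type*} {hash : H → X → β} {sim : X → X → ℝ} {lam : ℝ} {limit : ℕ} {n t : ℕ}
  {pts : Fin n → X} {x y : Fin n} {η : ℝ} {R K : ℕ}

lemma one_sub_le_seedMeasure_mem_totalOut (hlimit : 1 ≤ limit) (hsize : 1 ≤ lam * t)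
    (hxy : lam ≤ sim (pts x) (pts y)) (hyx : lam ≤ sim (pts y) (pts x)) (hη : 0 < η)
    (hK : 2 ≤ K) (hpairs : pairsBound lam n K ≤ Real.exp (-2) / (2 * (K + 1)))
    (hR : Real.log (1 / η) ≤ R * (Real.exp (-2) / (2 * (K + 1)))) {g : Fin t → H}
    (hg : (1 - 1 / (K : ℝ)) * (lam * t) ≤ hits {h | hash h (pts x) = hash h (pts y)} g) :
    ENNReal.ofReal (1 - η) ≤ seedMeasure (Fin t × β)
      {ω | (x, y) ∈ totalOut (simJoin hash sim lam limit R pts g ω)} := by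
  set I := embeddedInput hash sim lam limit pts g
  set fail : Set (Seeds (Fin t × β)) := {ω | ∀ i < R, (x, y) ∉
    (cpsJoin I (seedHash i ω) (K + 1) [] (List.finRange n)).out}
  have hK' : (1 : ℝ) < K := by exact_mod_cast hK
  have hβ : 1 - 1 / (K : ℝ) ∈ Set.Ioc (0 : ℝ) 1 :=
    ⟨sub_pos.2 ((div_lt_one (by linarith)).2 hK'), sub_le_self _ (by positivity)⟩
  have hfail : (seedMeasure (Fin t × β)).real fail ≤ η :=
    calc (seedMeasure (Fin t × β)).real fail
        ≤ (1 - (1 - 1 / (K : ℝ)) ^ K / (K + 1) + pairsBound lam n K) ^ R :=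
          seedMeasure_not_reported_le (embeddedInput_regular g) hlimit hsize hxy hyx hβ
            (by rw [embeddedInput_overlap]; exact hg) R K (List.nodup_finRange n)
            (List.mem_finRange x) (List.mem_finRange y)
      _ ≤ Real.exp (-(R * (Real.exp (-2) / (2 * (K + 1))))) :=
          one_sub_one_div_pow_div_add_pow_le hK (pairsBound_nonneg lam n K) hpairs R
      _ ≤ Real.exp (-Real.log (1 / η)) := Real.exp_le_exp.2 (neg_le_neg hR)
      _ = η := by rw [Real.exp_neg, Real.exp_log (one_div_pos.2 hη), one_div, inv_inv]
  have hcover : Set.univ ⊆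
      {ω | (x, y) ∈ totalOut (simJoin hash sim lam limit R pts g ω)} ∪ fail := by
    intro ω _
    by_cases hω : ω ∈ fail
    · exact Or.inr hω
    · simp only [fail, Set.mem_ofPred_eq, not_forall, not_not] at hω
      obtain ⟨i, hi, hout⟩ := hω
      exact Or.inl (mem_totalOut_simJoin.2 ⟨K + 1, i, hi, hout⟩)
  rw [ENNReal.ofReal_sub _ hη.le, ENNReal.ofReal_one, tsub_le_iff_right,
    ← measure_univ (μ := seedMeasure (Fin t × β))]
  refine (measure_mono hcover).trans ((measure_union_le _ _).trans ?_)
  gcongr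
  exact (ENNReal.le_ofReal_iff_toReal_le (measure_ne_top _ _) hη.le).2 hfail

lemma seedMeasure_lt_totalSpace_le (hlimit : 1 ≤ limit) (hsize : 1 ≤ lam * t) (g : Fin t → H)
    {s : ℝ} (hs : (n : ℝ) * t + (K + 1) * (n + 1 + 4 * (n * t)) ≤ s) :
    seedMeasure (Fin t × β) {ω | ENNReal.ofReal s <
      totalSpace (simJoin hash sim lam limit R pts g ω)} ≤
      ENNReal.ofReal (R * pairsBound lam n K) := by
  set I := embeddedInput hash sim lam limit pts g
  calc _ ≤ seedMeasure (Fin t × β) (⋃ i ∈ Finset.range R, {ω | treeCost I (fun _ => 0)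
        orderedPairs (seedHash i ω) K [] (List.finRange n) ≠ 0}) := by
        refine measure_mono fun ω hω => ?_
        by_contra hsep
        simp only [Set.mem_iUnion, Finset.mem_range, Set.mem_ofPred_eq, exists_prop, not_exists,
          not_and, not_not] at hsep
        refine (Set.mem_ofPred.1 hω).not_ge (iSup_le fun k => ?_)
        rw [← ENNReal.ofReal_natCast]
        refine ENNReal.ofReal_le_ofReal (le_trans ?_ hs)
        exact_mod_cast simJoin_space_le hlimit R g ω K k hsep
    _ ≤ ∑ _ ∈ Finset.range R, ENNReal.ofReal (pairsBound lam n K) :=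
        (measure_biUnion_finset_le _ _).trans (Finset.sum_le_sum fun i _ =>
          seedMeasure_treeCost_ne_zero_le (embeddedInput_regular g) hlimit hsize i K
            (List.nodup_finRange n))
    _ = ENNReal.ofReal (R * pairsBound lam n K) := by
        rw [Finset.sum_const, Finset.card_range, nsmul_eq_mul, ← ENNReal.ofReal_natCast,
          ← ENNReal.ofReal_mul (Nat.cast_nonneg R)]

variable [MeasurableSpace H] {ν : Measure H} {A : Set H}

lemma measurableSet_le_hits (hA : MeasurableSet A) (b : ℝ) :
    MeasurableSet {g : Fin t → H | b ≤ hits A g} := by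
  have hmeas := (measurable_choose_hits (t := t) hA 1).ennreal_toReal
  simp only [ENNReal.toReal_natCast, Nat.choose_one_right] at hmeas
  exact measurableSet_le measurable_const hmeas

lemma mul_le_prob {τ : Type*} {E : (Fin t → H) → Seeds τ → Prop} {G : Set (Fin t → H)}
    (hG : MeasurableSet G) {p : ℝ≥0∞} (hE : ∀ g ∈ G, p ≤ seedMeasure τ {ω | E g ω}) :
    p * (Measure.pi fun _ : Fin t => ν) G ≤ prob ν t τ E := by
  rw [← lintegral_indicator_const hG]
  exact lintegral_mono fun g => Set.indicator_le hE g

variable [IsProbabilityMeasure ν]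

lemma one_sub_le_measure_le_hits (hA : MeasurableSet A) (hlam : 0 < lam) (hAlam : lam ≤ ν.real A)
    (ht : 0 < t) (hK : 0 < K) (hKt : (K : ℝ) ^ 2 ≤ lam ^ 2 * η * t) :
    ENNReal.ofReal (1 - η) ≤ (Measure.pi fun _ : Fin t => ν)
      {g | (1 - 1 / (K : ℝ)) * (lam * t) ≤ hits A g} := by
  have ht' : (0 : ℝ) < t := by exact_mod_cast ht
  have hcompl : (Measure.pi fun _ : Fin t => ν).real
      {g | (1 - 1 / (K : ℝ)) * (lam * t) ≤ hits A g}ᶜ ≤ η := by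
    refine (measureReal_mono fun g hg => ?_).trans
      ((measure_hits_le ν hA (by positivity : 0 < lam * t / K)).trans ?_)
    · simp only [Set.mem_compl_iff, Set.mem_ofPred_eq, not_le] at hg ⊢
      rw [sub_mul, one_mul, one_div_mul_eq_div] at hg
      nlinarith
    · rw [div_le_iff₀ (by positivity), div_pow, mul_pow, ← mul_div_assoc,
        le_div_iff₀ (by positivity)]
      nlinarith [mul_le_mul_of_nonneg_right hKt ht'.le]
  rw [probReal_compl_eq_one_sub (measurableSet_le_hits hA _)] at hcompl
  refine ENNReal.ofReal_le_of_le_toReal ?_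
  change 1 - η ≤ (Measure.pi fun _ : Fin t => ν).real _
  linarith

/-- With probability `1 - η` the similarity of the pair is preserved by the embedding, and then
all repetitions together miss the pair with probability at most `η`, for `η = (1 - φ) / 2`. -/
theorem le_prob_mem_totalOut (h : IsLSHFamily ν hash sim) (hlam : 0 < lam) (hlimit : 1 ≤ limit)
    (hsize : 1 ≤ lam * t) {φ : ℝ} (hφ : φ ∈ Set.Ioo (0 : ℝ) 1) (hK : 2 ≤ K)
    (hKt : (K : ℝ) ^ 2 ≤ lam ^ 2 * ((1 - φ) / 2) * t)
    (hpairs : pairsBound lam n K ≤ Real.exp (-2) / (2 * (K + 1)))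
    (hR : Real.log (1 / ((1 - φ) / 2)) ≤ R * (Real.exp (-2) / (2 * (K + 1))))
    {q : Fin n × Fin n} (hq : q ∈ joinSet sim lam pts) :
    ENNReal.ofReal φ ≤ prob ν t (Fin t × β)
      (fun g ω => q ∈ totalOut (simJoin hash sim lam limit R pts g ω)) := by
  obtain ⟨x, y⟩ := q
  have hxy : lam ≤ sim (pts x) (pts y) := hq
  have hyx : lam ≤ sim (pts y) (pts x) := hxy.trans_eq (h.symm _ _)
  have ht : 0 < t := by
    rw [pos_iff_ne_zero]
    rintro rfl
    norm_num at hsize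
  obtain ⟨hA, hAsim⟩ := h (pts x) (pts y)
  have hη : 0 < (1 - φ) / 2 := half_pos (sub_pos.2 hφ.2)
  calc ENNReal.ofReal φ
      ≤ ENNReal.ofReal ((1 - (1 - φ) / 2) * (1 - (1 - φ) / 2)) :=
        ENNReal.ofReal_le_ofReal (by nlinarith [sq_nonneg (1 - φ)])
    _ = ENNReal.ofReal (1 - (1 - φ) / 2) * ENNReal.ofReal (1 - (1 - φ) / 2) :=
        ENNReal.ofReal_mul (by linarith [hφ.1])
    _ ≤ ENNReal.ofReal (1 - (1 - φ) / 2) * (Measure.pi fun _ : Fin t => ν)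
          {g | (1 - 1 / (K : ℝ)) * (lam * t) ≤ hits {h | hash h (pts x) = hash h (pts y)} g} := by
        gcongr
        exact one_sub_le_measure_le_hits hA hlam (hxy.trans_eq hAsim.symm) ht (by omega) hKt
    _ ≤ _ := mul_le_prob (measurableSet_le_hits hA _) fun g hg =>
        one_sub_le_seedMeasure_mem_totalOut hlimit hsize hxy hyx hη hK hpairs hR hg

theorem prob_lt_totalSpace_le (hlimit : 1 ≤ limit) (hsize : 1 ≤ lam * t) (R K : ℕ) {s : ℝ}
    (hs : (n : ℝ) * t + (K + 1) * (n + 1 + 4 * (n * t)) ≤ s) :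
    prob ν t (Fin t × β) (fun g ω =>
      ENNReal.ofReal s < totalSpace (simJoin hash sim lam limit R pts g ω)) ≤
      ENNReal.ofReal (R * pairsBound lam n K) := by
  refine (lintegral_mono fun g => seedMeasure_lt_totalSpace_le hlimit hsize g hs).trans_eq ?_
  rw [lintegral_const, measure_univ, mul_one]

end Guarantees

/-! ### Choice of the parameters -/

section Parameters

lemma one_le_one_add_log (n : ℕ) : 1 ≤ 1 + Real.log n :=
  le_add_of_nonneg_right (Real.log_natCast_nonneg n)

lemma le_exp_self (u : ℝ) : u ≤ Real.exp u := by
  linarith [Real.add_one_le_exp u]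

lemma ceil_mul_le {c u : ℝ} (hc : 0 ≤ c) (hu : 1 ≤ u) : (⌈c * u⌉₊ : ℝ) ≤ (c + 1) * u := by
  have := Nat.ceil_lt_add_one (mul_nonneg hc (by linarith : 0 ≤ u))
  nlinarith

variable {lam φ : ℝ} {limit n : ℕ}

lemma pairsBound_le (hlam : lam ∈ Set.Ioo (0 : ℝ) 1) (hn : 1 ≤ n) {b : ℝ} (hb : 0 ≤ b) :
    pairsBound lam n ⌈b * (1 + Real.log n) ^ 2⌉₊ ≤
      Real.exp ((2 - Real.log (1 / lam) * b) * (1 + Real.log n)) := by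
  rcases hn.eq_or_lt with rfl | hn
  · simp [pairsBound, orderedPairs, Real.exp_nonneg]
  have hl := log_one_div_pos hlam
  have hn' : (1 : ℝ) < n := by exact_mod_cast hn
  have hv : 0 < Real.log n := Real.log_pos hn'
  have hK := Nat.le_ceil (b * (1 + Real.log n) ^ 2)
  rw [pairsBound, orderedPairs, List.length_finRange]
  set K := ⌈b * (1 + Real.log n) ^ 2⌉₊
  set l := Real.log (1 / lam)
  set v := Real.log n with hv_def
  have hsplit : max (1 - l / v) 0 ≤ Real.exp (-(l / v)) :=
    max_le (Real.one_sub_le_exp_neg _) (Real.exp_pos _).le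
  have hpairs : ((n * (n - 1) : ℕ) : ℝ) ≤ Real.exp (2 * v) := by
    rw [two_mul, Real.exp_add, hv_def, Real.exp_log (by linarith), ← Nat.cast_mul]
    exact_mod_cast Nat.mul_le_mul_left n (Nat.sub_le n 1)
  have hdepth : l * b * (1 + v) ≤ K * (l / v) := by
    rw [← mul_div_assoc, le_div_iff₀ hv]
    have : b * (1 + v) * v ≤ K := by nlinarith [mul_nonneg hb (by linarith : 0 ≤ 1 + v)]
    nlinarith
  calc _ ≤ Real.exp (-(l / v)) ^ K * Real.exp (2 * v) := by gcongr
    _ = Real.exp (K * -(l / v) + 2 * v) := by rw [← Real.exp_nat_mul, ← Real.exp_add]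
    _ ≤ _ := Real.exp_le_exp.2 (by linarith)

/-- The recursion depth relevant for the recall is `depthConstant lam * (1 + log n) ^ 2`. The value
is an explicit solution of `6 + log (6 * B) ≤ log (1 / lam) * B`. -/
def depthConstant (lam : ℝ) : ℝ :=
  2 + (10 + 24 / Real.log (1 / lam)) / Real.log (1 / lam)

lemma two_le_depthConstant (hlam : lam ∈ Set.Ioo (0 : ℝ) 1) : 2 ≤ depthConstant lam := by
  have hl := log_one_div_pos hlam
  exact le_add_of_nonneg_right (by positivity)

lemma six_add_log_depthConstant_le (hlam : lam ∈ Set.Ioo (0 : ℝ) 1) :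
    6 + Real.log (6 * depthConstant lam) ≤ Real.log (1 / lam) * depthConstant lam := by
  have hl := log_one_div_pos hlam
  have hB := two_le_depthConstant hlam
  have hlB : Real.log (1 / lam) * depthConstant lam =
      2 * Real.log (1 / lam) + 10 + 24 / Real.log (1 / lam) := by
    rw [depthConstant]
    field_simp
    ring
  generalize depthConstant lam = B at *
  generalize Real.log (1 / lam) = l at *
  have hlog : Real.log (6 * B) ≤ (12 / l - 1) + (l * B / 2 - 1) := by
    rw [show 6 * B = 12 / l * (l * B / 2) by field_simp; ring,
      Real.log_mul (by positivity) (by positivity)]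
    exact add_le_add (Real.log_le_sub_one_of_pos (by positivity))
      (Real.log_le_sub_one_of_pos (by positivity))
  have : 24 / l = 2 * (12 / l) := by ring
  linarith

/-- The recursion depth by which all pairs of points have been separated with a probability that
exceeds the probability that a similar pair has been lost. -/
def depth (lam : ℝ) (n : ℕ) : ℕ :=
  ⌈depthConstant lam * (1 + Real.log n) ^ 2⌉₊

lemma two_le_depth (hlam : lam ∈ Set.Ioo (0 : ℝ) 1) (n : ℕ) : 2 ≤ depth lam n := by
  have hB := two_le_depthConstant hlam
  have : (2 : ℝ) ≤ depth lam n :=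
    (hB.trans (le_mul_of_one_le_right (by linarith) (one_le_pow₀ (one_le_one_add_log n)))).trans
      (Nat.le_ceil _)
  exact_mod_cast this

lemma depth_add_one_le (hlam : lam ∈ Set.Ioo (0 : ℝ) 1) (n : ℕ) :
    (depth lam n : ℝ) + 1 ≤ 2 * depthConstant lam * (1 + Real.log n) ^ 2 := by
  have hB := two_le_depthConstant hlam
  have hu : 1 ≤ (1 + Real.log n) ^ 2 := one_le_pow₀ (one_le_one_add_log n)
  have := ceil_mul_le (by linarith : 0 ≤ depthConstant lam) hu
  rw [depth]
  nlinarith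

lemma pairsBound_depth_le (hlam : lam ∈ Set.Ioo (0 : ℝ) 1) (hn : 1 ≤ n) :
    pairsBound lam n (depth lam n) ≤ Real.exp (-2) / (2 * (depth lam n + 1)) := by
  have hB := two_le_depthConstant hlam
  have hlB := six_add_log_depthConstant_le hlam
  have hK := depth_add_one_le hlam n
  have hu := one_le_one_add_log n
  refine (pairsBound_le hlam hn (by linarith)).trans ?_
  generalize depthConstant lam = B at *
  generalize 1 + Real.log n = u at *
  generalize Real.log (1 / lam) = l at *
  have hlog : 0 ≤ Real.log (6 * B) := Real.log_nonneg (by linarith)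
  have hu2 : u ^ 2 ≤ Real.exp u ^ 2 := by
    gcongr
    exact le_exp_self u
  rw [le_div_iff₀ (by positivity)]
  calc Real.exp ((2 - l * B) * u) * (2 * (depth lam n + 1))
      ≤ Real.exp ((2 - l * B) * u) * (6 * B * Real.exp u ^ 2) := by
        refine mul_le_mul_of_nonneg_left ?_ (Real.exp_pos _).le
        nlinarith
    _ = Real.exp ((2 - l * B) * u + (Real.log (6 * B) + 2 * u)) := by
        rw [Real.exp_add, Real.exp_add, Real.exp_log (by linarith), ← Real.exp_nat_mul,
          Nat.cast_two]
    _ ≤ Real.exp (-2) := Real.exp_le_exp.2 (by nlinarith)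

/-- The leading constant of the embedding size. The first summand makes the embedding large enough
for the potential argument, the second one makes it preserve the similarity of a given pair up to
a factor `1 - 1 / depth lam n`. -/
def embeddingConstant (lam φ : ℝ) : ℝ :=
  4 / lam * (1 + 1 / Real.log (1 / lam)) ^ 2 +
    8 * depthConstant lam ^ 2 / (lam ^ 2 * (1 - φ))

/-- The number of hash functions used by the embedding. -/
def embeddingSize (lam φ : ℝ) (n : ℕ) : ℕ :=
  ⌈embeddingConstant lam φ * (1 + Real.log n) ^ 4⌉₊

lemma embeddingConstant_pos (hlam : lam ∈ Set.Ioo (0 : ℝ) 1) (hφ : φ < 1) :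
    0 < embeddingConstant lam φ := by
  have hl := log_one_div_pos hlam
  have h0 := hlam.1
  have := sub_pos.2 hφ
  rw [embeddingConstant]
  positivity

lemma one_le_embeddingSize (hlam : lam ∈ Set.Ioo (0 : ℝ) 1) (hφ : φ < 1) (n : ℕ) :
    1 ≤ embeddingSize lam φ n :=
  Nat.one_le_ceil_iff.2
    (mul_pos (embeddingConstant_pos hlam hφ) (pow_pos (by linarith [one_le_one_add_log n]) 4))

lemma embeddingSize_le (hlam : lam ∈ Set.Ioo (0 : ℝ) 1) (hφ : φ < 1) (n : ℕ) :
    (embeddingSize lam φ n : ℝ) ≤ (embeddingConstant lam φ + 1) * (1 + Real.log n) ^ 4 :=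
  ceil_mul_le (embeddingConstant_pos hlam hφ).le (one_le_pow₀ (one_le_one_add_log n))

lemma four_mul_sq_le_mul_embeddingSize (hlam : lam ∈ Set.Ioo (0 : ℝ) 1) (hφ : φ < 1) (n : ℕ) :
    4 * (1 + Real.log n / Real.log (1 / lam)) ^ 2 ≤ lam * embeddingSize lam φ n := by
  have hl := log_one_div_pos hlam
  have h0 := hlam.1
  have := sub_pos.2 hφ
  have hv := Real.log_natCast_nonneg n
  have hT : 4 / lam * (1 + 1 / Real.log (1 / lam)) ^ 2 ≤ embeddingConstant lam φ :=
    le_add_of_nonneg_right (by positivity)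
  have ht := Nat.le_ceil (embeddingConstant lam φ * (1 + Real.log n) ^ 4)
  rw [← embeddingSize] at ht
  generalize Real.log (1 / lam) = l at *
  calc 4 * (1 + Real.log n / l) ^ 2 ≤ 4 * ((1 + 1 / l) * (1 + Real.log n)) ^ 2 := by
        gcongr
        have : 0 ≤ 1 / l := by positivity
        rw [div_eq_mul_one_div]
        nlinarith
    _ = lam * (4 / lam * (1 + 1 / l) ^ 2 * (1 + Real.log n) ^ 2) := by field_simp
    _ ≤ lam * (4 / lam * (1 + 1 / l) ^ 2 * (1 + Real.log n) ^ 4) := by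
        gcongr
        · linarith
        · norm_num
    _ ≤ lam * embeddingSize lam φ n := by
        gcongr
        exact (mul_le_mul_of_nonneg_right hT (by positivity)).trans ht

lemma depth_sq_le (hlam : lam ∈ Set.Ioo (0 : ℝ) 1) (hφ : φ < 1) (n : ℕ) :
    (depth lam n : ℝ) ^ 2 ≤ lam ^ 2 * ((1 - φ) / 2) * embeddingSize lam φ n := by
  have hl := log_one_div_pos hlam
  have h0 := hlam.1
  have := sub_pos.2 hφ
  have hT : 8 * depthConstant lam ^ 2 / (lam ^ 2 * (1 - φ)) ≤ embeddingConstant lam φ :=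
    le_add_of_nonneg_left (by positivity)
  have ht := Nat.le_ceil (embeddingConstant lam φ * (1 + Real.log n) ^ 4)
  rw [← embeddingSize] at ht
  calc (depth lam n : ℝ) ^ 2 ≤ (2 * depthConstant lam * (1 + Real.log n) ^ 2) ^ 2 := by
        gcongr
        linarith [depth_add_one_le hlam n]
    _ = lam ^ 2 * ((1 - φ) / 2) *
          (8 * depthConstant lam ^ 2 / (lam ^ 2 * (1 - φ)) * (1 + Real.log n) ^ 4) := by
        field_simp
        ring
    _ ≤ lam ^ 2 * ((1 - φ) / 2) * embeddingSize lam φ n := by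
        gcongr
        exact (mul_le_mul_of_nonneg_right hT (by positivity)).trans ht

/-- The leading constant of the number of repetitions: a single one reports a given pair of the
join with probability at least `exp (-2) / (2 * (depth lam n + 1))`. -/
def repetitionConstant (lam φ : ℝ) : ℝ :=
  4 * Real.exp 2 * depthConstant lam * Real.log (1 / ((1 - φ) / 2))

/-- The number of repetitions of the recursive procedure. -/
def repetitions (lam φ : ℝ) (n : ℕ) : ℕ :=
  ⌈repetitionConstant lam φ * (1 + Real.log n) ^ 2⌉₊

lemma log_one_div_half_nonneg (hφ : φ ∈ Set.Ioo (0 : ℝ) 1) :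
    0 ≤ Real.log (1 / ((1 - φ) / 2)) :=
  Real.log_nonneg ((one_le_div (half_pos (sub_pos.2 hφ.2))).2 (by linarith [hφ.1]))

lemma repetitionConstant_nonneg (hlam : lam ∈ Set.Ioo (0 : ℝ) 1) (hφ : φ ∈ Set.Ioo (0 : ℝ) 1) :
    0 ≤ repetitionConstant lam φ := by
  have hB := two_le_depthConstant hlam
  have hlog := log_one_div_half_nonneg hφ
  rw [repetitionConstant]
  positivity

lemma repetitions_le (hlam : lam ∈ Set.Ioo (0 : ℝ) 1) (hφ : φ ∈ Set.Ioo (0 : ℝ) 1) (n : ℕ) :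
    (repetitions lam φ n : ℝ) ≤ (repetitionConstant lam φ + 1) * (1 + Real.log n) ^ 2 :=
  ceil_mul_le (repetitionConstant_nonneg hlam hφ) (one_le_pow₀ (one_le_one_add_log n))

lemma log_le_repetitions_mul (hlam : lam ∈ Set.Ioo (0 : ℝ) 1) (hφ : φ ∈ Set.Ioo (0 : ℝ) 1)
    (n : ℕ) :
    Real.log (1 / ((1 - φ) / 2)) ≤
      repetitions lam φ n * (Real.exp (-2) / (2 * (depth lam n + 1))) := by
  have hlog := log_one_div_half_nonneg hφ
  rw [← mul_div_assoc, le_div_iff₀ (by positivity), Real.exp_neg, ← div_eq_mul_inv,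
    le_div_iff₀ (Real.exp_pos 2)]
  calc Real.log (1 / ((1 - φ) / 2)) * (2 * (depth lam n + 1)) * Real.exp 2
      ≤ Real.log (1 / ((1 - φ) / 2)) *
          (2 * (2 * depthConstant lam * (1 + Real.log n) ^ 2)) * Real.exp 2 := by
        gcongr
        exact depth_add_one_le hlam n
    _ = repetitionConstant lam φ * (1 + Real.log n) ^ 2 := by
        rw [repetitionConstant]
        ring
    _ ≤ repetitions lam φ n := Nat.le_ceil _

/-- The constant of the bounds for the embedding size, for the number of repetitions, for the
expected running time and for the expected number of similarity computations. -/
def costConstant (lam φ : ℝ) (limit : ℕ) : ℝ :=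
  (embeddingConstant lam φ + 1) + (repetitionConstant lam φ + 1) +
    (5 * embeddingConstant lam φ + 14) * (repetitionConstant lam φ + 1) * timeConstant lam limit +
    cmpsConstant lam limit

/-- The recursion depth `spaceDepthConstant lam φ a * (1 + log n) ^ 2` is exceeded in some
repetition with probability at most `n ^ (-a)`. -/
def spaceDepthConstant (lam φ a : ℝ) : ℝ :=
  (Real.log (repetitionConstant lam φ + 1) + 4 + a) / Real.log (1 / lam)

/-- The constant of the bound for the working space that holds with probability `1 - n ^ (-a)`. -/
def spaceConstant (lam φ a : ℝ) : ℝ :=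
  (embeddingConstant lam φ + 1) +
    (spaceDepthConstant lam φ a + 2) * (6 + 4 * embeddingConstant lam φ)

lemma costConstant_time_summand_nonneg (hlam : lam ∈ Set.Ioo (0 : ℝ) 1) (hφ : φ ∈ Set.Ioo (0 : ℝ) 1)
    (limit : ℕ) :
    0 ≤ (5 * embeddingConstant lam φ + 14) * (repetitionConstant lam φ + 1) *
      timeConstant lam limit := by
  have hT := embeddingConstant_pos hlam hφ.2
  have hr := repetitionConstant_nonneg hlam hφ
  have hM := one_le_timeConstant hlam limit
  positivity

lemma embeddingSize_le_costConstant_mul (hlam : lam ∈ Set.Ioo (0 : ℝ) 1)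
    (hφ : φ ∈ Set.Ioo (0 : ℝ) 1) (limit n : ℕ) :
    (embeddingSize lam φ n : ℝ) ≤ costConstant lam φ limit * (1 + Real.log n) ^ 7 := by
  have hT := embeddingConstant_pos hlam hφ.2
  have hr := repetitionConstant_nonneg hlam hφ
  have hP := costConstant_time_summand_nonneg hlam hφ limit
  have hN := cmpsConstant_nonneg hlam.1 limit
  have hu := one_le_one_add_log n
  refine (embeddingSize_le hlam hφ.2 n).trans
    (mul_le_mul ?_ (pow_le_pow_right₀ hu (by norm_num)) (by positivity) ?_) <;>
  · rw [costConstant]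
    linarith

lemma repetitions_le_costConstant_mul (hlam : lam ∈ Set.Ioo (0 : ℝ) 1)
    (hφ : φ ∈ Set.Ioo (0 : ℝ) 1) (limit n : ℕ) :
    (repetitions lam φ n : ℝ) ≤ costConstant lam φ limit * (1 + Real.log n) ^ 2 := by
  refine (repetitions_le hlam hφ n).trans (mul_le_mul_of_nonneg_right ?_ (sq_nonneg _))
  rw [costConstant]
  linarith [embeddingConstant_pos hlam hφ.2, costConstant_time_summand_nonneg hlam hφ limit,
    cmpsConstant_nonneg hlam.1 limit]

lemma cmpsConstant_le_costConstant (hlam : lam ∈ Set.Ioo (0 : ℝ) 1)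
    (hφ : φ ∈ Set.Ioo (0 : ℝ) 1) (limit : ℕ) :
    cmpsConstant lam limit ≤ costConstant lam φ limit := by
  rw [costConstant]
  linarith [embeddingConstant_pos hlam hφ.2, repetitionConstant_nonneg hlam hφ,
    costConstant_time_summand_nonneg hlam hφ limit]

lemma time_le_costConstant_mul (hlam : lam ∈ Set.Ioo (0 : ℝ) 1) (hφ : φ ∈ Set.Ioo (0 : ℝ) 1)
    (limit : ℕ) {W : ℝ} (hn : 1 ≤ n) (hW : n ≤ W) :
    ((n : ℝ) * embeddingSize lam φ n + repetitions lam φ n) + (5 * embeddingSize lam φ n + 9) *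
        (repetitions lam φ n * (timeConstant lam limit * (1 + Real.log n) * W)) ≤
      costConstant lam φ limit * (1 + Real.log n) ^ 7 * W := by
  have hT := embeddingConstant_pos hlam hφ.2
  have hr := repetitionConstant_nonneg hlam hφ
  have hM := one_le_timeConstant hlam limit
  have hN := cmpsConstant_nonneg hlam.1 limit
  have ht := embeddingSize_le hlam hφ.2 n
  have hR := repetitions_le hlam hφ n
  have hu := one_le_one_add_log n
  have hW1 : 1 ≤ W := le_trans (by exact_mod_cast hn) hW
  rw [costConstant]
  generalize embeddingConstant lam φ = T at *
  generalize repetitionConstant lam φ = r at *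
  generalize timeConstant lam limit = M at *
  generalize 1 + Real.log n = u at *
  have hu4 : 1 ≤ u ^ 4 := one_le_pow₀ hu
  have h47 : u ^ 4 ≤ u ^ 7 := pow_le_pow_right₀ hu (by norm_num)
  have h27 : u ^ 2 ≤ u ^ 7 := pow_le_pow_right₀ hu (by norm_num)
  have hembed : (n : ℝ) * embeddingSize lam φ n ≤ (T + 1) * u ^ 7 * W := by
    calc (n : ℝ) * embeddingSize lam φ n ≤ W * ((T + 1) * u ^ 7) := by
          gcongr
          exact ht.trans (by gcongr)
      _ = _ := by ring
  have hrestart : repetitions lam φ n ≤ (r + 1) * u ^ 7 * W :=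
    (hR.trans (by gcongr)).trans (le_mul_of_one_le_right (by positivity) hW1)
  have htree : (5 * embeddingSize lam φ n + 9) * (repetitions lam φ n * (M * u * W)) ≤
      (5 * T + 14) * (r + 1) * M * u ^ 7 * W := by
    calc _ ≤ ((5 * T + 14) * u ^ 4) * (((r + 1) * u ^ 2) * (M * u * W)) := by
          gcongr
          linarith
      _ = _ := by ring
  linarith [mul_nonneg (mul_nonneg hN (by positivity : 0 ≤ u ^ 7)) (by linarith : 0 ≤ W)]

lemma spaceDepthConstant_nonneg (hlam : lam ∈ Set.Ioo (0 : ℝ) 1) (hφ : φ ∈ Set.Ioo (0 : ℝ) 1)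
    {a : ℝ} (ha : 0 ≤ a) : 0 ≤ spaceDepthConstant lam φ a := by
  have hl := log_one_div_pos hlam
  have hr := Real.log_nonneg (le_add_of_nonneg_left (repetitionConstant_nonneg hlam hφ))
  rw [spaceDepthConstant]
  positivity

lemma repetitions_mul_pairsBound_le (hlam : lam ∈ Set.Ioo (0 : ℝ) 1)
    (hφ : φ ∈ Set.Ioo (0 : ℝ) 1) (hn : 1 ≤ n) {a : ℝ} (ha : 0 ≤ a) :
    repetitions lam φ n * pairsBound lam n ⌈spaceDepthConstant lam φ a * (1 + Real.log n) ^ 2⌉₊ ≤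
      (n : ℝ) ^ (-a) := by
  have hpairs := pairsBound_le hlam hn (spaceDepthConstant_nonneg hlam hφ ha)
  have hr : 1 ≤ repetitionConstant lam φ + 1 :=
    le_add_of_nonneg_left (repetitionConstant_nonneg hlam hφ)
  have hlog := Real.log_nonneg hr
  have hR := repetitions_le hlam hφ n
  have hu := one_le_one_add_log n
  have hn' : (0 : ℝ) < n := by exact_mod_cast hn
  rw [spaceDepthConstant, mul_div_cancel₀ _ (log_one_div_pos hlam).ne'] at hpairs
  rw [Real.rpow_def_of_pos hn']
  refine (mul_le_mul hR hpairs (pairsBound_nonneg _ _ _) (by positivity)).trans ?_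
  generalize repetitionConstant lam φ + 1 = c at *
  generalize Real.log n = v at *
  calc c * (1 + v) ^ 2 * Real.exp ((2 - (Real.log c + 4 + a)) * (1 + v))
      ≤ c * Real.exp (1 + v) ^ 2 * Real.exp ((2 - (Real.log c + 4 + a)) * (1 + v)) := by
        gcongr
        exact le_exp_self _
    _ = Real.exp (Real.log c + 2 * (1 + v) + (2 - (Real.log c + 4 + a)) * (1 + v)) := by
        rw [Real.exp_add _ ((2 - (Real.log c + 4 + a)) * (1 + v)), Real.exp_add (Real.log c),
          Real.exp_log (by linarith), ← Real.exp_nat_mul, Nat.cast_two]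
    _ ≤ Real.exp (v * -a) := Real.exp_le_exp.2 (by nlinarith)

lemma space_le_spaceConstant_mul (hlam : lam ∈ Set.Ioo (0 : ℝ) 1) (hφ : φ ∈ Set.Ioo (0 : ℝ) 1)
    (hn : 1 ≤ n) {a : ℝ} (ha : 0 ≤ a) :
    (n : ℝ) * embeddingSize lam φ n + (⌈spaceDepthConstant lam φ a * (1 + Real.log n) ^ 2⌉₊ + 1) *
        (n + 1 + 4 * (n * embeddingSize lam φ n)) ≤
      spaceConstant lam φ a * n * (1 + Real.log n) ^ 7 := by
  have hb := spaceDepthConstant_nonneg hlam hφ ha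
  have hT := embeddingConstant_pos hlam hφ.2
  have ht := embeddingSize_le hlam hφ.2 n
  have ht0 : (0 : ℝ) ≤ embeddingSize lam φ n := Nat.cast_nonneg _
  have hu := one_le_one_add_log n
  have hK := ceil_mul_le hb (one_le_pow₀ (n := 2) hu)
  have hn' : (1 : ℝ) ≤ n := by exact_mod_cast hn
  rw [spaceConstant]
  generalize ⌈spaceDepthConstant lam φ a * (1 + Real.log n) ^ 2⌉₊ = K at *
  generalize spaceDepthConstant lam φ a = b at *
  generalize embeddingConstant lam φ = T at *
  generalize 1 + Real.log n = u at *
  generalize (embeddingSize lam φ n : ℝ) = t at *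
  generalize (n : ℝ) = m at *
  have hu2 : 1 ≤ u ^ 2 := one_le_pow₀ hu
  have hu4 : 1 ≤ u ^ 4 := one_le_pow₀ hu
  have hframe : m + 1 + 4 * (m * t) ≤ m * ((6 + 4 * T) * u ^ 4) := by
    nlinarith [mul_le_mul_of_nonneg_left ht (by linarith : 0 ≤ m),
      mul_le_mul_of_nonneg_left hu4 (by linarith : 0 ≤ m)]
  have hframes : (K : ℝ) + 1 ≤ (b + 2) * u ^ 2 := by linarith
  calc _ ≤ m * ((T + 1) * u ^ 4) + ((b + 2) * u ^ 2) * (m * ((6 + 4 * T) * u ^ 4)) := by gcongr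
    _ = (m * (T + 1)) * u ^ 4 + ((b + 2) * m * (6 + 4 * T)) * u ^ 6 := by ring
    _ ≤ (m * (T + 1)) * u ^ 7 + ((b + 2) * m * (6 + 4 * T)) * u ^ 7 := by
        gcongr <;> first | exact hu | norm_num
    _ = _ := by ring

end Parameters

end CPSJoin

end

theorem theorem1_general (lam φ : ℝ) (hlam : lam ∈ Set.Ioo (0 : ℝ) 1) (hφ : φ ∈ Set.Ioo (0 : ℝ) 1)
    (limit : ℕ) (hlimit : 1 ≤ limit) :
    ∃ (t R : ℕ → ℕ) (C : ℝ) (D : ℝ → ℝ) (c : ℕ),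
      (∀ n : ℕ, 1 ≤ n →
        1 ≤ t n ∧ (t n : ℝ) ≤ C * (1 + Real.log n) ^ c ∧
        (R n : ℝ) ≤ C * (1 + Real.log n) ^ 2) ∧
      ∀ (X : Type*) (H : Type*) (β : Type*) [MeasurableSpace H] (ν : Measure H)
        [IsProbabilityMeasure ν] (hash : H → X → β) (sim : X → X → ℝ),
        CPSJoin.IsLSHFamily ν hash sim →
        ∀ (n : ℕ), 1 ≤ n → ∀ pts : Fin n → X,
          let run := fun (g : Fin (t n) → H) (ω : CPSJoin.Seeds (Fin (t n) × β)) =>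
            CPSJoin.simJoin hash sim lam limit (R n) pts g ω
          (∀ g ω, CPSJoin.totalOut (run g ω) ⊆ CPSJoin.joinSet sim lam pts) ∧
          (∀ q ∈ CPSJoin.joinSet sim lam pts,
            ENNReal.ofReal φ ≤ CPSJoin.prob ν (t n) (Fin (t n) × β)
              (fun g ω => q ∈ CPSJoin.totalOut (run g ω))) ∧
          CPSJoin.expect ν (t n) (Fin (t n) × β) (fun g ω => CPSJoin.totalTime (run g ω)) ≤
            ENNReal.ofReal
              (C * (1 + Real.log n) ^ c * CPSJoin.individualCost sim lam pts) ∧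
          CPSJoin.expect ν (t n) (Fin (t n) × β) (fun g ω => CPSJoin.totalCmps (run g ω)) ≤
            ENNReal.ofReal (C * R n * CPSJoin.individualCost sim lam pts) ∧
          ∀ a : ℝ, 0 < a →
            CPSJoin.prob ν (t n) (Fin (t n) × β)
              (fun g ω => ENNReal.ofReal (D a * n * (1 + Real.log n) ^ c) <
                CPSJoin.totalSpace (run g ω)) ≤ ENNReal.ofReal ((n : ℝ) ^ (-a)) := by
  refine ⟨CPSJoin.embeddingSize lam φ, CPSJoin.repetitions lam φ, CPSJoin.costConstant lam φ limit,
    CPSJoin.spaceConstant lam φ, 7, fun n _ => ⟨CPSJoin.one_le_embeddingSize hlam hφ.2 n,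
      CPSJoin.embeddingSize_le_costConstant_mul hlam hφ limit n,
      CPSJoin.repetitions_le_costConstant_mul hlam hφ limit n⟩, ?_⟩
  intro X H β _ ν _ hash sim hLSH n hn pts run
  have hsize := CPSJoin.four_mul_sq_le_mul_embeddingSize hlam hφ.2 n
  have hsize_one := CPSJoin.one_le_of_size hsize hlam
  have hW := CPSJoin.le_individualCost (pts := pts) hlam hLSH.nonneg
  refine ⟨fun g ω => CPSJoin.totalOut_subset_joinSet hLSH hlam.2.le _ g ω, fun q hq => ?mem,
    ?time, ?cmps, fun a ha => ?space⟩
  case mem =>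
    exact CPSJoin.le_prob_mem_totalOut hLSH hlam.1 hlimit hsize_one hφ
      (CPSJoin.two_le_depth hlam n) (CPSJoin.depth_sq_le hlam hφ.2 n)
      (CPSJoin.pairsBound_depth_le hlam hn) (CPSJoin.log_le_repetitions_mul hlam hφ n) hq
  case time =>
    exact (CPSJoin.expect_totalTime_le hLSH hlam hlimit hn hsize _).trans
      (ENNReal.ofReal_le_ofReal (CPSJoin.time_le_costConstant_mul hlam hφ limit hn hW))
  case cmps =>
    refine (CPSJoin.expect_totalCmps_le hLSH hlam hlimit hsize _).trans
      (ENNReal.ofReal_le_ofReal ?_)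
    rw [← mul_assoc, mul_comm (CPSJoin.repetitions lam φ n : ℝ)]
    gcongr
    · exact (Nat.cast_nonneg n).trans hW
    · exact CPSJoin.cmpsConstant_le_costConstant hlam hφ limit
  case space =>
    exact (CPSJoin.prob_lt_totalSpace_le hlimit hsize_one _ _
      (CPSJoin.space_le_spaceConstant_mul hlam hφ hn ha.le)).trans
      (ENNReal.ofReal_le_ofReal (CPSJoin.repetitions_mul_pairsBound_le hlam hφ hn ha.le))

/-- The constants depend on `lam`, `φ` and `limit` only. The conclusions are, in this order: the
embedding uses polylogarithmically many hash functions and there are `O(log² n)` repetitions; only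
pairs of the join are reported; each of them is reported with probability at least `φ`; expected
running time; expected number of similarity computations per repetition; working space with high
probability. -/
theorem theorem1 (lam φ : ℝ) (hlam : lam ∈ Set.Ioo (0 : ℝ) 1) (hφ : φ ∈ Set.Ioo (0 : ℝ) 1)
    (limit : ℕ) (hlimit : 1 ≤ limit) :
    ∃ (t R : ℕ → ℕ) (C : ℝ) (D : ℝ → ℝ) (c : ℕ),
      (∀ n : ℕ, 1 ≤ n →
        1 ≤ t n ∧ (t n : ℝ) ≤ C * (1 + Real.log n) ^ c ∧
        (R n : ℝ) ≤ C * (1 + Real.log n) ^ 2) ∧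
      ∀ (X : Type*) (H : Type*) (β : Type*) [MeasurableSpace H] (ν : Measure H)
        [IsProbabilityMeasure ν] (hash : H → X → β) (sim : X → X → ℝ),
        CPSJoin.IsLSHFamily ν hash sim →
        ∀ (n : ℕ), 1 ≤ n → ∀ pts : Fin n → X, Function.Injective pts →
          let run := fun (g : Fin (t n) → H) (ω : CPSJoin.Seeds (Fin (t n) × β)) =>
            CPSJoin.simJoin hash sim lam limit (R n) pts g ω
          (∀ g ω, CPSJoin.totalOut (run g ω) ⊆ CPSJoin.joinSet sim lam pts) ∧
          (∀ q ∈ CPSJoin.joinSet sim lam pts,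
            ENNReal.ofReal φ ≤ CPSJoin.prob ν (t n) (Fin (t n) × β)
              (fun g ω => q ∈ CPSJoin.totalOut (run g ω))) ∧
          CPSJoin.expect ν (t n) (Fin (t n) × β) (fun g ω => CPSJoin.totalTime (run g ω)) ≤
            ENNReal.ofReal
              (C * (1 + Real.log n) ^ c * CPSJoin.individualCost sim lam pts) ∧
          CPSJoin.expect ν (t n) (Fin (t n) × β) (fun g ω => CPSJoin.totalCmps (run g ω)) ≤
            ENNReal.ofReal (C * R n * CPSJoin.individualCost sim lam pts) ∧
          ∀ a : ℝ, 0 < a →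
            CPSJoin.prob ν (t n) (Fin (t n) × β)
              (fun g ω => ENNReal.ofReal (D a * n * (1 + Real.log n) ^ c) <
                CPSJoin.totalSpace (run g ω)) ≤ ENNReal.ofReal ((n : ℝ) ^ (-a)) := by
  obtain ⟨t, R, C, D, c, hsize, hrun⟩ := theorem1_general lam φ hlam hφ limit hlimit
  exact ⟨t, R, C, D, c, hsize, fun X H β _ ν _ hash sim hLSH n hn pts _ =>
    hrun X H β ν hash sim hLSH n hn pts⟩
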